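/- **Setting.** Let $\gamma\in[1,2]$ and let $\bar\rho$ be the density profile of a liquid Lane--Emden star of radius $R>0$: on $[0,R]$ the function $\bar\rho$ is positive and $C^2$, satisfies $\bar\rho'(0)=0$, $\bar\rho(R)=1$, and, with $\Delta=r^{-2}\partial_r(r^2\partial_r)$, $$\tfrac{\gamma}{\gamma-1}\Delta\bar\rho^{\gamma-1}+4\pi\bar\rho=0\ \ (\gamma>1),\qquad \Delta\ln\bar\rho+4\pi\bar\rho=0\ \ (\gamma=1)\qquad\text{on }(0,R);$$ for $r>R$ one sets $\bar\rho=0$. Derivatives at $R$ are one-sided (from inside). Write $\bar\rho(\mathbf x)=\bar\rho(|\mathbf x|)$ and let $B_R\subset\mathbb R^3$ be the ball of radius $R$ about $0$. Let $Y_{lm}$ ($l\in\mathbb N_0$, $m\in\{-l,\dots,l\}$) be the real spherical harmonics, orthonormal in $L^2(S^2)$. For a vector field $\boldsymbol\theta\in H^2(B_R)$ put $$g=\nabla\cdot(\bar\rho\boldsymbol\theta)\ \text{ on } B_R,\qquad \Psi(\mathbf x)=-\frac1{4\pi}\int_{B_R}\frac{g(\mathbf y)}{|\mathbf x-\mathbf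 y|}\,d\mathbf y,$$ let $g_{lm}(r)=\int_{S^2}g(r\omega)Y_{lm}(\omega)\,dS(\omega)$ (defined for almost every $r\in(0,R)$ and identified with its continuous representative on $(0,R]$) and $\Psi_{lm}(r)=\int_{S^2}\Psi(r\omega)Y_{lm}(\omega)\,dS(\omega)$, and $$\Lambda_{lm}=\int_0^R\big(\gamma\bar\rho^{\gamma-2}g_{lm}^2+4\pi g_{lm}\Psi_{lm}\big)r^2\,dr,$$ $$\Gamma_{lm}=-\frac{R^2}{\bar\rho'(R)}\Big(\Big(\gamma+\frac{4\pi R}{\bar\rho'(R)}\frac1{2l+1}\Big)g_{lm}(R)^2+8\pi g_{lm}(R)\Psi_{lm}(R)\Big).$$ **Lemma.** Suppose that $\boldsymbol\theta\in H^2(B_R)$ and that the trace of $\nabla\cdot\boldsymbol\theta$ on $\partial B_R$ vanishes. Then for all $l\ge0$ and $|m|\le l$ the function $g_{lm}$ has a continuous representative on $(0,R]$, and there is a function $\chi_{lm}\in C^1((0,R])$ such that $$g_{lm}=(\bar\rho\chi_{lm})'\,r^{l-1}\ \text{ on }(0,R],\qquad \chi_{lm}'(R)=0,$$ and, all the integrals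 being absolutely convergent, $$\Lambda_{lm}+\Gamma_{lm}=\int_0^R\big(\gamma\bar\rho^{\gamma-2}((\bar\rho\chi_{lm})')^2-4\pi(\bar\rho\chi_{lm})^2\big)r^{2l}\,dr-\gamma\bar\rho'(R)\chi_{lm}(R)^2R^{2l}$$ $$=\int_0^R\big(\gamma\bar\rho^\gamma(\chi_{lm}')^2r^{2l}-2(l-1)(\bar\rho^\gamma)'\chi_{lm}^2r^{2l-1}\big)\,dr.$$ For $l\ge1$ the last integrand is non-negative on $(0,R)$, and hence $\Lambda_{lm}+\Gamma_{lm}\ge0$. -/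

import Mathlib

open MeasureTheory Set Metric Polynomial

noncomputable section

namespace LiquidStar

/-- Three-dimensional Euclidean space. -/
abbrev E3 : Type := EuclideanSpace ℝ (Fin 3)

/-- The unit sphere of `E3`. -/
abbrev S2 : Type := sphere (0 : E3) 1

/-- The surface measure of the unit sphere (of total mass `4π`). -/
abbrev surf : Measure S2 := (volume : Measure E3).toSphere

/-! ### Weak derivatives, Sobolev spaces, traces -/

/-- The classical partial derivative `∂ᵢ φ`. -/
def partialDeriv (i : Fin 3) (φ : E3 → ℝ) (x : E3) : ℝ :=
  fderiv ℝ φ x (EuclideanSpace.single i 1)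

/-- Test functions on `U`: smooth functions with compact support contained in `U`. -/
structure IsTest (U : Set E3) (φ : E3 → ℝ) : Prop where
  smooth : ContDiff ℝ (⊤ : ℕ∞) φ
  compact : HasCompactSupport φ
  support : tsupport φ ⊆ U

/-- `d` is a weak `i`-th partial derivative of `f` on `U`. -/
structure HasWeakPartial (U : Set E3) (f : E3 → ℝ) (i : Fin 3) (d : E3 → ℝ) : Prop where
  locInt : LocallyIntegrableOn f U
  locInt_deriv : LocallyIntegrableOn d U
  eq : ∀ φ : E3 → ℝ, IsTest U φ →
    ∫ x in U, f x * partialDeriv i φ x = - ∫ x in U, d x * φ x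

/-- The Sobolev space `H¹(U)`. -/
def MemH1 (U : Set E3) (f : E3 → ℝ) : Prop :=
  MemLp f 2 (volume.restrict U) ∧
    ∀ i, ∃ d, MemLp d 2 (volume.restrict U) ∧ HasWeakPartial U f i d

/-- The Sobolev space `H²(U)`. -/
def MemH2 (U : Set E3) (f : E3 → ℝ) : Prop :=
  MemLp f 2 (volume.restrict U) ∧ ∀ i, ∃ d, MemH1 U d ∧ HasWeakPartial U f i d

/-- `d` is a weak divergence of the vector field `F` on `U`. -/
structure HasWeakDiv (U : Set E3) (F : E3 → E3) (d : E3 → ℝ) : Prop where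
  locInt : LocallyIntegrableOn F U
  locInt_div : LocallyIntegrableOn d U
  eq : ∀ φ : E3 → ℝ, IsTest U φ →
    ∫ x in U, ∑ i, F x i * partialDeriv i φ x = - ∫ x in U, d x * φ x

open Classical in
/-- The weak divergence of `F` on `U`, which is determined almost everywhere on `U`
(and `0` by convention if there is none). -/
def weakDiv (U : Set E3) (F : E3 → E3) : E3 → ℝ :=
  if h : ∃ d, HasWeakDiv U F d then h.choose else 0

/-- `t` is the trace on `∂B_R` of the function `f ∈ H¹(B_R)`, characterised by the formula
`∫_{B_R} (f div φ + ∇f · φ) dx = ∫_{∂B_R} t φ · n dS` for all smooth vector fields `φ`.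
Here `∂B_R` is parametrised by `ω ↦ R ω`, with `ω` in the unit sphere. -/
def HasTrace (R : ℝ) (f : E3 → ℝ) (t : S2 → ℝ) : Prop :=
  MemLp f 2 (volume.restrict (ball 0 R)) ∧ MemLp t 2 surf ∧
  ∃ G : Fin 3 → E3 → ℝ,
    (∀ i, MemLp (G i) 2 (volume.restrict (ball 0 R)) ∧ HasWeakPartial (ball 0 R) f i (G i)) ∧
    ∀ φ : E3 → E3, ContDiff ℝ (⊤ : ℕ∞) φ →
      ∫ x in ball (0 : E3) R,
          (f x * ∑ i, partialDeriv i (fun y => φ y i) x + ∑ i, G i x * φ x i)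
        = R ^ 2 * ∫ ω : S2, t ω * inner ℝ (φ (R • (ω : E3))) (ω : E3) ∂surf

/-! ### Real spherical harmonics -/

/-- The Legendre polynomial `P_l`, by Rodrigues' formula. -/
def legendreP (l : ℕ) : ℝ[X] :=
  C (1 / (2 ^ l * (l.factorial : ℝ))) * derivative^[l] ((X ^ 2 - 1) ^ l)

/-- The real spherical harmonic `Y_{lm}` on the unit sphere (`|m| ≤ l`), orthonormal in `L²(S²)`.
In spherical coordinates about the third axis, `(sin ϑ)^k exp (i k φ) = (ω₁ + i ω₂)^k`, so that
`Y_{lm}` is `√2 N sin^k ϑ P_l^{(k)}(cos ϑ)` times `cos (k φ)` for `m = k > 0` and times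
`sin (k φ)` for `m = -k < 0`, and `Y_{l0} = N P_l(cos ϑ)`,
with `N = √((2l+1)/(4π) · (l-k)!/(l+k)!)`. -/
def sphY (l : ℕ) (m : ℤ) (ω : S2) : ℝ :=
  let k := m.natAbs
  let N : ℝ := √((2 * l + 1) / (4 * Real.pi) * (((l - k).factorial : ℝ) / ((l + k).factorial : ℝ)))
  let q : ℝ := (derivative^[k] (legendreP l)).eval ((ω : E3) 2)
  let z : ℂ := ((⟨(ω : E3) 0, (ω : E3) 1⟩ : ℂ)) ^ k
  if m = 0 then N * q else if 0 < m then √2 * N * q * z.re else √2 * N * q * z.im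

/-- The spherical-harmonic coefficient `r ↦ ∫_{S²} f(rω) Y_{lm}(ω) dS(ω)` of `f`. -/
def sphCoeff (f : E3 → ℝ) (l : ℕ) (m : ℤ) (r : ℝ) : ℝ :=
  ∫ ω : S2, f (r • (ω : E3)) * sphY l m ω ∂surf

/-! ### The liquid Lane–Emden star -/

/-- The derivative in the radial variable on `[0, R]` (one-sided at the end points). -/
def radDeriv (R : ℝ) (f : ℝ → ℝ) (r : ℝ) : ℝ := derivWithin f (Icc 0 R) r

/-- `γ/(γ-1) s^(γ-1)` for `γ ≠ 1`, and `log s` for `γ = 1`. -/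
def enthalpy (γ s : ℝ) : ℝ :=
  if γ = 1 then Real.log s else γ / (γ - 1) * s ^ (γ - 1)

/-- `ρ` is the density profile, as a function of the radius `r ≥ 0`, of a liquid Lane–Emden star
of radius `R` with adiabatic index `γ`: a positive `C²` solution on `[0, R]` of
`γ/(γ-1) Δ ρ^(γ-1) + 4π ρ = 0` (of `Δ log ρ + 4π ρ = 0` if `γ = 1`), where
`Δ = r⁻² ∂_r (r² ∂_r)`, with `ρ'(0) = 0` and `ρ(R) = 1`, extended by `0` outside of the star.
That `ρ` is decreasing on `[0, R]` is a consequence. -/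
structure IsLiquidLaneEmden (γ R : ℝ) (ρ : ℝ → ℝ) : Prop where
  radius_pos : 0 < R
  smooth : ContDiffOn ℝ 2 ρ (Icc 0 R)
  pos : ∀ r ∈ Icc 0 R, 0 < ρ r
  deriv_zero : radDeriv R ρ 0 = 0
  ode : ∀ r ∈ Ioo 0 R,
    (1 / r ^ 2) * radDeriv R (fun s => s ^ 2 * radDeriv R (fun t => enthalpy γ (ρ t)) s) r
      + 4 * Real.pi * ρ r = 0
  boundary : ρ R = 1
  outside : ∀ r, R < r → ρ r = 0

/-- The operator `𝒦 f(x) = - ∫_{B_R} f(y)/|x-y| dy`. -/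
def gravK (R : ℝ) (f : E3 → ℝ) (x : E3) : ℝ :=
  - ∫ y in ball (0 : E3) R, f y / ‖x - y‖

/-- `g = ∇ · (ρ θ)` on `B_R`. -/
def gField (R : ℝ) (ρ : ℝ → ℝ) (θ : E3 → E3) : E3 → ℝ :=
  weakDiv (ball 0 R) (fun x => ρ ‖x‖ • θ x)

/-- `Ψ = (4π)⁻¹ 𝒦 g`. -/
def PsiField (R : ℝ) (ρ : ℝ → ℝ) (θ : E3 → E3) (x : E3) : ℝ :=
  1 / (4 * Real.pi) * gravK R (gField R ρ θ) x

/-- `u` is the mode `g_{lm}` on `(0, R]`: the continuous representative of the spherical-harmonic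
coefficient of `g`, which is itself determined for almost every radius only. -/
def IsMode (R : ℝ) (g : E3 → ℝ) (l : ℕ) (m : ℤ) (u : ℝ → ℝ) : Prop :=
  ContinuousOn u (Ioc 0 R) ∧ ∀ᵐ r ∂(volume.restrict (Ioo 0 R)), u r = sphCoeff g l m r

/-- The integrand of the bulk energy of a mode. -/
def LambdaIntegrand (γ : ℝ) (ρ u ψ : ℝ → ℝ) (r : ℝ) : ℝ :=
  (γ * ρ r ^ (γ - 2) * u r ^ 2 + 4 * Real.pi * u r * ψ r) * r ^ 2

/-- The bulk energy `Λ_{lm}` of a mode with `g_{lm} = u` and `Ψ_{lm} = ψ`. -/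
def Lambda (γ R : ℝ) (ρ u ψ : ℝ → ℝ) : ℝ :=
  ∫ r in (0 : ℝ)..R, LambdaIntegrand γ ρ u ψ r

/-- The boundary energy `Γ_{lm}` of a mode with `g_{lm} = u` and `Ψ_{lm} = ψ`. -/
def Gamma (γ R : ℝ) (ρ : ℝ → ℝ) (l : ℕ) (u ψ : ℝ → ℝ) : ℝ :=
  - (R ^ 2 / radDeriv R ρ R) *
    ((γ + 4 * Real.pi * R / radDeriv R ρ R * (1 / (2 * l + 1))) * u R ^ 2
      + 8 * Real.pi * u R * ψ R)

/-- The integrand `(γ ρ^(γ-2) ((ρχ)')² - 4π (ρχ)²) r^(2l)`. -/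
def chiIntegrandOne (γ R : ℝ) (ρ : ℝ → ℝ) (l : ℕ) (χ : ℝ → ℝ) (r : ℝ) : ℝ :=
  (γ * ρ r ^ (γ - 2) * radDeriv R (fun s => ρ s * χ s) r ^ 2
    - 4 * Real.pi * (ρ r * χ r) ^ 2) * r ^ (2 * l)

/-- The integrand `γ ρ^γ χ'² r^(2l) - 2 (l-1) (ρ^γ)' χ² r^(2l-1)`. -/
def chiIntegrandTwo (γ R : ℝ) (ρ : ℝ → ℝ) (l : ℕ) (χ : ℝ → ℝ) (r : ℝ) : ℝ :=
  γ * ρ r ^ γ * radDeriv R χ r ^ 2 * r ^ (2 * l)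
    - 2 * ((l : ℝ) - 1) * radDeriv R (fun s => ρ s ^ γ) r * χ r ^ 2 * r ^ (2 * (l : ℤ) - 1)

end LiquidStar

end

/-!
Write `u = g_lm` and `p = r^(1-l) u`. A primitive `w` of `p` is determined up to its value `c` at
`R`, and `χ = w / ρ` satisfies `u = (ρχ)' r^(l-1)` for every `c`; as `ρ(R) = 1` and `ρ'(R) < 0`, the
condition `χ'(R) = 0` amounts to `c = p(R) / ρ'(R)`. What remains is to show that `u` exists as a
function continuous up to `R`, to express `Ψ_lm` through `w`, and to integrate by parts twice.

*The mode of the divergence.* `div (ρθ) = ρ div θ + ρ' θ · x/|x|` holds weakly, since `ρ(|x|)` is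
a `C¹` limit of polynomials in `|x|²` (`hasWeakDiv_radial_smul`). Its angular moments against
`Y_lm` are combinations of moments of the `H¹` functions `∂ᵢθᵢ` and `θᵢ` against smooth weights. Such
a moment has a weak derivative in the radius, because for a test function `φ` on `(0, R)` the
field `|x|⁻³ φ(|x|) κ(x/|x|) x` is smooth, with divergence `|x|⁻² φ'(|x|) κ(x/|x|)`; hence the
moment is continuous up to `R` (`exists_continuousOn_moment`,
`exists_isMode_gField`). Also `r u` is square integrable.

*The mode of the potential.* The expansion
`∫_{S²} Y_lm(ω) / |rω - sη| dS(ω) = 4π/(2l+1) · r_<^l / r_>^(l+1) · Y_lm(η)` is proved without a theory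
of the Laplacian on the sphere. The function `Y_lm` is a multiple of the real or imaginary part of a
coefficient of a polynomial in `τ` whose values are `l`-th powers of isotropic linear forms `L_τ`
(`harmonicGen`, `exists_sphY_eq`). For isotropic `L` the potential on the sphere of the density
`L^l` is found by induction on `l`: the divergence theorem on the sphere gives a first order linear
equation for its dependence on the distance to the centre, with a regular singular point at `0`, and
only one solution is bounded there (`sphere_integral_lineDeriv`, `eq_zero_of_singular_ode`,
`spherePot_isotropic`). Integrating the expansion against `u` and by parts,
`r^(l+1) Ψ_lm(r) = M(r) - c r^(2l+1) / (2l+1)` with `M(r) = ∫₀^r w s^(2l) ds`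
(`pow_mul_sphCoeff_potential`).

*The energy.* The integrand of `Λ_lm` minus `(γ ρ^(γ-2) w'² - 4π w²) r^(2l)` is the derivative of
`4π (w M - c w r^(2l+1) / (2l+1) + c M)`. This vanishes at the origin because
`w = O(r^(-l))` and `M = O(r^(l+1))`, and its value at `R` is cancelled by the potential part of
`Γ_lm` (`Lambda_add_Gamma`). With the enthalpy `h`, so that `h' = γ ρ^(γ-2) ρ'`, the Lane–Emden
equation `(r² h')' = -4π ρ r²` shows that the two integrands in terms of `χ` differ by the derivative
of `h' r^(2l) w² / ρ` (`integral_chiIntegrandTwo`). The same equation gives `h' < 0`, hence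
`(ρ^γ)' = ρ h' < 0`, and with it the sign of the last integrand for `l ≥ 1`.
-/


namespace LiquidStar

open Filter Topology ComplexConjugate

/-! ### Polar coordinates -/

/-- The map `(ω, r) ↦ r ω` carries `dS(ω) r² dr` on `S² × (0, ∞)` to Lebesgue measure. -/
lemma measurePreserving_polar :
    MeasurePreserving (fun p : S2 × ℝ => p.2 • (p.1 : E3))
      (surf.prod ((volume.restrict (Ioi (0 : ℝ))).withDensity fun r => ENNReal.ofReal (r ^ 2)))
      (volume : Measure E3) := by
  have hT : Measurable (fun p : S2 × ℝ => p.2 • (p.1 : E3)) := by fun_prop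
  refine ⟨hT, ?_⟩
  have h1 : Measure.map (Subtype.val : Ioi (0 : ℝ) → ℝ) (Measure.volumeIoiPow 2)
      = (volume.restrict (Ioi (0 : ℝ))).withDensity fun r => ENNReal.ofReal (r ^ 2) := by
    ext s hs
    rw [Measure.map_apply measurable_subtype_coe hs, Measure.volumeIoiPow,
      withDensity_apply _ (measurable_subtype_coe hs), withDensity_apply _ hs]
    rw [← (MeasurableEmbedding.subtype_coe measurableSet_Ioi).lintegral_map
        (μ := (Measure.comap Subtype.val volume).restrict (Subtype.val ⁻¹' s))
        (fun r : ℝ => ENNReal.ofReal (r ^ 2))]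
    congr 1
    rw [← Measure.restrict_map measurable_subtype_coe hs, map_comap_subtype_coe measurableSet_Ioi]
  have h2 := (volume : Measure E3).measurePreserving_homeomorphUnitSphereProd
  have h3 : Module.finrank ℝ E3 - 1 = 2 := by simp
  rw [h3] at h2
  have h4 := h2.symm (homeomorphUnitSphereProd E3).toMeasurableEquiv
  rw [← h1]
  have h6 : surf.prod (Measure.map (Subtype.val : Ioi (0 : ℝ) → ℝ) (Measure.volumeIoiPow 2))
      = Measure.map (Prod.map id Subtype.val) (surf.prod (Measure.volumeIoiPow 2)) := by
    have := Measure.map_prod_map surf (Measure.volumeIoiPow 2) (measurable_id (α := S2))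
      (measurable_subtype_coe (p := fun x : ℝ => x ∈ Ioi (0 : ℝ)))
    rw [← this, Measure.map_id]
  rw [h6, Measure.map_map hT (by fun_prop)]
  have h7 : ((fun p : S2 × ℝ => p.2 • (p.1 : E3)) ∘ Prod.map id (Subtype.val : Ioi (0 : ℝ) → ℝ))
      = Subtype.val ∘ (homeomorphUnitSphereProd E3).toMeasurableEquiv.symm := by
    ext1 p
    simp
  rw [h7, ← Measure.map_map measurable_subtype_coe (MeasurableEquiv.measurable _), h4.map_eq,
    map_comap_subtype_coe (measurableSet_singleton _).compl, restrict_compl_singleton]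

lemma polar_ae {P : E3 → Prop} (h : ∀ᵐ x, P x) :
    ∀ᵐ p ∂(surf.prod (volume.restrict (Ioi (0 : ℝ)))), P (p.2 • (p.1 : E3)) := by
  have h1 := measurePreserving_polar.quasiMeasurePreserving.ae h
  rw [prod_withDensity_right (by fun_prop), ae_withDensity_iff (by fun_prop)] at h1
  have h2 : ∀ᵐ p ∂(surf.prod (volume.restrict (Ioi (0 : ℝ)))), 0 < p.2 :=
    Measure.quasiMeasurePreserving_snd.ae (ae_restrict_mem measurableSet_Ioi)
  filter_upwards [h1, h2] with p hp hp2
  exact hp (by simpa using hp2.ne')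

lemma polar_integrable {V : Type*} [NormedAddCommGroup V] [NormedSpace ℝ V]
    {F : E3 → V} (hF : AEStronglyMeasurable F) :
    Integrable F ↔ Integrable (fun p : S2 × ℝ => p.2 ^ 2 • F (p.2 • (p.1 : E3)))
      (surf.prod (volume.restrict (Ioi (0 : ℝ)))) := by
  rw [← measurePreserving_polar.integrable_comp hF, prod_withDensity_right (by fun_prop),
    integrable_withDensity_iff_integrable_smul' (by fun_prop) (by simp)]
  apply integrable_congr
  filter_upwards with p
  simp [ENNReal.toReal_ofReal (sq_nonneg p.2)]

lemma polar_integral {V : Type*} [NormedAddCommGroup V] [NormedSpace ℝ V]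
    {F : E3 → V} (hF : AEStronglyMeasurable F) :
    ∫ x, F x = ∫ p : S2 × ℝ, p.2 ^ 2 • F (p.2 • (p.1 : E3))
      ∂(surf.prod (volume.restrict (Ioi (0 : ℝ)))) := by
  have h := measurePreserving_polar.map_eq
  have h1 : ∫ x, F x = ∫ x, F x ∂(Measure.map (fun p : S2 × ℝ => p.2 • (p.1 : E3))
      (surf.prod ((volume.restrict (Ioi (0 : ℝ))).withDensity
        fun r => ENNReal.ofReal (r ^ 2)))) := by rw [h]
  rw [h1, integral_map measurePreserving_polar.aemeasurable (by rwa [h]),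
    prod_withDensity_right (by fun_prop),
    integral_withDensity_eq_integral_toReal_smul (by fun_prop) (by simp)]
  apply integral_congr_ae
  filter_upwards with p
  simp [ENNReal.toReal_ofReal (sq_nonneg p.2)]

/-- `p ↦ p.2 • p.1` sends the slab `S² × (0, R)` into the ball, and only this slab of
`S² × (0, ∞)`. -/
lemma smul_sphere_mem_ball {R r : ℝ} (hr : 0 < r) (ω : S2) :
    r • (ω : E3) ∈ ball (0 : E3) R ↔ r < R := by
  have : ‖(ω : E3)‖ = 1 := by simp
  simp [norm_smul, this, abs_of_pos hr]

lemma polar_ball_ae {R : ℝ} {P : E3 → Prop} (h : ∀ᵐ x ∂(volume.restrict (ball (0 : E3) R)), P x) :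
    ∀ᵐ p ∂(surf.prod (volume.restrict (Ioo (0 : ℝ) R))), P (p.2 • (p.1 : E3)) := by
  rw [ae_restrict_iff' measurableSet_ball] at h
  have h1 := polar_ae h
  have hle : surf.prod (volume.restrict (Ioo (0 : ℝ) R)) ≤
      surf.prod (volume.restrict (Ioi (0 : ℝ))) :=
    Measure.prod_mono le_rfl (Measure.restrict_mono (fun x hx => hx.1) le_rfl)
  have h2 : ∀ᵐ p ∂(surf.prod (volume.restrict (Ioo (0 : ℝ) R))), p.2 ∈ Ioo 0 R :=
    Measure.quasiMeasurePreserving_snd.ae (ae_restrict_mem measurableSet_Ioo)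
  filter_upwards [ae_mono hle h1, h2] with p hp hp2
  exact hp ((smul_sphere_mem_ball hp2.1 _).2 hp2.2)

lemma polar_slab {R : ℝ} (F : E3 → ℝ) :
    (fun p : S2 × ℝ => p.2 ^ 2 * (ball (0 : E3) R).indicator F (p.2 • (p.1 : E3)))
      =ᵐ[surf.prod (volume.restrict (Ioi (0 : ℝ)))]
    (univ ×ˢ Iio R).indicator (fun p : S2 × ℝ => p.2 ^ 2 * F (p.2 • (p.1 : E3))) := by
  have h2 : ∀ᵐ p ∂(surf.prod (volume.restrict (Ioi (0 : ℝ)))), 0 < p.2 :=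
    Measure.quasiMeasurePreserving_snd.ae (ae_restrict_mem measurableSet_Ioi)
  filter_upwards [h2] with p hp
  have := smul_sphere_mem_ball (R := R) hp p.1
  by_cases h : p.2 < R
  · rw [indicator_of_mem (this.2 h), indicator_of_mem (by simpa using h)]
  · rw [indicator_of_notMem (fun h' => h (this.1 h')), indicator_of_notMem (by simpa using h)]
    simp

lemma restrict_slab (R : ℝ) : (surf.prod (volume.restrict (Ioi (0 : ℝ)))).restrict (univ ×ˢ Iio R)
    = surf.prod (volume.restrict (Ioo (0 : ℝ) R)) := by
  rw [← Measure.prod_restrict, Measure.restrict_univ, Measure.restrict_restrict measurableSet_Iio,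
    inter_comm, Ioi_inter_Iio]

lemma polar_ball_integrable {R : ℝ} {F : E3 → ℝ}
    (hF : AEStronglyMeasurable F (volume.restrict (ball 0 R))) :
    IntegrableOn F (ball 0 R) ↔ Integrable (fun p : S2 × ℝ => p.2 ^ 2 * F (p.2 • (p.1 : E3)))
      (surf.prod (volume.restrict (Ioo (0 : ℝ) R))) := by
  rw [← integrable_indicator_iff measurableSet_ball, polar_integrable
    ((aestronglyMeasurable_indicator_iff measurableSet_ball).2 hF),
    integrable_congr (by simpa only [smul_eq_mul] using polar_slab F),
    integrable_indicator_iff (MeasurableSet.univ.prod measurableSet_Iio), IntegrableOn,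
    restrict_slab]

lemma polar_ball_integral {R : ℝ} {F : E3 → ℝ}
    (hF : IntegrableOn F (ball 0 R)) :
    ∫ x in ball (0 : E3) R, F x
      = ∫ r in Ioo (0 : ℝ) R, r ^ 2 * ∫ ω : S2, F (r • (ω : E3)) ∂surf := by
  rw [← integral_indicator measurableSet_ball, polar_integral
    ((aestronglyMeasurable_indicator_iff measurableSet_ball).2 hF.aestronglyMeasurable),
    integral_congr_ae (by simpa only [smul_eq_mul] using polar_slab F),
    integral_indicator (MeasurableSet.univ.prod measurableSet_Iio), restrict_slab,
    integral_prod_symm _ ((polar_ball_integrable hF.aestronglyMeasurable).1 hF)]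
  simp_rw [integral_const_mul]

/-! ### The divergence theorem on the sphere for homogeneous functions -/

/-- There is a `C¹` cutoff `φ` on `(0, ∞)`, vanishing outside of `[1, 3]`, together with the moment
identity `∫ φ' r^(d+2) = -(d+2) ∫ φ r^(d+1)`, in which the right hand side is not zero. -/
lemma exists_radial_cutoff (d : ℕ) : ∃ φ : ℝ → ℝ, (∀ r, HasDerivAt φ (deriv φ r) r) ∧
    Continuous φ ∧ Continuous (deriv φ) ∧ (∀ r < 1, φ r = 0) ∧ (∀ r < 1, deriv φ r = 0) ∧
    HasCompactSupport φ ∧ HasCompactSupport (deriv φ) ∧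
    (∫ r in Ioi (0 : ℝ), φ r * r ^ (d + 1)) ≠ 0 ∧
    ∫ r in Ioi (0 : ℝ), deriv φ r * r ^ (d + 2)
      = - (d + 2) * ∫ r in Ioi (0 : ℝ), φ r * r ^ (d + 1) := by
  let φ : ContDiffBump (2 : ℝ) := ⟨1 / 2, 1, by norm_num, by norm_num⟩
  have hd : Differentiable ℝ φ := (φ.contDiff (n := 1)).differentiable (by norm_num)
  have hc : Continuous φ := φ.continuous
  have hc' : Continuous (deriv φ) := (φ.contDiff (n := 1)).continuous_deriv (by norm_num)
  have hz : ∀ r < 1, φ r = 0 := fun r hr => by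
    have : r ∉ Function.support φ := by
      rw [φ.support_eq, Real.ball_eq_Ioo]
      intro h
      have := h.1
      norm_num [φ] at this
      linarith
    simpa using this
  have hz' : ∀ r < 1, deriv φ r = 0 := fun r hr => by
    have : φ =ᶠ[𝓝 r] fun _ => 0 := by
      filter_upwards [Iio_mem_nhds hr] with s hs using hz s hs
    rw [this.deriv_eq]; simp
  have hs := φ.hasCompactSupport
  have hs' : HasCompactSupport (deriv φ) := hs.deriv
  have hfull : ∀ f : ℝ → ℝ, (∀ r < 1, f r = 0) → ∀ n : ℕ,
      ∫ r in Ioi (0 : ℝ), f r * r ^ n = ∫ r, f r * r ^ n := by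
    intro f hf n
    rw [← integral_indicator measurableSet_Ioi]
    congr 1
    ext r
    by_cases h : r ∈ Ioi (0 : ℝ)
    · rw [indicator_of_mem h]
    · rw [indicator_of_notMem h, hf r (by have := notMem_Ioi.1 h; linarith), zero_mul]
  refine ⟨φ, fun r => (hd r).hasDerivAt, hc, hc', hz, hz', hs, hs', ?_, ?_⟩
  · rw [hfull _ hz]
    refine (Continuous.integral_pos_of_hasCompactSupport_nonneg_nonzero (x := 2)
      (by fun_prop) hs.mul_right (fun r => ?_) ?_).ne'
    · rcases lt_or_ge r 1 with h | h
      · simp [hz r h]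
      · have := φ.nonneg (x := r)
        exact mul_nonneg this (by positivity)
    · have : 0 < φ 2 := φ.pos_of_mem_ball (by simp [φ])
      exact mul_ne_zero this.ne' (by positivity)
  · rw [hfull _ hz, hfull _ hz']
    have hder : ∀ r, HasDerivAt (fun r => φ r * r ^ (d + 2))
        (deriv φ r * r ^ (d + 2) + (d + 2) * (φ r * r ^ (d + 1))) r := fun r => by
      refine ((hd r).hasDerivAt.fun_mul (hasDerivAt_pow (d + 2) r)).congr_deriv ?_
      push_cast
      ring_nf
    have hi1 : Integrable (fun r => deriv φ r * r ^ (d + 2)) :=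
      (hc'.mul (by fun_prop)).integrable_of_hasCompactSupport hs'.mul_right
    have hi2 : Integrable (fun r => φ r * r ^ (d + 1)) :=
      (hc.mul (by fun_prop)).integrable_of_hasCompactSupport hs.mul_right
    have hi3 : Integrable (fun r => φ r * r ^ (d + 2)) :=
      (hc.mul (by fun_prop)).integrable_of_hasCompactSupport hs.mul_right
    have := integral_eq_zero_of_hasDerivAt_of_integrable hder
      (hi1.add (hi2.const_mul _)) hi3
    rw [integral_add hi1 (hi2.const_mul _), integral_const_mul] at this
    linarith

lemma hasDerivAt_norm_line {x v : E3} (hx : x ≠ 0) :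
    HasDerivAt (fun t : ℝ => ‖x + t • v‖) (inner ℝ x v / ‖x‖) 0 := by
  have h1 : HasDerivAt (fun t : ℝ => x + t • v) v 0 := by
    simpa using ((hasDerivAt_id (0 : ℝ)).smul_const v).const_add x
  have h2 := h1.norm_sq
  simp only [zero_smul, add_zero] at h2
  have h3 := h2.sqrt (by simpa using hx)
  have hx' : ‖x‖ ≠ 0 := by simpa using hx
  simp only [zero_smul, add_zero, Real.sqrt_sq (norm_nonneg _)] at h3
  convert h3 using 1
  field_simp

/-- For `G` homogeneous of degree `d`, and `C¹` away from the origin, one has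
`∫_{S²} ∂_v G = (d + 2) ∫_{S²} ⟨ω, v⟩ G`: integrate `∂_v (φ(|x|) G)` over the whole space, for a
radial cutoff `φ`, in polar coordinates. -/
lemma sphere_integral_lineDeriv {G G' : E3 → ℂ} {v : E3} {d : ℕ}
    (hG : ContinuousOn G {0}ᶜ) (hG' : ContinuousOn G' {0}ᶜ)
    (hd : ∀ x, x ≠ 0 → HasLineDerivAt ℝ G (G' x) x v)
    (hhom : ∀ (ω : S2) (r : ℝ), 0 < r → G (r • (ω : E3)) = r ^ d * G ω)
    (hhom' : ∀ (ω : S2) (r : ℝ), 0 < r → r * G' (r • (ω : E3)) = r ^ d * G' ω) :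
    ∫ ω : S2, G' ω ∂surf = (d + 2) * ∫ ω : S2, (inner ℝ (ω : E3) v : ℝ) * G ω ∂surf := by
  obtain ⟨φ, hφ, hc, hc', hz, hz', hs, hs', hA, hB⟩ := exists_radial_cutoff d
  have hmeas : ∀ f : E3 → ℂ, ContinuousOn f {0}ᶜ → AEStronglyMeasurable f := fun f hf => by
    have := hf.aestronglyMeasurable (μ := volume) (measurableSet_singleton (0 : E3)).compl
    rwa [restrict_compl_singleton] at this
  have hsph : ∀ f : E3 → ℂ, ContinuousOn f {0}ᶜ → Continuous fun ω : S2 => f ω := fun f hf =>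
    hf.comp_continuous continuous_subtype_val fun ω => by
      simpa using ne_of_mem_sphere ω.2 one_ne_zero
  have hint : ∀ f : S2 → ℂ, Continuous f → Integrable f surf := fun f hf =>
    hf.integrable_of_hasCompactSupport (HasCompactSupport.of_compactSpace f)
  have hcn : ContinuousOn (fun x : E3 => ((inner ℝ x v / ‖x‖ : ℝ) : ℂ)) {0}ᶜ := by
    refine Complex.continuous_ofReal.comp_continuousOn
      (ContinuousOn.div (by fun_prop) (by fun_prop) fun x hx => by simpa using hx)
  set F : E3 → ℂ := fun x => φ ‖x‖ * G x with hF
  set F' : E3 → ℂ := fun x => deriv φ ‖x‖ * ((inner ℝ x v / ‖x‖ : ℝ) : ℂ) * G x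
    + φ ‖x‖ * G' x with hF'
  have hFc : ContinuousOn F {0}ᶜ :=
    (Complex.continuous_ofReal.comp (hc.comp continuous_norm)).continuousOn.mul hG
  have hFc' : ContinuousOn F' {0}ᶜ :=
    (((Complex.continuous_ofReal.comp (hc'.comp continuous_norm)).continuousOn.mul hcn).mul hG).add
    ((Complex.continuous_ofReal.comp (hc.comp continuous_norm)).continuousOn.mul hG')
  have hline : ∀ x, HasLineDerivAt ℝ F (F' x) x v := by
    intro x
    by_cases hx : x = 0
    · have h0 : F' x = 0 := by simp [hF', hx, hz 0, hz' 0]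
      rw [h0]
      have : (fun t : ℝ => F (x + t • v)) =ᶠ[𝓝 0] fun _ => 0 := by
        have hc0 : Continuous fun t : ℝ => ‖x + t • v‖ := by fun_prop
        have : ∀ᶠ t in 𝓝 (0 : ℝ), ‖x + t • v‖ < 1 :=
          hc0.continuousAt.eventually_lt continuousAt_const (by simp [hx])
        filter_upwards [this] with t ht
        simp [hF, hz _ ht]
      exact (hasDerivAt_const (0 : ℝ) (0 : ℂ)).congr_of_eventuallyEq this
    · have h1 : HasDerivAt (fun t : ℝ => φ ‖x + t • v‖)
          (deriv φ ‖x‖ * (inner ℝ x v / ‖x‖)) 0 :=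
        HasDerivAt.comp (0 : ℝ) (h₂ := φ) (by simpa using hφ ‖x‖) (hasDerivAt_norm_line hx)
      have h2 := h1.ofReal_comp.mul (hd x hx)
      refine h2.congr_deriv ?_
      simp [hF']
  -- the two functions in polar coordinates
  have hpol : ∀ (ω : S2) (r : ℝ), 0 < r →
      r ^ 2 • F (r • (ω : E3)) = G ω * ((φ r * r ^ (d + 2) : ℝ) : ℂ) := by
    intro ω r hr
    have hn : ‖r • (ω : E3)‖ = r := by simp [norm_smul, abs_of_pos hr]
    simp only [hF, hn, hhom ω r hr, Complex.real_smul]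
    push_cast
    ring
  have hpol' : ∀ (ω : S2) (r : ℝ), 0 < r → r ^ 2 • F' (r • (ω : E3))
      = (inner ℝ (ω : E3) v : ℝ) * G ω * ((deriv φ r * r ^ (d + 2) : ℝ) : ℂ)
        + G' ω * ((φ r * r ^ (d + 1) : ℝ) : ℂ) := by
    intro ω r hr
    have hn : ‖r • (ω : E3)‖ = r := by simp [norm_smul, abs_of_pos hr]
    have hi : inner ℝ (r • (ω : E3)) v / r = inner ℝ (ω : E3) v := by
      rw [real_inner_smul_left]; field_simp
    simp only [hF', hn, hi, hhom ω r hr, Complex.real_smul]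
    have := hhom' ω r hr
    push_cast
    linear_combination (r * φ r : ℂ) * this
  have hpos : ∀ᵐ p ∂(surf.prod (volume.restrict (Ioi (0 : ℝ)))), 0 < p.2 :=
    Measure.quasiMeasurePreserving_snd.ae (ae_restrict_mem measurableSet_Ioi)
  have hir : ∀ f : ℝ → ℝ, Continuous f → HasCompactSupport f → ∀ n : ℕ,
      Integrable (fun r : ℝ => ((f r * r ^ n : ℝ) : ℂ)) (volume.restrict (Ioi 0)) :=
    fun f hf hfs n => (((hf.mul (by fun_prop)).integrable_of_hasCompactSupport
      hfs.mul_right).ofReal).restrict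
  have hiv : Continuous fun ω : S2 => ((inner ℝ (ω : E3) v : ℝ) : ℂ) * G ω :=
    (by fun_prop : Continuous fun ω : S2 => ((inner ℝ (ω : E3) v : ℝ) : ℂ)).mul (hsph G hG)
  have hI1 := (hint _ hiv).mul_prod (hir _ hc' hs' (d + 2))
  have hI2 := (hint _ (hsph G' hG')).mul_prod (hir _ hc hs (d + 1))
  have hFi : Integrable F := by
    rw [polar_integrable (hmeas F hFc)]
    refine ((hint _ (hsph G hG)).mul_prod (hir _ hc hs (d + 2))).congr ?_
    filter_upwards [hpos] with p hp using (hpol p.1 p.2 hp).symm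
  have hFi' : Integrable F' := by
    rw [polar_integrable (hmeas F' hFc')]
    refine (hI1.add hI2).congr ?_
    filter_upwards [hpos] with p hp using (hpol' p.1 p.2 hp).symm
  have hzero : ∫ x, F' x = 0 := by
    have := integral_bilinear_hasLineDerivAt_right_eq_neg_left_of_integrable (μ := volume)
      (f := fun _ : E3 => (1 : ℂ)) (f' := fun _ => 0) (g := F) (g' := F') (v := v)
      (B := ContinuousLinearMap.mul ℝ ℂ) (by simp) (by simpa using hFi') (by simpa using hFi)
      (fun x _ => by simpa [HasLineDerivAt] using hasDerivAt_const (0 : ℝ) (1 : ℂ))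
      (fun x _ => hline x)
    simpa using this
  rw [polar_integral (hmeas F' hFc'), integral_congr_ae
    (by filter_upwards [hpos] with p hp using hpol' p.1 p.2 hp), integral_add hI1 hI2,
    integral_prod_mul (μ := surf) (fun ω : S2 => ((inner ℝ (ω : E3) v : ℝ) : ℂ) * G ω)
      (fun r : ℝ => ((deriv φ r * r ^ (d + 2) : ℝ) : ℂ)),
    integral_prod_mul (μ := surf) (fun ω : S2 => G' ω)
      (fun r : ℝ => ((φ r * r ^ (d + 1) : ℝ) : ℂ)), integral_complex_ofReal,
    integral_complex_ofReal, hB] at hzero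
  have hA' : ((∫ r in Ioi (0 : ℝ), φ r * r ^ (d + 1) : ℝ) : ℂ) ≠ 0 := by exact_mod_cast hA
  apply mul_right_cancel₀ hA'
  push_cast at hzero ⊢
  linear_combination hzero

/-! ### Powers of isotropic linear forms against the Newtonian kernel -/

/-- The complex linear form `x ↦ ∑ aᵢ xᵢ` on `E3`. If `∑ aᵢ² = 0` (the form is isotropic), all its
powers are harmonic. -/
def linForm (a : Fin 3 → ℂ) (x : E3) : ℂ := ∑ i, a i * (x i : ℂ)

@[fun_prop]
lemma continuous_linForm (a : Fin 3 → ℂ) : Continuous (linForm a) := by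
  unfold linForm; fun_prop

lemma linForm_smul (a : Fin 3 → ℂ) (r : ℝ) (x : E3) : linForm a (r • x) = r * linForm a x := by
  simp only [linForm, PiLp.smul_apply, smul_eq_mul, Complex.ofReal_mul, Finset.mul_sum]
  exact Finset.sum_congr rfl fun i _ => by ring

lemma linForm_add (a : Fin 3 → ℂ) (x y : E3) : linForm a (x + y) = linForm a x + linForm a y := by
  simp only [linForm, PiLp.add_apply, Complex.ofReal_add, mul_add, Finset.sum_add_distrib]

lemma integrable_sphere {f : S2 → ℂ} (hf : Continuous f) : Integrable f surf :=
  hf.integrable_of_hasCompactSupport (HasCompactSupport.of_compactSpace f)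

lemma inner_div_norm_mem {x η : E3} (hη : ‖η‖ = 1) : inner ℝ x η / ‖x‖ ∈ Icc (-1 : ℝ) 1 := by
  have := abs_real_inner_div_norm_mul_norm_le_one x η
  rw [hη, mul_one] at this
  exact abs_le.1 this

lemma inner_sphere_mem {η : E3} (hη : ‖η‖ = 1) (ω : S2) :
    inner ℝ (ω : E3) η ∈ Icc (-1 : ℝ) 1 := by
  simpa using inner_div_norm_mem (x := (ω : E3)) hη

/-- `sphere_integral_lineDeriv` for the function `f(⟨x, η⟩/|x|) L(x)^n`, homogeneous of
degree `n`. -/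
lemma zonal_lineDeriv {f f' : ℝ → ℝ} (hf : ∀ c ∈ Icc (-1 : ℝ) 1, HasDerivAt f (f' c) c)
    (hf' : ContinuousOn f' (Icc (-1) 1)) {η : E3} (hη : ‖η‖ = 1) (a : Fin 3 → ℂ) (n : ℕ) (v : E3) :
    ∫ ω : S2, ((f' (inner ℝ (ω : E3) η) * (inner ℝ v η - inner ℝ (ω : E3) η * inner ℝ (ω : E3) v) :
        ℝ) * linForm a ω ^ n
      + (f (inner ℝ (ω : E3) η) : ℂ) * (n * linForm a ω ^ (n - 1) * linForm a v)) ∂surf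
    = (n + 2) * ∫ ω : S2, (inner ℝ (ω : E3) v : ℝ) *
        ((f (inner ℝ (ω : E3) η) : ℂ) * linForm a ω ^ n) ∂surf := by
  have hfc : ContinuousOn f (Icc (-1) 1) := fun c hc => (hf c hc).continuousAt.continuousWithinAt
  have hu : ContinuousOn (fun x : E3 => inner ℝ x η / ‖x‖) {0}ᶜ :=
    ContinuousOn.div (by fun_prop) (by fun_prop) fun x hx => by simpa using hx
  have hmap : MapsTo (fun x : E3 => inner ℝ x η / ‖x‖) {0}ᶜ (Icc (-1) 1) :=
    fun x _ => inner_div_norm_mem hη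
  have hw : ContinuousOn (fun x : E3 => inner ℝ v η / ‖x‖ - inner ℝ x η * inner ℝ x v / ‖x‖ ^ 3)
      {0}ᶜ :=
    (ContinuousOn.div (by fun_prop) (by fun_prop) fun x hx => by simpa using hx).sub
      (ContinuousOn.div (by fun_prop) (by fun_prop) fun x hx => by simpa using hx)
  have hF1 : ContinuousOn (fun x : E3 => ((f (inner ℝ x η / ‖x‖) : ℝ) : ℂ)) {0}ᶜ :=
    Complex.continuous_ofReal.comp_continuousOn (hfc.comp hu hmap)
  have hF2 : ContinuousOn (fun x : E3 => ((f' (inner ℝ x η / ‖x‖) *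
        (inner ℝ v η / ‖x‖ - inner ℝ x η * inner ℝ x v / ‖x‖ ^ 3) : ℝ) : ℂ)) {0}ᶜ :=
    Complex.continuous_ofReal.comp_continuousOn ((hf'.comp hu hmap).mul hw)
  have hL1 : Continuous (fun x : E3 => linForm a x ^ n) := by fun_prop
  have hL2 : Continuous (fun x : E3 => (n : ℂ) * linForm a x ^ (n - 1) * linForm a v) := by
    fun_prop
  have key := sphere_integral_lineDeriv (d := n) (v := v)
    (G := fun x => (f (inner ℝ x η / ‖x‖) : ℂ) * linForm a x ^ n)
    (G' := fun x => (f' (inner ℝ x η / ‖x‖) *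
        (inner ℝ v η / ‖x‖ - inner ℝ x η * inner ℝ x v / ‖x‖ ^ 3) : ℝ) * linForm a x ^ n
      + (f (inner ℝ x η / ‖x‖) : ℂ) * (n * linForm a x ^ (n - 1) * linForm a v))
    (hF1.mul hL1.continuousOn) ((hF2.mul hL1.continuousOn).add (hF1.mul hL2.continuousOn))
    ?_ ?_ ?_
  · simpa using key
  · intro x hx
    have hx' : ‖x‖ ≠ 0 := by simpa using hx
    have h1 : HasDerivAt (fun t : ℝ => inner ℝ (x + t • v) η) (inner ℝ v η) 0 := by
      have : HasDerivAt (fun t : ℝ => x + t • v) v 0 := by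
        simpa using ((hasDerivAt_id (0 : ℝ)).smul_const v).const_add x
      simpa using this.inner ℝ (hasDerivAt_const (0 : ℝ) η)
    have h2 := h1.div (hasDerivAt_norm_line (v := v) hx) (by simpa using hx)
    have h3 := HasDerivAt.comp (0 : ℝ) (h₂ := f)
      (by simpa using hf _ (inner_div_norm_mem (x := x) hη)) h2
    have h4 : HasDerivAt (fun t : ℝ => linForm a (x + t • v)) (linForm a v) 0 := by
      have h : ∀ t : ℝ, linForm a (x + t • v) = linForm a x + t * linForm a v := fun t => by
        rw [linForm_add, linForm_smul]
      simp only [h]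
      simpa using ((hasDerivAt_id (0 : ℝ)).ofReal_comp.mul_const (linForm a v)).const_add
        (linForm a x)
    refine (h3.ofReal_comp.mul (h4.pow n)).congr_deriv ?_
    simp only [zero_smul, add_zero, Function.comp, Pi.div_apply, Pi.pow_apply]
    congr 3
    field_simp
  · intro ω r hr
    have hn : ‖r • (ω : E3)‖ = r := by simp [norm_smul, abs_of_pos hr]
    simp only [hn, linForm_smul, real_inner_smul_left, mul_div_cancel_left₀ _ hr.ne']
    simp
    ring
  · intro ω r hr
    have hn : ‖r • (ω : E3)‖ = r := by simp [norm_smul, abs_of_pos hr]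
    have hr' : (r : ℂ) ≠ 0 := by exact_mod_cast hr.ne'
    simp only [hn, linForm_smul, real_inner_smul_left, mul_div_cancel_left₀ _ hr.ne']
    rcases n with _ | n
    · simp
      field_simp
    · simp
      field_simp
      ring

/-- The identity `∑ aᵢ ∂ᵢ (f(⟨x, η⟩/|x|) L(x)^n)` leads to; the isotropy of `L` removes the
derivative of `L ^ n`. -/
lemma zonal_isotropic {f f' : ℝ → ℝ} (hf : ∀ c ∈ Icc (-1 : ℝ) 1, HasDerivAt f (f' c) c)
    (hf' : ContinuousOn f' (Icc (-1) 1)) {η : E3} (hη : ‖η‖ = 1) {a : Fin 3 → ℂ}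
    (ha : ∑ i, a i ^ 2 = 0) (n : ℕ) :
    ∫ ω : S2, (f' (inner ℝ (ω : E3) η) : ℂ) *
        (linForm a η - (inner ℝ (ω : E3) η : ℝ) * linForm a ω) * linForm a ω ^ n ∂surf
    = (n + 2) * ∫ ω : S2, (f (inner ℝ (ω : E3) η) : ℂ) * linForm a ω ^ (n + 1) ∂surf := by
  have hfc : ContinuousOn f (Icc (-1) 1) := fun c hc => (hf c hc).continuousAt.continuousWithinAt
  have hc1 : Continuous fun ω : S2 => f (inner ℝ (ω : E3) η) :=
    hfc.comp_continuous (by fun_prop) fun ω => inner_sphere_mem hη ω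
  have hc2 : Continuous fun ω : S2 => f' (inner ℝ (ω : E3) η) :=
    hf'.comp_continuous (by fun_prop) fun ω => inner_sphere_mem hη ω
  have key := Finset.sum_congr (rfl : (Finset.univ : Finset (Fin 3)) = _) fun i _ =>
    congrArg (a i * ·) (zonal_lineDeriv hf hf' hη a n (EuclideanSpace.single i (1 : ℝ)))
  simp_rw [mul_left_comm _ ((n : ℂ) + 2), ← Finset.mul_sum, ← integral_const_mul] at key
  have hC1 : Continuous fun ω : S2 => (f (inner ℝ (ω : E3) η) : ℂ) :=
    Complex.continuous_ofReal.comp hc1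
  have hC2 : ∀ v : E3, Continuous fun ω : S2 => ((f' (inner ℝ (ω : E3) η) *
      (inner ℝ v η - inner ℝ (ω : E3) η * inner ℝ (ω : E3) v) : ℝ) : ℂ) := fun v =>
    Complex.continuous_ofReal.comp (hc2.mul (by fun_prop))
  have hL : ∀ k : ℕ, Continuous fun ω : S2 => linForm a ω ^ k := fun k => by fun_prop
  rw [← integral_finsetSum, ← integral_finsetSum] at key
  rotate_left
  · exact fun i _ => integrable_sphere (continuous_const.mul
      (Continuous.mul (by fun_prop) (hC1.mul (hL n))))
  · exact fun i _ => integrable_sphere (continuous_const.mul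
      (((hC2 _).mul (hL n)).add (hC1.mul ((continuous_const.mul (hL _)).mul continuous_const))))
  have hs : ∀ i, linForm a (EuclideanSpace.single i (1 : ℝ)) = a i := by
    intro i
    simp [linForm, apply_ite Complex.ofReal]
  simp only [hs] at key
  refine Eq.trans (integral_congr_ae (.of_forall fun ω => ?_))
    (key.trans (congrArg _ (integral_congr_ae (.of_forall fun ω => ?_))))
  · simp only [Fin.sum_univ_three] at ha ⊢
    simp only [linForm, Fin.sum_univ_three, EuclideanSpace.inner_single_left,
      EuclideanSpace.inner_single_right]
    push_cast
    simp only [conj_trivial, Complex.ofReal_one, one_mul]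
    linear_combination (- (f (inner ℝ (ω : E3) η) : ℂ) * (n * (a 0 * ((ω : E3) 0 : ℂ) +
      a 1 * ((ω : E3) 1 : ℂ) + a 2 * ((ω : E3) 2 : ℂ)) ^ (n - 1))) * ha
  · simp only [EuclideanSpace.inner_single_right, one_mul, pow_succ]
    simp only [linForm, Fin.sum_univ_three, conj_trivial]
    ring

/-- The distance `√(1 - 2tc + t²)` of the points `ω` and `t η`, where `ω` and `η` are unit vectors
with `⟨ω, η⟩ = c`. -/
noncomputable def chord (t c : ℝ) : ℝ := √(1 - 2 * t * c + t ^ 2)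

lemma le_chord_sq {t c : ℝ} (hc : c ∈ Icc (-1 : ℝ) 1) :
    (1 - |t|) ^ 2 ≤ 1 - 2 * t * c + t ^ 2 := by
  have h1 : t * c ≤ |t| := by
    calc t * c ≤ |t * c| := le_abs_self _
      _ = |t| * |c| := abs_mul _ _
      _ ≤ |t| * 1 := by gcongr; exact abs_le.2 hc
      _ = |t| := mul_one _
  nlinarith [sq_abs t]

lemma chord_sq_pos {t c : ℝ} (ht : |t| < 1) (hc : c ∈ Icc (-1 : ℝ) 1) :
    0 < 1 - 2 * t * c + t ^ 2 :=
  lt_of_lt_of_le (pow_pos (by linarith) 2) (le_chord_sq hc)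

lemma chord_pos {t c : ℝ} (ht : |t| < 1) (hc : c ∈ Icc (-1 : ℝ) 1) : 0 < chord t c :=
  Real.sqrt_pos.2 (chord_sq_pos ht hc)

lemma chord_sq {t c : ℝ} (ht : |t| < 1) (hc : c ∈ Icc (-1 : ℝ) 1) :
    chord t c ^ 2 = 1 - 2 * t * c + t ^ 2 :=
  Real.sq_sqrt (chord_sq_pos ht hc).le

lemma le_chord {t c : ℝ} (hc : c ∈ Icc (-1 : ℝ) 1) : 1 - |t| ≤ chord t c :=
  Real.le_sqrt_of_sq_le (le_chord_sq hc)

lemma hasDerivAt_chord_right {t c : ℝ} (ht : |t| < 1) (hc : c ∈ Icc (-1 : ℝ) 1) :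
    HasDerivAt (chord t) (-t / chord t c) c := by
  have h : HasDerivAt (fun c => 1 - 2 * t * c + t ^ 2) (-(2 * t)) c := by
    simpa using (((hasDerivAt_id c).const_mul (2 * t)).const_sub 1).add_const (t ^ 2)
  refine (h.sqrt (chord_sq_pos ht hc).ne').congr_deriv ?_
  have := (chord_pos ht hc).ne'
  unfold chord at this ⊢
  field_simp

lemma hasDerivAt_chord_left {t c : ℝ} (ht : |t| < 1) (hc : c ∈ Icc (-1 : ℝ) 1) :
    HasDerivAt (fun t => chord t c) ((t - c) / chord t c) t := by
  have h : HasDerivAt (fun t => 1 - 2 * t * c + t ^ 2) (2 * (t - c)) t := by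
    have h1 := ((((hasDerivAt_id t).const_mul 2).mul_const c).const_sub 1).add (hasDerivAt_pow 2 t)
    refine h1.congr_deriv ?_
    simp
    ring
  refine (h.sqrt (chord_sq_pos ht hc).ne').congr_deriv ?_
  have := (chord_pos ht hc).ne'
  unfold chord at this ⊢
  field_simp

lemma hasDerivAt_inv_chord_left {t c : ℝ} (ht : |t| < 1) (hc : c ∈ Icc (-1 : ℝ) 1) :
    HasDerivAt (fun t => (chord t c)⁻¹) ((c - t) / chord t c ^ 3) t := by
  have h0 := (chord_pos ht hc).ne'
  refine ((hasDerivAt_chord_left ht hc).fun_inv h0).congr_deriv ?_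
  field_simp
  ring

lemma hasDerivAt_inv_chord_right {t c : ℝ} (ht : |t| < 1) (hc : c ∈ Icc (-1 : ℝ) 1) :
    HasDerivAt (fun c => (chord t c)⁻¹) (t / chord t c ^ 3) c := by
  have h0 := (chord_pos ht hc).ne'
  refine ((hasDerivAt_chord_right ht hc).fun_inv h0).congr_deriv ?_
  field_simp

lemma continuous_chord_right (t : ℝ) : Continuous (chord t) := by
  unfold chord; fun_prop

lemma continuous_chord_sphere (t : ℝ) (η : E3) :
    Continuous fun ω : S2 => chord t (inner ℝ (ω : E3) η) :=
  (continuous_chord_right t).comp (by fun_prop)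

lemma continuous_div_chord_pow {t : ℝ} (ht : |t| < 1) {η : E3} (hη : ‖η‖ = 1) {u : S2 → ℝ}
    (hu : Continuous u) (n : ℕ) :
    Continuous fun ω : S2 => ((u ω / chord t (inner ℝ (ω : E3) η) ^ n : ℝ) : ℂ) :=
  Complex.continuous_ofReal.comp (hu.div ((continuous_chord_sphere t η).pow n) fun ω =>
    pow_ne_zero _ (chord_pos ht (inner_sphere_mem hη ω)).ne')

lemma continuous_inv_chord {t : ℝ} (ht : |t| < 1) {η : E3} (hη : ‖η‖ = 1) :
    Continuous fun ω : S2 => (((chord t (inner ℝ (ω : E3) η))⁻¹ : ℝ) : ℂ) :=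
  Complex.continuous_ofReal.comp ((continuous_chord_sphere t η).inv₀ fun ω =>
    (chord_pos ht (inner_sphere_mem hη ω)).ne')

/-- The potential at `t η` of the density `w` on the unit sphere. -/
noncomputable def spherePot (η : E3) (w : S2 → ℂ) (t : ℝ) : ℂ :=
  ∫ ω : S2, (((chord t (inner ℝ (ω : E3) η))⁻¹ : ℝ) : ℂ) * w ω ∂surf

lemma hasDerivAt_spherePot {η : E3} (hη : ‖η‖ = 1) {w : S2 → ℂ} (hw : Continuous w) {t : ℝ}
    (ht : |t| < 1) : HasDerivAt (spherePot η w)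
      (∫ ω : S2, (((inner ℝ (ω : E3) η - t) / chord t (inner ℝ (ω : E3) η) ^ 3 : ℝ) : ℂ)
        * w ω ∂surf) t := by
  set δ := (1 - |t|) / 2 with hδ
  have hδ0 : 0 < δ := by rw [hδ]; linarith
  have hball : ∀ s ∈ ball t δ, |s| < 1 - δ := fun s hs => by
    have h1 : |s - t| < δ := by simpa [Real.dist_eq] using hs
    have h2 : |s| ≤ |s - t| + |t| := by simpa using abs_add_le (s - t) t
    have h3 : |t| = 1 - 2 * δ := by rw [hδ]; ring
    linarith
  have hball' : ∀ s ∈ ball t δ, |s| < 1 := fun s hs => by linarith [hball s hs]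
  refine (hasDerivAt_integral_of_dominated_loc_of_deriv_le (μ := surf)
    (F := fun s (ω : S2) => (((chord s (inner ℝ (ω : E3) η))⁻¹ : ℝ) : ℂ) * w ω)
    (F' := fun s (ω : S2) =>
      (((inner ℝ (ω : E3) η - s) / chord s (inner ℝ (ω : E3) η) ^ 3 : ℝ) : ℂ) * w ω)
    (bound := fun ω => 2 / δ ^ 3 * ‖w ω‖) (ball_mem_nhds t hδ0) ?_ ?_ ?_ ?_ ?_ ?_).2
  · filter_upwards [ball_mem_nhds t hδ0] with s hs
    exact ((continuous_inv_chord (hball' s hs) hη).mul hw).aestronglyMeasurable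
  · exact integrable_sphere ((continuous_inv_chord ht hη).mul hw)
  · exact ((continuous_div_chord_pow ht hη (by fun_prop) 3).mul hw).aestronglyMeasurable
  · refine .of_forall fun ω s hs => ?_
    have hc := inner_sphere_mem hη ω
    have h1 : δ ≤ chord s (inner ℝ (ω : E3) η) := by
      linarith [le_chord (t := s) hc, hball s hs]
    rw [norm_mul, Complex.norm_real, Real.norm_eq_abs, abs_div,
      abs_of_pos (pow_pos (chord_pos (hball' s hs) hc) 3)]
    gcongr
    have h3 : |inner ℝ (ω : E3) η - s| ≤ |inner ℝ (ω : E3) η| + |s| := abs_sub _ _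
    have h4 : |inner ℝ (ω : E3) η| ≤ 1 := abs_le.2 hc
    linarith [hball' s hs]
  · exact (hw.norm.integrable_of_hasCompactSupport
      (HasCompactSupport.of_compactSpace _)).const_mul _
  · refine .of_forall fun ω s hs => ?_
    exact ((hasDerivAt_inv_chord_left (hball' s hs)
      (inner_sphere_mem hη ω)).ofReal_comp).mul_const _

/-- The potential of the uniform density is constant inside the sphere: with `S = chord t c` the
derivative `(c - t)/S³` of its integrand is `(1 - c²) f' - 2 c f` for `f = -1/(S (1 - tc + S))`. -/
lemma integral_deriv_spherePot_one {η : E3} (hη : ‖η‖ = 1) {t : ℝ} (ht : |t| < 1) :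
    ∫ ω : S2, (((inner ℝ (ω : E3) η - t) / chord t (inner ℝ (ω : E3) η) ^ 3 : ℝ) : ℂ) ∂surf
      = 0 := by
  have hp : ∀ c ∈ Icc (-1 : ℝ) 1, 0 < 1 - t * c + chord t c := fun c hc => by
    have h1 : t * c ≤ |t| := by
      calc t * c ≤ |t * c| := le_abs_self _
        _ = |t| * |c| := abs_mul _ _
        _ ≤ |t| * 1 := by gcongr; exact abs_le.2 hc
        _ = |t| := mul_one _
    linarith [chord_pos ht hc]
  set f : ℝ → ℝ := fun c => -(chord t c * (1 - t * c + chord t c))⁻¹ with hfdef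
  set f' : ℝ → ℝ := fun c => -(t * (1 - t * c + 2 * chord t c + chord t c ^ 2)) /
    (chord t c ^ 3 * (1 - t * c + chord t c) ^ 2) with hfdef'
  have hf : ∀ c ∈ Icc (-1 : ℝ) 1, HasDerivAt f (f' c) c := fun c hc => by
    have h0 := (chord_pos ht hc).ne'
    have h1 := (hp c hc).ne'
    have h2 := hasDerivAt_chord_right ht hc
    have h3 : HasDerivAt (fun c => 1 - t * c) (-t) c := by
      simpa using ((hasDerivAt_id c).const_mul t).const_sub 1
    refine (((h2.fun_mul (h3.fun_add h2)).fun_inv (mul_ne_zero h0 h1)).fun_neg).congr_deriv ?_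
    simp only [hfdef']
    field_simp
    ring
  have hf' : ContinuousOn f' (Icc (-1) 1) := by
    have := continuous_chord_right t
    refine ContinuousOn.div (by fun_prop) (by fun_prop) fun c hc => ?_
    have h0 := (chord_pos ht hc).ne'
    have h1 := (hp c hc).ne'
    positivity
  have key := zonal_lineDeriv hf hf' hη 0 0 η
  have hfc : ContinuousOn f (Icc (-1) 1) := fun c hc => (hf c hc).continuousAt.continuousWithinAt
  have hc1 : Continuous fun ω : S2 => f (inner ℝ (ω : E3) η) :=
    hfc.comp_continuous (by fun_prop) fun ω => inner_sphere_mem hη ω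
  have hc2 : Continuous fun ω : S2 => f' (inner ℝ (ω : E3) η) :=
    hf'.comp_continuous (by fun_prop) fun ω => inner_sphere_mem hη ω
  have hηη : inner ℝ η η = (1 : ℝ) := by rw [real_inner_self_eq_norm_sq, hη]; norm_num
  simp only [pow_zero, mul_one, Nat.cast_zero, zero_mul, mul_zero, add_zero, zero_add, hηη] at key
  rw [← integral_const_mul] at key
  have hA : Continuous fun ω : S2 => ((f' (inner ℝ (ω : E3) η) *
      (1 - inner ℝ (ω : E3) η * inner ℝ (ω : E3) η) : ℝ) : ℂ) :=
    Complex.continuous_ofReal.comp (hc2.mul (by fun_prop))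
  have hB : Continuous fun ω : S2 => (2 : ℂ) * (((inner ℝ (ω : E3) η : ℝ) : ℂ) *
      ((f (inner ℝ (ω : E3) η) : ℝ) : ℂ)) :=
    continuous_const.mul (Continuous.mul (by fun_prop) (Complex.continuous_ofReal.comp hc1))
  rw [← sub_eq_zero, ← integral_sub (integrable_sphere hA) (integrable_sphere hB)] at key
  rw [← key]
  refine integral_congr_ae (.of_forall fun ω => ?_)
  have hc := inner_sphere_mem hη ω
  simp only [hfdef, hfdef']
  generalize (inner ℝ (ω : E3) η : ℝ) = c at hc
  have h0 := (chord_pos ht hc).ne'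
  have h1 := (hp c hc).ne'
  have hS := chord_sq ht hc
  obtain ⟨V, hV⟩ : ∃ V, V = 1 - t * c + chord t c := ⟨_, rfl⟩
  have hV' : 1 - t * c + 2 * chord t c + chord t c ^ 2 = V + chord t c + chord t c ^ 2 := by
    rw [hV]; ring
  rw [hV', ← hV]
  rw [← hV] at h1
  norm_cast
  field_simp
  rw [hV]
  linear_combination
    (-(2 * c * chord t c + (-(1 - c ^ 2) * t + 2 * c * (1 - t * c) - (c - t)))) * hS

lemma surf_univ : surf.real univ = 4 * Real.pi := by
  rw [Measure.toSphere_real_apply_univ, Measure.real, EuclideanSpace.volume_ball_fin_three]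
  have : (0 : ℝ) ≤ Real.pi := Real.pi_pos.le
  simp only [ENNReal.toReal_mul, ENNReal.toReal_pow, ENNReal.ofReal_one, ENNReal.toReal_one]
  rw [ENNReal.toReal_ofReal (by positivity)]
  simp
  ring

lemma spherePot_one {η : E3} (hη : ‖η‖ = 1) {t : ℝ} (ht : t ∈ Ico (0 : ℝ) 1) :
    spherePot η (fun _ => 1) t = 4 * Real.pi := by
  have hd : ∀ s ∈ Ico (0 : ℝ) 1, HasDerivAt (spherePot η fun _ => 1) 0 s := fun s hs => by
    have hs' : |s| < 1 := by rw [abs_of_nonneg hs.1]; exact hs.2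
    have := hasDerivAt_spherePot hη (w := fun _ => 1) continuous_const hs'
    simp only [mul_one] at this
    rwa [integral_deriv_spherePot_one hη hs'] at this
  have h0 : spherePot η (fun _ => 1) 0 = 4 * Real.pi := by
    simp only [spherePot, chord]
    simp [-Measure.toSphere_real_apply_univ, surf_univ]
  rw [← h0]
  refine constant_of_has_deriv_right_zero (a := 0) (b := t) (fun s hs => ?_) (fun s hs => ?_) t
    ⟨ht.1, le_rfl⟩
  · exact (hd s ⟨hs.1, hs.2.trans_lt ht.2⟩).continuousAt.continuousWithinAt
  · exact (hd s ⟨hs.1, hs.2.trans ht.2⟩).hasDerivWithinAt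

/-- A first order linear equation with a regular singular point at `0`, all of whose solutions but
`0` are unbounded at `0`. The integrating factor is `t^(n+1) (1 + t²)^(-(2n+1)/2)`. -/
lemma eq_zero_of_singular_ode {n : ℕ} (hn : n ≠ 0) {δ δ' : ℝ → ℂ}
    (hd : ∀ t ∈ Ico (0 : ℝ) 1, HasDerivAt δ (δ' t) t)
    (hode : ∀ t ∈ Ioo (0 : ℝ) 1, (t * (1 + t ^ 2) : ℂ) * δ' t + ((n + 1) - n * t ^ 2) * δ t = 0)
    {t : ℝ} (ht : t ∈ Ioo (0 : ℝ) 1) : δ t = 0 := by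
  set W : ℝ → ℝ := fun s => √(1 + s ^ 2) with hWdef
  have hWp : ∀ s, 0 < W s := fun s => Real.sqrt_pos.2 (by positivity)
  have hWs : ∀ s, W s ^ 2 = 1 + s ^ 2 := fun s => Real.sq_sqrt (by positivity)
  have hW : ∀ s, HasDerivAt W (s / W s) s := fun s => by
    have h := ((hasDerivAt_pow 2 s).const_add 1).sqrt (by positivity)
    refine h.congr_deriv ?_
    have := (hWp s).ne'
    simp only [hWdef] at this ⊢
    field_simp
    norm_num
  set m : ℝ → ℝ := fun s => s ^ (n + 1) / W s ^ (2 * n + 1) with hm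
  have hmd : ∀ s, HasDerivAt m (s ^ n / W s ^ (2 * n + 3) * ((n + 1) - n * s ^ 2)) s := fun s => by
    have h0 := (hWp s).ne'
    refine ((hasDerivAt_pow (n + 1) s).fun_div ((hW s).fun_pow (2 * n + 1))
      (pow_ne_zero _ h0)).congr_deriv ?_
    have e1 : 2 * n + 1 - 1 = 2 * n := by omega
    have e2 : n + 1 - 1 = n := by omega
    rw [e1, e2]
    have e3 : ((n : ℝ) + 1) - n * s ^ 2 = (n + 1) * W s ^ 2 - (2 * n + 1) * s ^ 2 := by
      rw [hWs]; ring
    rw [e3]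
    push_cast
    field_simp
    ring
  have hE : ∀ s ∈ Ico (0 : ℝ) 1, HasDerivAt (fun s => (m s : ℂ) * δ s) 0 s := fun s hs => by
    refine ((hmd s).ofReal_comp.fun_mul (hd s hs)).congr_deriv ?_
    rcases hs.1.eq_or_lt with h | h
    · simp [← h, hm, hn]
    · have h1 := hode s ⟨h, hs.2⟩
      have e : m s = s ^ n / W s ^ (2 * n + 3) * (s * (1 + s ^ 2)) := by
        have h0 := (hWp s).ne'
        rw [← hWs s]
        simp only [hm]
        field_simp
        ring
      rw [e]
      push_cast
      linear_combination (s ^ n / W s ^ (2 * n + 3) : ℂ) * h1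
  have hconst := constant_of_has_deriv_right_zero (a := 0) (b := t)
    (f := fun s => (m s : ℂ) * δ s)
    (fun s hs => (hE s ⟨hs.1, hs.2.trans_lt ht.2⟩).continuousAt.continuousWithinAt)
    (fun s hs => (hE s ⟨hs.1, hs.2.trans ht.2⟩).hasDerivWithinAt) t ⟨ht.1.le, le_rfl⟩
  have hm0 : m 0 = 0 := by simp [hm]
  have hmt : m t ≠ 0 := by
    have := hWp t
    have := ht.1
    simp only [hm]
    positivity
  simp only [hm0, Complex.ofReal_zero, zero_mul, mul_eq_zero, Complex.ofReal_eq_zero] at hconst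
  exact hconst.resolve_left hmt

/-- The potential of an isotropic power on the sphere. In the induction on the degree,
`zonal_isotropic` with `f = 1/S` gives a first order equation in `t` for the potential of degree
`l + 1` with a right hand side that comes from degree `l`. -/
lemma spherePot_isotropic {a : Fin 3 → ℂ} (ha : ∑ i, a i ^ 2 = 0) {η : E3} (hη : ‖η‖ = 1) (l : ℕ) :
    ∀ t ∈ Ioo (0 : ℝ) 1, spherePot η (fun ω => linForm a ω ^ l) t
      = 4 * Real.pi / (2 * l + 1) * (t ^ l * linForm a η ^ l) := by
  induction l with
  | zero =>
    intro t ht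
    simpa using spherePot_one hη ⟨ht.1.le, ht.2⟩
  | succ l ih =>
    have habs : ∀ t ∈ Ico (0 : ℝ) 1, |t| < 1 := fun t ht => by
      rw [abs_of_nonneg ht.1]; exact ht.2
    have hL : ∀ k : ℕ, Continuous fun ω : S2 => linForm a ω ^ k := fun k => by fun_prop
    set B : ℕ → ℝ → ℂ := fun k t =>
      ∫ ω : S2, ((1 / chord t (inner ℝ (ω : E3) η) ^ 3 : ℝ) : ℂ) * linForm a ω ^ k ∂surf with hB
    set D : ℕ → ℝ → ℂ := fun k t =>
      ∫ ω : S2, (((inner ℝ (ω : E3) η - t) / chord t (inner ℝ (ω : E3) η) ^ 3 : ℝ) : ℂ)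
        * linForm a ω ^ k ∂surf with hD
    have hiB : ∀ t ∈ Ico (0 : ℝ) 1, ∀ k, Integrable (fun ω : S2 =>
        ((1 / chord t (inner ℝ (ω : E3) η) ^ 3 : ℝ) : ℂ) * linForm a ω ^ k) surf := fun t ht k =>
      integrable_sphere ((continuous_div_chord_pow (habs t ht) hη continuous_const 3).mul (hL k))
    have hiD : ∀ t ∈ Ico (0 : ℝ) 1, ∀ k, Integrable (fun ω : S2 =>
        (((inner ℝ (ω : E3) η - t) / chord t (inner ℝ (ω : E3) η) ^ 3 : ℝ) : ℂ) * linForm a ω ^ k)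
        surf := fun t ht k =>
      integrable_sphere ((continuous_div_chord_pow (habs t ht) hη (by fun_prop) 3).mul (hL k))
    have hder : ∀ t ∈ Ico (0 : ℝ) 1, ∀ k,
        HasDerivAt (spherePot η fun ω => linForm a ω ^ k) (D k t) t := fun t ht k =>
      hasDerivAt_spherePot hη (hL k) (habs t ht)
    have hP : ∀ t ∈ Ico (0 : ℝ) 1, ∀ k, spherePot η (fun ω => linForm a ω ^ k) t
        = (1 - t ^ 2) * B k t - 2 * t * D k t := fun t ht k => by
      simp only [hB, hD, spherePot]
      rw [← integral_const_mul, ← integral_const_mul,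
        ← integral_sub ((hiB t ht k).const_mul _) ((hiD t ht k).const_mul _)]
      refine integral_congr_ae (.of_forall fun ω => ?_)
      have hc := inner_sphere_mem hη ω
      simp only
      have h0 := (chord_pos (habs t ht) hc).ne'
      have hS := chord_sq (habs t ht) hc
      generalize (inner ℝ (ω : E3) η : ℝ) = c at *
      have : (chord t c)⁻¹ = (1 - t ^ 2) * (1 / chord t c ^ 3)
          - 2 * t * ((c - t) / chord t c ^ 3) := by
        field_simp
        linear_combination hS
      rw [this]
      push_cast
      ring
    have hBl : ∀ t ∈ Ioo (0 : ℝ) 1, (1 - t ^ 2) * B l t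
        = 4 * Real.pi * (t ^ l * linForm a η ^ l) := fun t ht => by
      have ht' : t ∈ Ico (0 : ℝ) 1 := ⟨ht.1.le, ht.2⟩
      have h1 : HasDerivAt (fun t : ℝ => 4 * Real.pi / (2 * l + 1) * (t ^ l * linForm a η ^ l))
          (4 * Real.pi / (2 * l + 1) * (l * t ^ (l - 1) * linForm a η ^ l)) t := by
        have := (((hasDerivAt_pow l t).ofReal_comp.mul_const (linForm a η ^ l)).const_mul
          (4 * Real.pi / (2 * l + 1) : ℂ))
        push_cast at this
        exact this
      have h2 := (hder t ht' l).unique (h1.congr_of_eventuallyEq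
        (by filter_upwards [Ioo_mem_nhds ht.1 ht.2] with s hs using ih s hs))
      have h3 := hP t ht' l
      rw [ih t ht, h2] at h3
      have h4 : (2 * l + 1 : ℂ) ≠ 0 := by
        exact_mod_cast (by positivity : (2 * l + 1 : ℝ) ≠ 0)
      have h5 : (t : ℂ) * (l * t ^ (l - 1)) = l * t ^ l := by
        rcases l with _ | l
        · simp
        · simp; ring
      field_simp at h3
      apply mul_left_cancel₀ h4
      linear_combination (-1 : ℂ) * h3 + (4 * Real.pi * linForm a η ^ l * 2) * h5
    have hK3 : ∀ t ∈ Ico (0 : ℝ) 1, t * linForm a η * B l t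
        - t * (D (l + 1) t + t * B (l + 1) t)
        = (l + 2) * spherePot η (fun ω => linForm a ω ^ (l + 1)) t := fun t ht => by
      have hct : ContinuousOn (fun c => t / chord t c ^ 3) (Icc (-1) 1) :=
        ContinuousOn.div continuousOn_const ((continuous_chord_right t).pow 3).continuousOn
          fun c hc => pow_ne_zero _ (chord_pos (habs t ht) hc).ne'
      have key := zonal_isotropic (fun c hc => hasDerivAt_inv_chord_right (habs t ht) hc)
        hct hη ha l
      rw [spherePot, ← key]
      simp only [hB, hD]
      have hDB : Integrable (fun ω : S2 =>
          (((inner ℝ (ω : E3) η - t) / chord t (inner ℝ (ω : E3) η) ^ 3 : ℝ) : ℂ)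
            * linForm a ω ^ (l + 1)
          + t * (((1 / chord t (inner ℝ (ω : E3) η) ^ 3 : ℝ) : ℂ) * linForm a ω ^ (l + 1))) surf :=
        (hiD t ht _).add ((hiB t ht _).const_mul _)
      rw [← integral_const_mul, ← integral_const_mul,
        ← integral_add (hiD t ht _) ((hiB t ht _).const_mul _), ← integral_const_mul,
        ← integral_sub ((hiB t ht _).const_mul _) (hDB.const_mul _)]
      refine integral_congr_ae (.of_forall fun ω => ?_)
      push_cast
      ring
    intro t ht
    have h2 : (2 * (l + 1) + 1 : ℂ) ≠ 0 := by
      exact_mod_cast (by positivity : (2 * (l + 1) + 1 : ℝ) ≠ 0)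
    have hfin := eq_zero_of_singular_ode (n := l + 1) (Nat.succ_ne_zero l)
      (δ := fun t : ℝ => spherePot η (fun ω => linForm a ω ^ (l + 1)) t
        - 4 * Real.pi / (2 * (l + 1) + 1) * (t ^ (l + 1) * linForm a η ^ (l + 1)))
      (δ' := fun t : ℝ => D (l + 1) t
        - 4 * Real.pi / (2 * (l + 1) + 1) * ((l + 1) * t ^ l * linForm a η ^ (l + 1)))
      (fun s hs => ?_) (fun s hs => ?_) ht
    · push_cast
      exact sub_eq_zero.1 hfin
    · refine (hder s hs (l + 1)).sub ?_
      have := (((hasDerivAt_pow (l + 1) s).ofReal_comp.mul_const (linForm a η ^ (l + 1))).const_mul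
          (4 * Real.pi / (2 * (l + 1) + 1) : ℂ))
      push_cast at this
      simpa using this
    · have hs' : s ∈ Ico (0 : ℝ) 1 := ⟨hs.1.le, hs.2⟩
      have e1 := hK3 s hs'
      have e2 := hBl s hs
      have e3 := hP s hs' (l + 1)
      generalize spherePot η (fun ω => linForm a ω ^ (l + 1)) s = P at *
      generalize D (l + 1) s = D' at *
      generalize B (l + 1) s = B' at *
      generalize B l s = B0 at *
      generalize linForm a η = Λ at *
      obtain ⟨K, hK⟩ : ∃ K : ℂ, K = 4 * Real.pi / (2 * (l + 1) + 1) := ⟨_, rfl⟩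
      have hK' : K * (2 * (l + 1) + 1) = 4 * Real.pi := by rw [hK]; field_simp
      rw [← hK]
      push_cast
      linear_combination - (1 - s ^ 2 : ℂ) * e1 + s * Λ * e2 + s ^ 2 * e3
        - (s ^ (l + 1) * Λ ^ (l + 1)) * hK'

/-! ### Spherical harmonics and the Newtonian kernel -/

/-- The point `ω₀ + i ω₁` of the complex plane. -/
noncomputable def planar (ω : S2) : ℂ := ⟨(ω : E3) 0, (ω : E3) 1⟩

/-- The polynomial `(-ζ̄ + 2 z X + ζ X²)^l`, with `ζ = ω₀ + i ω₁` and `z = ω₂`. Its values are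
`l`-th powers of isotropic linear forms in `ω`, and its coefficients are, up to factors, the spherical
harmonics of degree `l`. -/
noncomputable def harmonicGen (l : ℕ) (ω : S2) : ℂ[X] :=
  (C (-conj (planar ω)) + C (2 * ((ω : E3) 2 : ℂ)) * X + C (planar ω) * X ^ 2) ^ l

lemma planar_eq (ω : S2) : planar ω = (ω : E3) 0 + Complex.I * (ω : E3) 1 := by
  apply Complex.ext <;> simp [planar]

lemma conj_planar_eq (ω : S2) : conj (planar ω) = (ω : E3) 0 - Complex.I * (ω : E3) 1 := by
  apply Complex.ext <;> simp [planar]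

lemma continuous_planar : Continuous planar := by
  simp_rw [funext planar_eq]; fun_prop

lemma sphere_sum_sq (ω : S2) : (ω : E3) 0 ^ 2 + (ω : E3) 1 ^ 2 + (ω : E3) 2 ^ 2 = 1 := by
  have h : ‖(ω : E3)‖ ^ 2 = 1 := by simp
  rw [EuclideanSpace.norm_sq_eq, Fin.sum_univ_three] at h
  simpa using h

lemma planar_mul_conj (ω : S2) :
    planar ω * conj (planar ω) = 1 - ((ω : E3) 2 : ℂ) ^ 2 := by
  have h : (((ω : E3) 0 ^ 2 + (ω : E3) 1 ^ 2 + (ω : E3) 2 ^ 2 : ℝ) : ℂ) = 1 := by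
    rw [sphere_sum_sq]; simp
  push_cast at h
  rw [conj_planar_eq, planar_eq]
  linear_combination h - ((ω : E3) 1 : ℂ) ^ 2 * Complex.I_sq

/-- The isotropic vectors `(τ² - 1, i (τ² + 1), 2 τ)`. -/
noncomputable def isoVec (τ : ℂ) : Fin 3 → ℂ := ![τ ^ 2 - 1, Complex.I * (τ ^ 2 + 1), 2 * τ]

lemma isoVec_isotropic (τ : ℂ) : ∑ i, isoVec τ i ^ 2 = 0 := by
  simp [isoVec, Fin.sum_univ_three, mul_pow]
  ring

lemma harmonicGen_eval (l : ℕ) (ω : S2) (τ : ℂ) :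
    (harmonicGen l ω).eval τ = linForm (isoVec τ) ω ^ l := by
  simp only [harmonicGen, eval_pow, eval_add, eval_mul, eval_C, eval_X,
    linForm, isoVec, Fin.sum_univ_three, Matrix.cons_val_zero, Matrix.cons_val_one,
    Matrix.cons_val]
  rw [conj_planar_eq, planar_eq]
  congr 1
  ring

lemma harmonicGen_natDegree (l : ℕ) (ω : S2) : (harmonicGen l ω).natDegree ≤ l * 2 := by
  refine natDegree_pow_le_of_le l ?_
  compute_degree

lemma continuous_coeff_harmonicGen (l n : ℕ) : Continuous fun ω => (harmonicGen l ω).coeff n := by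
  induction l generalizing n with
  | zero => simpa [harmonicGen] using continuous_const
  | succ l ih =>
    have h : ∀ ω, harmonicGen (l + 1) ω = harmonicGen l ω *
        (C (-conj (planar ω)) + C (2 * ((ω : E3) 2 : ℂ)) * X + C (planar ω) * X ^ 2) := fun ω =>
      pow_succ _ _
    simp only [h, coeff_mul]
    refine continuous_finsetSum _ fun p _ => (ih p.1).mul ?_
    have hp := continuous_planar
    have hp' : Continuous fun ω => conj (planar ω) := Complex.continuous_conj.comp hp
    simp only [coeff_add, coeff_C, coeff_C_mul, coeff_X, coeff_X_pow]
    split_ifs <;> fun_prop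

lemma spherePot_coeff (l n : ℕ) (η : S2) {t : ℝ} (ht : t ∈ Ioo (0 : ℝ) 1) :
    spherePot η (fun ω => (harmonicGen l ω).coeff n) t
      = 4 * Real.pi / (2 * l + 1) * (t ^ l * (harmonicGen l η).coeff n) := by
  have hη : ‖(η : E3)‖ = 1 := by simp
  have ht' : |t| < 1 := by rw [abs_of_pos ht.1]; exact ht.2
  have hdeg : ∀ ω τ, (harmonicGen l ω).eval τ
      = ∑ i ∈ Finset.range (l * 2 + 1), (harmonicGen l ω).coeff i * τ ^ i := fun ω τ =>
    eval_eq_sum_range' (Nat.lt_succ_of_le (harmonicGen_natDegree l ω)) τ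
  set p : ℂ[X] := ∑ i ∈ Finset.range (l * 2 + 1),
    C (spherePot η (fun ω => (harmonicGen l ω).coeff i) t) * X ^ i with hp
  set q : ℂ[X] := ∑ i ∈ Finset.range (l * 2 + 1),
    C (4 * Real.pi / (2 * l + 1) * (t ^ l * (harmonicGen l η).coeff i)) * X ^ i with hq
  have hpq : p = q := by
    refine Polynomial.funext fun τ => ?_
    have h1 := spherePot_isotropic (isoVec_isotropic τ) hη l t ht
    simp only [← harmonicGen_eval] at h1
    simp only [hp, hq, eval_finsetSum, eval_mul, eval_C, eval_pow, eval_X]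
    have h2 : spherePot η (fun ω => (harmonicGen l ω).eval τ) t
        = ∑ i ∈ Finset.range (l * 2 + 1),
          spherePot η (fun ω => (harmonicGen l ω).coeff i) t * τ ^ i := by
      simp only [hdeg, spherePot, Finset.mul_sum]
      rw [integral_finsetSum]
      · refine Finset.sum_congr rfl fun i _ => ?_
        rw [← integral_mul_const]
        congr 1
        ext ω
        ring
      · exact fun i _ => integrable_sphere ((continuous_inv_chord ht' hη).mul
          ((continuous_coeff_harmonicGen l i).mul continuous_const))
    rw [← h2, h1, hdeg, Finset.mul_sum, Finset.mul_sum]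
    exact Finset.sum_congr rfl fun i _ => by ring
  have hcoef : ∀ f : ℕ → ℂ, (∑ i ∈ Finset.range (l * 2 + 1), C (f i) * X ^ i : ℂ[X]).coeff n
      = if n < l * 2 + 1 then f n else 0 := fun f => by
    simp [finsetSum_coeff, coeff_C_mul, coeff_X_pow]
  by_cases hn : n < l * 2 + 1
  · have := congrArg (fun r : ℂ[X] => r.coeff n) hpq
    simp only [hp, hq, hcoef, if_pos hn] at this
    exact this
  · have h0 : ∀ ω, (harmonicGen l ω).coeff n = 0 := fun ω =>
      coeff_eq_zero_of_natDegree_lt (lt_of_le_of_lt (harmonicGen_natDegree l ω) (by omega))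
    simp [h0, spherePot]

/-- The coefficients of `harmonicGen l ω` are spherical harmonics: multiplication by `ζ^l` turns it
into the Taylor expansion of `(X² - 1)^l` at `z`, in the variable `ζ X`. -/
lemma coeff_harmonicGen (l k : ℕ) (ω : S2) : (harmonicGen l ω).coeff (l + k)
    = (taylor ((ω : E3) 2 : ℂ) ((X ^ 2 - 1) ^ l)).coeff (l + k) * planar ω ^ k := by
  set ζ := planar ω with hζ
  set z : ℂ := ((ω : E3) 2 : ℂ) with hz
  have hmul : ζ * conj ζ = 1 - z ^ 2 := planar_mul_conj ω
  have hT : taylor z ((X ^ 2 - 1 : ℂ[X]) ^ l) = (X ^ 2 + C (2 * z) * X + C (z ^ 2 - 1)) ^ l := by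
    rw [taylor_pow]
    congr 1
    simp only [taylor_apply, sub_comp, pow_comp, X_comp, one_comp, C_sub, C_pow, C_mul, C_1]
    simp only [map_ofNat]
    ring
  by_cases h0 : ζ = 0
  · have hz1 : z ^ 2 - 1 = 0 := by rw [h0, zero_mul] at hmul; linear_combination hmul
    rw [hT, hz1, harmonicGen, ← hζ, h0]
    have e1 : (X ^ 2 + C (2 * z) * X + C 0 : ℂ[X]) ^ l = X ^ l * (X + C (2 * z)) ^ l := by
      rw [← mul_pow]; simp; ring
    have e2 : (C (-conj (0 : ℂ)) + C (2 * z) * X + C 0 * X ^ 2 : ℂ[X]) ^ l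
        = C ((2 * z) ^ l) * X ^ l := by
      simp [mul_pow]
    rw [e1, e2, coeff_C_mul, coeff_X_pow]
    rcases k with _ | k
    · rw [add_zero, coeff_X_pow_mul' , if_pos le_rfl, Nat.sub_self, coeff_zero_eq_eval_zero]
      simp
    · simp
  · have h1 : (taylor z ((X ^ 2 - 1 : ℂ[X]) ^ l)).comp (C ζ * X) = C (ζ ^ l) * harmonicGen l ω := by
      have h3 : z ^ 2 - 1 = - (ζ * conj ζ) := by rw [hmul]; ring
      rw [hT, harmonicGen, C_pow, ← mul_pow, pow_comp, ← hζ, ← hz, h3]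
      congr 1
      simp only [add_comp, mul_comp, pow_comp, X_comp, C_comp, neg_comp, C_neg, C_mul]
      ring
    have h2 := congrArg (fun r : ℂ[X] => r.coeff (l + k)) h1
    simp only [comp_C_mul_X_coeff, coeff_C_mul] at h2
    apply mul_left_cancel₀ (pow_ne_zero l h0)
    rw [← h2]
    ring

lemma iterate_derivative_legendreP (l k : ℕ) (z : ℝ) :
    (((derivative^[k] (legendreP l)).eval z : ℝ) : ℂ)
      = (((l + k).factorial : ℝ) / (2 ^ l * (l.factorial : ℝ)) : ℝ)
        * (taylor (z : ℂ) ((X ^ 2 - 1) ^ l)).coeff (l + k) := by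
  have h1 : derivative^[k] (legendreP l)
      = C (1 / (2 ^ l * (l.factorial : ℝ))) * derivative^[l + k] ((X ^ 2 - 1) ^ l) := by
    rw [legendreP, iterate_derivative_C_mul, ← Function.iterate_add_apply, add_comm]
  have h2 : derivative^[l + k] ((X ^ 2 - 1 : ℂ[X]) ^ l)
      = (derivative^[l + k] ((X ^ 2 - 1 : ℝ[X]) ^ l)).map Complex.ofRealHom := by
    rw [← iterate_derivative_map]
    simp
  have h3 : (taylor (z : ℂ) ((X ^ 2 - 1) ^ l)).coeff (l + k) * ((l + k).factorial : ℂ)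
      = (((derivative^[l + k] ((X ^ 2 - 1 : ℝ[X]) ^ l)).eval z : ℝ) : ℂ) := by
    rw [taylor_coeff]
    have h4 := congrArg (fun p : ℂ[X] => p.eval (z : ℂ)) (congrFun
      (factorial_smul_hasseDeriv (R := ℂ) (l + k)) ((X ^ 2 - 1 : ℂ[X]) ^ l))
    rw [h2] at h4
    simp only [LinearMap.smul_apply] at h4
    rw [nsmul_eq_mul, eval_mul, eval_natCast] at h4
    rw [mul_comm, h4]
    rw [eval_map]
    exact eval₂_at_apply Complex.ofRealHom z
  rw [h1, eval_mul, eval_C]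
  push_cast
  rw [← h3]
  ring


/-- Every `Y_{lm}` is a real multiple of the real or of the imaginary part of a coefficient of
`harmonicGen`. -/
lemma exists_sphY_eq (l : ℕ) (m : ℤ) : ∃ (c : ℝ) (n : ℕ),
    (∀ ω, sphY l m ω = c * ((harmonicGen l ω).coeff n).re) ∨
    (∀ ω, sphY l m ω = c * ((harmonicGen l ω).coeff n).im) := by
  set k := m.natAbs with hk
  set N : ℝ := √((2 * l + 1) / (4 * Real.pi) *
    (((l - k).factorial : ℝ) / ((l + k).factorial : ℝ))) with hN
  set b : ℝ := ((l + k).factorial : ℝ) / (2 ^ l * (l.factorial : ℝ)) with hb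
  have hb0 : b ≠ 0 := by rw [hb]; positivity
  have hco : ∀ ω : S2, (((derivative^[k] (legendreP l)).eval ((ω : E3) 2) : ℝ) : ℂ) * planar ω ^ k
      = b * (harmonicGen l ω).coeff (l + k) := fun ω => by
    rw [iterate_derivative_legendreP, coeff_harmonicGen, mul_assoc]
  have hre : ∀ ω : S2, (derivative^[k] (legendreP l)).eval ((ω : E3) 2) * (planar ω ^ k).re
      = b * ((harmonicGen l ω).coeff (l + k)).re := fun ω => by
    rw [← Complex.re_ofReal_mul, hco, Complex.re_ofReal_mul]
  have him : ∀ ω : S2, (derivative^[k] (legendreP l)).eval ((ω : E3) 2) * (planar ω ^ k).im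
      = b * ((harmonicGen l ω).coeff (l + k)).im := fun ω => by
    rw [← Complex.im_ofReal_mul, hco, Complex.im_ofReal_mul]
  rcases lt_trichotomy m 0 with h | h | h
  · refine ⟨√2 * N * b, l + k, Or.inr fun ω => ?_⟩
    simp only [sphY, if_neg h.ne, if_neg h.not_gt]
    rw [mul_assoc (√2 * N) b, ← him, ← mul_assoc]
    rfl
  · refine ⟨N * b, l + k, Or.inl fun ω => ?_⟩
    simp only [sphY, if_pos h]
    rw [mul_assoc N b, ← hre]
    have : k = 0 := by simp [hk, h]
    simp [this, hN, ← hk]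
  · refine ⟨√2 * N * b, l + k, Or.inl fun ω => ?_⟩
    simp only [sphY, if_neg h.ne', if_pos h]
    rw [mul_assoc (√2 * N) b, ← hre, ← mul_assoc]
    rfl

lemma continuous_sphY (l : ℕ) (m : ℤ) : Continuous (sphY l m) := by
  obtain ⟨c, n, h | h⟩ := exists_sphY_eq l m
  · rw [funext h]
    exact continuous_const.mul (Complex.continuous_re.comp (continuous_coeff_harmonicGen l n))
  · rw [funext h]
    exact continuous_const.mul (Complex.continuous_im.comp (continuous_coeff_harmonicGen l n))

lemma integral_inv_chord_sphY (l : ℕ) (m : ℤ) (η : S2) {t : ℝ} (ht : t ∈ Ioo (0 : ℝ) 1) :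
    ∫ ω : S2, (chord t (inner ℝ (ω : E3) η))⁻¹ * sphY l m ω ∂surf
      = 4 * Real.pi / (2 * l + 1) * (t ^ l * sphY l m η) := by
  have ht' : |t| < 1 := by rw [abs_of_pos ht.1]; exact ht.2
  obtain ⟨c, n, h⟩ := exists_sphY_eq l m
  have hint : Integrable (fun ω : S2 => (((chord t (inner ℝ (ω : E3) η))⁻¹ : ℝ) : ℂ) *
      (harmonicGen l ω).coeff n) surf :=
    integrable_sphere ((continuous_inv_chord ht' (η := η) (by simp)).mul
      (continuous_coeff_harmonicGen l n))
  have key := spherePot_coeff l n η ht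
  have hr : (4 * Real.pi / (2 * l + 1) * (t ^ l * (harmonicGen l η).coeff n) : ℂ)
      = ((4 * Real.pi / (2 * l + 1) * t ^ l : ℝ) : ℂ) * (harmonicGen l η).coeff n := by
    push_cast; ring
  rw [hr] at key
  rcases h with h | h
  · have h1 := Complex.reCLM.integral_comp_comm hint
    have h2 := congrArg Complex.re key
    simp only [spherePot] at h2
    simp only [Complex.reCLM_apply] at h1
    rw [← h1] at h2
    simp only [Complex.re_ofReal_mul] at h2
    simp only [h, mul_left_comm _ c, integral_const_mul]
    rw [h2]
    ring
  · have h1 := Complex.imCLM.integral_comp_comm hint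
    have h2 := congrArg Complex.im key
    simp only [spherePot] at h2
    simp only [Complex.imCLM_apply] at h1
    rw [← h1] at h2
    simp only [Complex.im_ofReal_mul] at h2
    simp only [h, mul_left_comm _ c, integral_const_mul]
    rw [h2]
    ring

lemma integral_inv_chord (η : S2) {t : ℝ} (ht : t ∈ Ioo (0 : ℝ) 1) :
    ∫ ω : S2, (chord t (inner ℝ (ω : E3) η))⁻¹ ∂surf = 4 * Real.pi := by
  have h := spherePot_one (η := η) (by simp) ⟨ht.1.le, ht.2⟩
  simp only [spherePot, mul_one, integral_complex_ofReal] at h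
  exact_mod_cast h

lemma norm_sub_eq_mul_chord {r s : ℝ} (hr : 0 < r) (ω η : S2) :
    ‖r • (ω : E3) - s • (η : E3)‖
      = max r s * chord (min r s / max r s) (inner ℝ (ω : E3) η) := by
  have h1 : ‖r • (ω : E3) - s • (η : E3)‖ ^ 2
      = r ^ 2 - 2 * r * s * inner ℝ (ω : E3) η + s ^ 2 := by
    rw [norm_sub_sq_real]
    simp [norm_smul, real_inner_smul_left, real_inner_smul_right]
    ring
  have hm : 0 < max r s := lt_max_of_lt_left hr
  rw [← Real.sqrt_sq (norm_nonneg _), h1, chord, ← Real.sqrt_sq hm.le,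
    ← Real.sqrt_mul (sq_nonneg _), Real.sqrt_sq hm.le]
  congr 1
  field_simp
  rcases le_total r s with h | h
  · rw [max_eq_right h, min_eq_left h]; ring
  · rw [max_eq_left h, min_eq_right h]; ring

/-- The multipole kernel `r_<^l / r_>^(l+1)`, with `r_<` and `r_>` the smaller and the larger of the
two radii. -/
noncomputable def multipole (l : ℕ) (r s : ℝ) : ℝ := min r s ^ l / max r s ^ (l + 1)

lemma integral_sphY_div_norm (l : ℕ) (m : ℤ) (η : S2) {r s : ℝ} (hr : 0 < r) (hs : 0 < s)
    (hrs : r ≠ s) :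
    ∫ ω : S2, sphY l m ω / ‖r • (ω : E3) - s • (η : E3)‖ ∂surf
      = 4 * Real.pi / (2 * l + 1) * multipole l r s * sphY l m η := by
  have hm : 0 < max r s := lt_max_of_lt_left hr
  have ht : min r s / max r s ∈ Ioo (0 : ℝ) 1 :=
    ⟨div_pos (lt_min hr hs) hm, (div_lt_one hm).2 (by
      rcases hrs.lt_or_gt with h | h <;> simp [h])⟩
  have key := integral_inv_chord_sphY l m η ht
  have h1 : ∀ ω : S2, sphY l m ω / ‖r • (ω : E3) - s • (η : E3)‖ = (max r s)⁻¹ *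
      ((chord (min r s / max r s) (inner ℝ (ω : E3) η))⁻¹ * sphY l m ω) := fun ω => by
    rw [norm_sub_eq_mul_chord hr]
    field_simp
  simp only [h1, integral_const_mul]
  rw [key, multipole, div_pow]
  field_simp
  ring

lemma integral_one_div_norm (η : S2) {r s : ℝ} (hr : 0 < r) (hs : 0 < s) (hrs : r ≠ s) :
    ∫ ω : S2, 1 / ‖r • (ω : E3) - s • (η : E3)‖ ∂surf = 4 * Real.pi / max r s := by
  have hm : 0 < max r s := lt_max_of_lt_left hr
  have ht : min r s / max r s ∈ Ioo (0 : ℝ) 1 :=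
    ⟨div_pos (lt_min hr hs) hm, (div_lt_one hm).2 (by
      rcases hrs.lt_or_gt with h | h <;> simp [h])⟩
  have key := integral_inv_chord η ht
  have h1 : ∀ ω : S2, 1 / ‖r • (ω : E3) - s • (η : E3)‖ = (max r s)⁻¹ *
      ((chord (min r s / max r s) (inner ℝ (ω : E3) η))⁻¹) := fun ω => by
    rw [norm_sub_eq_mul_chord hr]
    field_simp
  simp only [h1, integral_const_mul]
  rw [key]
  field_simp

/-! ### The modes of the gravitational potential -/

lemma exists_eq_norm_smul_sphere {y : E3} (hy : y ≠ 0) : ∃ η : S2, y = ‖y‖ • (η : E3) := by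
  have h : ‖y‖ ≠ 0 := by simpa using hy
  refine ⟨⟨‖y‖⁻¹ • y, ?_⟩, ?_⟩
  · simp [norm_smul, h]
  · simp [smul_smul, h]

lemma norm_smul_sphere {s : ℝ} (hs : 0 < s) (η : S2) : ‖s • (η : E3)‖ = s := by
  simp [norm_smul, abs_of_pos hs]

lemma norm_sub_pos_of_norm_ne {r : ℝ} (hr : 0 < r) {y : E3} (hy : r ≠ ‖y‖) (ω : S2) :
    0 < ‖r • (ω : E3) - y‖ := by
  rw [norm_pos_iff, sub_ne_zero]
  intro h
  exact hy (by rw [← h, norm_smul_sphere hr])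

lemma integrable_sphere_real {f : S2 → ℝ} (hf : Continuous f) : Integrable f surf :=
  hf.integrable_of_hasCompactSupport (HasCompactSupport.of_compactSpace f)

lemma ae_ne_zero_and_norm_ne (r : ℝ) (μ : Measure E3) (hμ : μ ≪ volume) (hr : 0 < r) :
    ∀ᵐ y ∂μ, y ≠ 0 ∧ r ≠ ‖y‖ := by
  have h1 : ∀ᵐ y : E3, y ≠ 0 := by simp [ae_iff, measure_singleton]
  have h2 : ∀ᵐ y : E3, r ≠ ‖y‖ := by
    have : (volume : Measure E3) (sphere 0 r) = 0 := Measure.addHaar_sphere_of_ne_zero _ _ hr.ne'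
    rw [ae_iff]
    convert this using 2
    ext y
    simp [eq_comm]
  exact hμ.ae_le (h1.and h2)

/-- The Newtonian kernel, weighted with a continuous function on the sphere of radius `r`, is
integrable against `g`: its spherical means are bounded, by `integral_one_div_norm`. -/
lemma integrable_newton {R r : ℝ} (hr : 0 < r) {g : E3 → ℝ} (hg : IntegrableOn g (ball 0 R))
    {Y : S2 → ℝ} (hY : Continuous Y) :
    Integrable (fun p : S2 × E3 => g p.2 / ‖r • (p.1 : E3) - p.2‖ * Y p.1)
      (surf.prod (volume.restrict (ball 0 R))) := by
  have hmeas : AEStronglyMeasurable (fun p : S2 × E3 => g p.2 / ‖r • (p.1 : E3) - p.2‖ * Y p.1)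
      (surf.prod (volume.restrict (ball 0 R))) := by
    have h1 : AEStronglyMeasurable (fun p : S2 × E3 => g p.2)
        (surf.prod (volume.restrict (ball 0 R))) := hg.aestronglyMeasurable.comp_snd
    have h2 : Measurable (fun p : S2 × E3 => ‖r • (p.1 : E3) - p.2‖⁻¹) := by fun_prop
    have h3 : Measurable (fun p : S2 × E3 => Y p.1) := hY.measurable.comp measurable_fst
    simp only [div_eq_mul_inv]
    exact (h1.mul h2.aestronglyMeasurable).mul h3.aestronglyMeasurable
  obtain ⟨K, hK⟩ : ∃ K, ∀ ω, ‖Y ω‖ ≤ K := by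
    obtain ⟨K, hK⟩ := isCompact_univ.exists_bound_of_continuousOn hY.continuousOn
    exact ⟨K, fun ω => hK ω (mem_univ _)⟩
  have hae := ae_ne_zero_and_norm_ne r (volume.restrict (ball 0 R))
    Measure.restrict_le_self.absolutelyContinuous hr
  have hcont : ∀ y : E3, r ≠ ‖y‖ → ∀ c : ℝ, ∀ Z : S2 → ℝ, Continuous Z →
      Integrable (fun ω : S2 => c / ‖r • (ω : E3) - y‖ * Z ω) surf := fun y hy c Z hZ => by
    refine integrable_sphere_real (Continuous.mul (Continuous.div (by fun_prop) (by fun_prop)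
      fun ω => ?_) hZ)
    exact (norm_sub_pos_of_norm_ne hr hy ω).ne'
  rw [integrable_prod_iff' hmeas]
  refine ⟨?_, ?_⟩
  · filter_upwards [hae] with y hy using hcont y hy.2 _ _ hY
  · refine (hg.norm.mul_const (K * (4 * Real.pi / r))).mono'
      hmeas.norm.prod_swap.integral_prod_right' ?_
    filter_upwards [hae] with y hy
    obtain ⟨η, hη⟩ := exists_eq_norm_smul_sphere hy.1
    have hy0 : 0 < ‖y‖ := by simpa using hy.1
    have h1 := integral_one_div_norm η hr hy0 hy.2
    rw [← hη] at h1
    have hK0 : 0 ≤ K := (norm_nonneg _).trans (hK η)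
    rw [Real.norm_of_nonneg (integral_nonneg fun ω => norm_nonneg _)]
    calc ∫ ω : S2, ‖g y / ‖r • (ω : E3) - y‖ * Y ω‖ ∂surf
        ≤ ∫ ω : S2, (‖g y‖ * K) * (1 / ‖r • (ω : E3) - y‖ * 1) ∂surf := by
          refine integral_mono (hcont y hy.2 _ _ hY).norm
            ((hcont y hy.2 1 _ continuous_const).const_mul _) fun ω => ?_
          simp only [norm_mul, norm_div, norm_norm]
          calc ‖g y‖ / ‖r • (ω : E3) - y‖ * ‖Y ω‖ ≤ ‖g y‖ / ‖r • (ω : E3) - y‖ * K := by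
                gcongr
                exact hK ω
            _ = _ := by ring
      _ = ‖g y‖ * K * (4 * Real.pi / max r ‖y‖) := by
          simp only [mul_one, integral_const_mul, h1]
      _ ≤ ‖g y‖ * (K * (4 * Real.pi / r)) := by
          rw [mul_assoc]
          have : r ≤ max r ‖y‖ := le_max_left _ _
          have := Real.pi_pos
          gcongr

/-- The multipole expansion of the Newtonian potential, mode by mode. -/
lemma sphCoeff_potential {R r : ℝ} (hr : 0 < r) {g : E3 → ℝ} (hg : IntegrableOn g (ball 0 R))
    (l : ℕ) (m : ℤ) :
    sphCoeff (fun x => 1 / (4 * Real.pi) * gravK R g x) l m r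
      = -(1 / (2 * l + 1)) *
        ∫ s in Ioo (0 : ℝ) R, s ^ 2 * (multipole l r s * sphCoeff g l m s) := by
  have hint := integrable_newton hr hg (continuous_sphY l m)
  have h1 : sphCoeff (fun x => 1 / (4 * Real.pi) * gravK R g x) l m r
      = -(1 / (4 * Real.pi)) * ∫ ω : S2, (∫ y in ball (0 : E3) R,
        g y / ‖r • (ω : E3) - y‖ * sphY l m ω) ∂surf := by
    rw [sphCoeff, ← integral_const_mul]
    congr 1
    ext ω
    rw [integral_mul_const, gravK]
    ring
  rw [h1, integral_integral_swap hint, polar_ball_integral hint.integral_prod_right,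
    ← integral_const_mul, ← integral_const_mul]
  refine integral_congr_ae ?_
  have hne : ∀ᵐ s ∂(volume.restrict (Ioo (0 : ℝ) R)), s ≠ r :=
    ae_restrict_of_ae (by simp [ae_iff, measure_singleton])
  filter_upwards [hne, ae_restrict_mem measurableSet_Ioo] with s hs hs0
  have h2 : ∀ η : S2, ∫ ω : S2, g (s • (η : E3)) / ‖r • (ω : E3) - s • (η : E3)‖ * sphY l m ω ∂surf
      = 4 * Real.pi / (2 * l + 1) * multipole l r s * (g (s • (η : E3)) * sphY l m η) := fun η => by
    have : ∀ ω : S2, g (s • (η : E3)) / ‖r • (ω : E3) - s • (η : E3)‖ * sphY l m ω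
        = g (s • (η : E3)) * (sphY l m ω / ‖r • (ω : E3) - s • (η : E3)‖) := fun ω => by ring
    simp only [this, integral_const_mul, integral_sphY_div_norm l m η hr hs0.1 hs.symm]
    ring
  simp only [h2, integral_const_mul, sphCoeff]
  have := Real.pi_pos.ne'
  field_simp

/-! ### Functions of the radius with a weak derivative -/

lemma exists_Icc_of_isCompact_subset_Ioo {K : Set ℝ} {R : ℝ} (hR : 0 < R) (hK : IsCompact K)
    (hKR : K ⊆ Ioo 0 R) : ∃ a b, 0 < a ∧ a < b ∧ b < R ∧ K ⊆ Ioo a b := by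
  rcases K.eq_empty_or_nonempty with rfl | hne
  · exact ⟨R / 3, R / 2, by linarith, by linarith, by linarith, empty_subset _⟩
  · obtain ⟨x, hx, hx'⟩ := hK.exists_isLeast hne
    obtain ⟨y, hy, hy'⟩ := hK.exists_isGreatest hne
    have h1 := hKR hx
    have h2 := hKR hy
    have h3 : x ≤ y := hx' hy
    exact ⟨x / 2, (y + R) / 2, by linarith [h1.1], by linarith [h1.1, h2.2], by linarith [h2.2],
      fun z hz => ⟨by linarith [hx' hz, h1.1], by linarith [hy' hz, h2.2]⟩⟩

lemma setIntegral_Ioo_eq_of_eq_zero {f : ℝ → ℝ} {a b R : ℝ} (ha : 0 < a) (hab : a ≤ b) (hb : b < R)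
    (hf : ∀ x ∉ Ioo a b, f x = 0) : ∫ x in Ioo 0 R, f x = ∫ x in a..b, f x := by
  rw [intervalIntegral.integral_of_le hab, integral_Ioc_eq_integral_Ioo]
  exact (setIntegral_eq_of_subset_of_forall_sdiff_eq_zero measurableSet_Ioo
    (Ioo_subset_Ioo ha.le hb.le) fun x hx => hf x hx.2)

lemma tsupport_deriv_subset' (φ : ℝ → ℝ) {s : Set ℝ} (h : tsupport φ ⊆ s) :
    ∀ x ∉ s, deriv φ x = 0 := fun x hx => by
  by_contra h0
  exact hx (h (support_deriv_subset (Function.mem_support.2 h0)))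

/-- Integration by parts for the primitive of an integrable function against a test function. -/
lemma integral_primitive_mul_deriv {D : ℝ → ℝ} {R : ℝ} (hR : 0 < R)
    (hD : ∀ ε ∈ Ioo 0 R, IntervalIntegrable D volume ε R) {φ : ℝ → ℝ}
    (hφ : ContDiff ℝ (⊤ : ℕ∞) φ) (hc : HasCompactSupport φ) (hs : tsupport φ ⊆ Ioo 0 R) :
    ∫ r in Ioo 0 R, (∫ s in R..r, D s) * deriv φ r = - ∫ r in Ioo 0 R, D r * φ r := by
  obtain ⟨a, b, ha, hab, hb, hK⟩ := exists_Icc_of_isCompact_subset_Ioo hR hc hs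
  have hφ0 : ∀ x ∉ Ioo a b, φ x = 0 := fun x hx =>
    image_eq_zero_of_notMem_tsupport fun h => hx (hK h)
  have hφ' := tsupport_deriv_subset' φ hK
  have hDa : IntervalIntegrable D volume a R := hD a ⟨ha, hab.trans hb⟩
  have hDab : IntervalIntegrable D volume a b :=
    hDa.mono_set (by
      rw [uIcc_of_le hab.le, uIcc_of_le (hab.trans hb).le]; exact Icc_subset_Icc_right hb.le)
  rw [setIntegral_Ioo_eq_of_eq_zero ha hab.le hb (fun x hx => by simp [hφ' x hx]),
    setIntegral_Ioo_eq_of_eq_zero ha hab.le hb (fun x hx => by simp [hφ0 x hx])]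
  have hac : AbsolutelyContinuousOnInterval (fun r => ∫ s in R..r, D s) a b :=
    (hDa.absolutelyContinuousOnInterval_intervalIntegral right_mem_uIcc).mono (by
      rw [uIcc_of_le hab.le, uIcc_of_le (hab.trans hb).le]; exact Icc_subset_Icc_right hb.le)
  have hacφ : AbsolutelyContinuousOnInterval φ a b :=
    (hφ.of_le (by norm_cast)).contDiffOn.absolutelyContinuousOnInterval
  rw [hac.integral_mul_deriv_eq_deriv_mul hacφ, hφ0 a (by simp), hφ0 b (by simp)]
  simp only [mul_zero, sub_zero, zero_sub]
  congr 1
  refine intervalIntegral.integral_congr_ae ?_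
  filter_upwards [hDa.ae_hasDerivAt_integral] with x hx hxab
  rw [uIoc_of_le hab.le] at hxab
  have hx2 : x ∈ uIcc a R := by
    rw [uIcc_of_le (hab.trans hb).le]; exact ⟨hxab.1.le, hxab.2.trans hb.le⟩
  rw [(hx hx2 R right_mem_uIcc).deriv]

/-- The du Bois-Reymond lemma: a function with vanishing weak derivative is constant. -/
lemma ae_eq_const_of_weak_deriv_eq_zero {w : ℝ → ℝ} {R : ℝ} (hR : 0 < R)
    (hw : LocallyIntegrableOn w (Ioo 0 R))
    (h : ∀ φ : ℝ → ℝ, ContDiff ℝ (⊤ : ℕ∞) φ → HasCompactSupport φ → tsupport φ ⊆ Ioo 0 R →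
      ∫ r in Ioo 0 R, w r * deriv φ r = 0) :
    ∃ c, ∀ᵐ r ∂(volume.restrict (Ioo 0 R)), w r = c := by
  have hint : ∀ ψ : ℝ → ℝ, Continuous ψ → HasCompactSupport ψ → tsupport ψ ⊆ Ioo 0 R →
      IntegrableOn (fun r => w r * ψ r) (Ioo 0 R) := fun ψ hψ hc hs => by
    have h1 : IntegrableOn (fun r => w r * ψ r) (tsupport ψ) :=
      (hw.integrableOn_compact_subset hs hc).mul_continuousOn hψ.continuousOn hc
    exact h1.of_forall_sdiff_eq_zero measurableSet_Ioo fun x hx => by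
      simp [image_eq_zero_of_notMem_tsupport hx.2]
  let β : ContDiffBump (R / 2) := ⟨R / 8, R / 4, by linarith, by linarith⟩
  set θ : ℝ → ℝ := β.normed volume with hθ
  have hθs : tsupport θ = Icc (R / 4) (3 * R / 4) := by
    rw [hθ, β.tsupport_normed_eq, Real.closedBall_eq_Icc]
    congr 1 <;> simp only [β] <;> ring
  have hθc : HasCompactSupport θ := β.hasCompactSupport_normed
  have hθR : tsupport θ ⊆ Ioo 0 R := by
    rw [hθs]; exact fun x hx => ⟨by linarith [hx.1], by linarith [hx.2]⟩
  refine ⟨∫ r in Ioo 0 R, w r * θ r, ?_⟩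
  set c := ∫ r in Ioo 0 R, w r * θ r with hcdef
  have key : ∀ᵐ r, r ∈ Ioo 0 R → w r - c = 0 := by
    refine isOpen_Ioo.ae_eq_zero_of_integral_contDiff_smul_eq_zero
      (hw.sub (locallyIntegrableOn_const c)) fun ψ hψ hψc hψs => ?_
    obtain ⟨I, hI⟩ : ∃ I, I = ∫ x, ψ x := ⟨_, rfl⟩
    -- the primitive of `ψ - (∫ ψ) θ` is a test function
    set q : ℝ → ℝ := fun x => ψ x - I * θ x with hq
    have hqs : ContDiff ℝ (⊤ : ℕ∞) q := hψ.sub (contDiff_const.mul β.contDiff_normed)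
    obtain ⟨a, b, ha, hab, hb, hK⟩ := exists_Icc_of_isCompact_subset_Ioo hR
      (hψc.isCompact.union hθc.isCompact) (union_subset hψs hθR)
    have hq0 : ∀ x ∉ Ioo a b, q x = 0 := fun x hx => by
      have h1 : ψ x = 0 := image_eq_zero_of_notMem_tsupport fun h => hx (hK (Or.inl h))
      have h2 : θ x = 0 := image_eq_zero_of_notMem_tsupport fun h => hx (hK (Or.inr h))
      simp [hq, h1, h2]
    have hψi : Integrable ψ := hψ.continuous.integrable_of_hasCompactSupport hψc
    have hqt : ∫ x in a..b, q x = 0 := by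
      have h1 : ∫ x, q x = 0 := by
        rw [integral_sub hψi (β.integrable_normed.const_mul I), integral_const_mul,
          β.integral_normed, mul_one, ← hI, sub_self]
      rw [← h1, intervalIntegral.integral_of_le hab.le, integral_Ioc_eq_integral_Ioo]
      exact setIntegral_eq_integral_of_forall_compl_eq_zero hq0
    set φ : ℝ → ℝ := fun r => ∫ x in a..r, q x with hφ
    have hφd : ∀ r, HasDerivAt φ (q r) r := fun r =>
      intervalIntegral.integral_hasDerivAt_right (hqs.continuous.intervalIntegrable _ _)
        hqs.continuous.aestronglyMeasurable.stronglyMeasurableAtFilter hqs.continuous.continuousAt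
    have hφd' : deriv φ = q := funext fun r => (hφd r).deriv
    have hφs : ContDiff ℝ (⊤ : ℕ∞) φ := by
      rw [contDiff_infty_iff_deriv, hφd']
      exact ⟨fun r => (hφd r).differentiableAt, hqs⟩
    have hφ0 : ∀ x ∉ Icc a b, φ x = 0 := fun x hx => by
      rcases lt_or_ge x a with h | h
      · refine (intervalIntegral.integral_congr (g := fun _ => 0) fun y hy => ?_).trans (by simp)
        rw [uIcc_of_ge h.le] at hy
        exact hq0 y fun h' => by linarith [h'.1, hy.2]
      · have hxb : b < x := lt_of_not_ge fun h' => hx ⟨h, h'⟩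
        have : φ x = (∫ y in a..b, q y) + ∫ y in b..x, q y :=
          (intervalIntegral.integral_add_adjacent_intervals
            (hqs.continuous.intervalIntegrable _ _) (hqs.continuous.intervalIntegrable _ _)).symm
        rw [this, hqt, zero_add]
        refine (intervalIntegral.integral_congr (g := fun _ => 0) fun y hy => ?_).trans (by simp)
        rw [uIcc_of_le hxb.le] at hy
        exact hq0 y fun h' => by linarith [h'.2, hy.1]
    have hφsub : tsupport φ ⊆ Icc a b := closure_minimal
      (fun x hx => by by_contra h'; exact hx (hφ0 x h')) isClosed_Icc
    have hφc : HasCompactSupport φ := isCompact_Icc.of_isClosed_subset (isClosed_tsupport φ) hφsub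
    have hz := h φ hφs hφc (hφsub.trans fun x hx => ⟨by linarith [hx.1], by linarith [hx.2]⟩)
    rw [hφd'] at hz
    have h1 : ∫ r in Ioo 0 R, w r * q r = (∫ r in Ioo 0 R, w r * ψ r) - I * c := by
      rw [hcdef, ← integral_const_mul, ← integral_sub (hint ψ hψ.continuous hψc hψs)
        ((hint θ β.continuous_normed hθc hθR).const_mul I)]
      congr 1
      ext r
      simp only [hq]
      ring
    have h2 : ∫ x, ψ x • (w x - c) = (∫ r in Ioo 0 R, w r * ψ r) - I * c := by
      have hz0 : ∀ x ∉ Ioo 0 R, ψ x • (w x - c) = 0 := fun x hx => by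
        simp [image_eq_zero_of_notMem_tsupport fun h => hx (hψs h)]
      rw [← setIntegral_eq_integral_of_forall_compl_eq_zero hz0]
      have h3 : I = ∫ x in Ioo 0 R, ψ x := by
        rw [hI, setIntegral_eq_integral_of_forall_compl_eq_zero]
        exact fun x hx => image_eq_zero_of_notMem_tsupport fun h => hx (hψs h)
      rw [h3, ← integral_mul_const, ← integral_sub (hint ψ hψ.continuous hψc hψs)
        (hψi.integrableOn.mul_const c)]
      congr 1
      ext r
      simp only [smul_eq_mul]
      ring
    rw [h2, ← h1, hz]
  rw [ae_restrict_iff' measurableSet_Ioo]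
  filter_upwards [key] with r hr hr2
  linarith [hr hr2]

/-- A function on `(0, R)` with a weak derivative that is integrable up to `R` has a representative
which is continuous on `(0, R]`. -/
lemma exists_continuousOn_of_weak_deriv {A D : ℝ → ℝ} {R : ℝ} (hR : 0 < R)
    (hA : LocallyIntegrableOn A (Ioo 0 R))
    (hD : ∀ ε ∈ Ioo 0 R, IntervalIntegrable D volume ε R)
    (h : ∀ φ : ℝ → ℝ, ContDiff ℝ (⊤ : ℕ∞) φ → HasCompactSupport φ → tsupport φ ⊆ Ioo 0 R →
      ∫ r in Ioo 0 R, A r * deriv φ r = - ∫ r in Ioo 0 R, D r * φ r) :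
    ∃ u : ℝ → ℝ, ContinuousOn u (Ioc 0 R) ∧ ∀ᵐ r ∂(volume.restrict (Ioo 0 R)), u r = A r := by
  set V : ℝ → ℝ := fun r => ∫ s in R..r, D s with hV
  have hVc : ContinuousOn V (Ioc 0 R) := by
    intro x hx
    have hx2 : x / 2 ∈ Ioo 0 R := ⟨by linarith [hx.1], by linarith [hx.1, hx.2]⟩
    have h1 := intervalIntegral.continuousOn_primitive_interval' (hD _ hx2) right_mem_uIcc
    rw [uIcc_of_le hx2.2.le] at h1
    refine (h1 x ⟨by linarith [hx.1], hx.2⟩).mono_of_mem_nhdsWithin ?_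
    filter_upwards [self_mem_nhdsWithin, mem_nhdsWithin_of_mem_nhds
      (Ioi_mem_nhds (show x / 2 < x by linarith [hx.1]))] with y hy hy2
    exact ⟨le_of_lt hy2, hy.2⟩
  have hVl : LocallyIntegrableOn V (Ioo 0 R) :=
    (hVc.mono Ioo_subset_Ioc_self).locallyIntegrableOn measurableSet_Ioo
  obtain ⟨c, hc⟩ := ae_eq_const_of_weak_deriv_eq_zero hR (hA.sub hVl) fun φ hφ hφc hφs => by
    have hint : ∀ f : ℝ → ℝ, LocallyIntegrableOn f (Ioo 0 R) →
        IntegrableOn (fun r => f r * deriv φ r) (Ioo 0 R) := fun f hf => by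
      have h1 : IntegrableOn (fun r => f r * deriv φ r) (tsupport φ) :=
        (hf.integrableOn_compact_subset hφs hφc).mul_continuousOn
          (hφ.continuous_deriv (by norm_cast)).continuousOn hφc
      exact h1.of_forall_sdiff_eq_zero measurableSet_Ioo fun x hx => by
        simp [tsupport_deriv_subset' φ subset_rfl x hx.2]
    simp only [Pi.sub_apply, sub_mul]
    rw [integral_sub (hint A hA) (hint V hVl), h φ hφ hφc hφs,
      integral_primitive_mul_deriv hR hD hφ hφc hφs, sub_self]
  refine ⟨fun r => c + V r, continuousOn_const.add hVc, ?_⟩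
  filter_upwards [hc] with r hr
  simp only [Pi.sub_apply] at hr
  linarith

/-! ### Angular moments of `H¹` functions -/

lemma isFiniteMeasure_ball (R : ℝ) : IsFiniteMeasure ((volume : Measure E3).restrict (ball 0 R)) :=
  ⟨by rw [Measure.restrict_apply_univ]; exact measure_ball_lt_top⟩

lemma memLp_two_integrableOn {R : ℝ} {f : E3 → ℝ} (hf : MemLp f 2 (volume.restrict (ball 0 R))) :
    IntegrableOn f (ball 0 R) := by
  have := isFiniteMeasure_ball R
  exact hf.integrable one_le_two

lemma integrable_polar_mul {R : ℝ} {F : E3 → ℝ} (hF : IntegrableOn F (ball 0 R)) {Y : S2 → ℝ}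
    (hY : Continuous Y) :
    Integrable (fun p : S2 × ℝ => p.2 ^ 2 * (F (p.2 • (p.1 : E3)) * Y p.1))
      (surf.prod (volume.restrict (Ioo (0 : ℝ) R))) := by
  obtain ⟨K, hK⟩ := isCompact_univ.exists_bound_of_continuousOn hY.continuousOn
  have h1 := ((polar_ball_integrable hF.aestronglyMeasurable).1 hF).mul_bdd (c := K)
    (hY.measurable.comp measurable_fst).aestronglyMeasurable
    (.of_forall fun p => hK p.1 (mem_univ _))
  refine h1.congr (.of_forall fun p => ?_)
  simp only [Function.comp_apply]
  ring

/-- The angular moment `r ↦ ∫ F(rω) Y(ω) dS(ω)` is integrable with weight `r²`. -/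
lemma integrableOn_sq_mul_moment {R : ℝ} {F : E3 → ℝ} (hF : IntegrableOn F (ball 0 R))
    {Y : S2 → ℝ} (hY : Continuous Y) :
    IntegrableOn (fun r => r ^ 2 * ∫ ω : S2, F (r • (ω : E3)) * Y ω ∂surf) (Ioo 0 R) := by
  have := (integrable_polar_mul hF hY).integral_prod_right
  simp only [integral_const_mul] at this; exact this

lemma locallyIntegrableOn_of_sq_mul {A : ℝ → ℝ} {R : ℝ}
    (hA : IntegrableOn (fun r => r ^ 2 * A r) (Ioo 0 R)) : LocallyIntegrableOn A (Ioo 0 R) := by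
  have h1 : LocallyIntegrableOn (fun r => (r ^ 2)⁻¹ * (r ^ 2 * A r)) (Ioo 0 R) :=
    hA.locallyIntegrableOn.continuousOn_mul
      (ContinuousOn.inv₀ (by fun_prop) fun x hx => (pow_pos hx.1 2).ne') isOpen_Ioo.isLocallyClosed
  refine fun x hx => ?_
  obtain ⟨s, hs, hi⟩ := h1 x hx
  refine ⟨s ∩ Ioo 0 R, inter_mem hs self_mem_nhdsWithin, ?_⟩
  refine (hi.mono_set inter_subset_left).congr ?_
  have hms : ∀ᵐ r ∂(volume.restrict (s ∩ Ioo 0 R)), r ∈ Ioo 0 R :=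
    ae_mono (Measure.restrict_mono inter_subset_right le_rfl) (ae_restrict_mem measurableSet_Ioo)
  filter_upwards [hms] with r hr
  have := hr.1.ne'
  field_simp

lemma intervalIntegrable_of_sq_mul {A : ℝ → ℝ} {R : ℝ}
    (hA : IntegrableOn (fun r => r ^ 2 * A r) (Ioo 0 R)) {ε : ℝ} (hε : ε ∈ Ioo 0 R) :
    IntervalIntegrable A volume ε R := by
  rw [intervalIntegrable_iff_integrableOn_Ioo_of_le hε.2.le]
  have h1 : IntegrableOn (fun r => (r ^ 2)⁻¹ * (r ^ 2 * A r)) (Ioo ε R) :=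
    IntegrableOn.continuousOn_mul_of_subset (K := Icc ε R)
      (ContinuousOn.inv₀ (by fun_prop) fun x hx => (pow_pos (hε.1.trans_le hx.1) 2).ne')
      (hA.mono_set (Ioo_subset_Ioo_left hε.1.le)) isCompact_Icc measurableSet_Ioo
      Ioo_subset_Icc_self
  refine h1.congr_fun (fun r hr => ?_) measurableSet_Ioo
  have := (hε.1.trans hr.1).ne'
  simp only
  field_simp

/-- The radial-angular function `|x|⁻³ φ(|x|) κ(x/|x|)`. -/
noncomputable def bumpField (φ : ℝ → ℝ) (κ : E3 → ℝ) (x : E3) : ℝ :=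
  (‖x‖ ^ 3)⁻¹ * φ ‖x‖ * κ (‖x‖⁻¹ • x)

lemma bumpField_polar (φ : ℝ → ℝ) (κ : E3 → ℝ) {r : ℝ} (hr : 0 < r) (ω : S2) :
    bumpField φ κ (r • (ω : E3)) = (r ^ 3)⁻¹ * φ r * κ ω := by
  simp [bumpField, norm_smul_sphere hr, smul_smul, hr.ne']

section

variable {φ : ℝ → ℝ} {κ : E3 → ℝ} {a b : ℝ}

lemma bumpField_eq_zero (h0 : ∀ x ∉ Ioo a b, φ x = 0) {x : E3} (hx : ‖x‖ ∉ Ioo a b) :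
    bumpField φ κ x = 0 := by
  simp [bumpField, h0 _ hx]

lemma contDiff_bumpField (ha : 0 < a) (hφ : ContDiff ℝ (⊤ : ℕ∞) φ) (hκ : ContDiff ℝ (⊤ : ℕ∞) κ)
    (h0 : ∀ x ∉ Ioo a b, φ x = 0) : ContDiff ℝ (⊤ : ℕ∞) (bumpField φ κ) := by
  rw [contDiff_iff_contDiffAt]
  intro x
  by_cases hx : x = 0
  · have : bumpField φ κ =ᶠ[𝓝 x] fun _ => 0 := by
      have h1 : ∀ᶠ y in 𝓝 x, ‖y‖ < a :=
        continuous_norm.continuousAt.eventually_lt continuousAt_const (by simpa [hx] using ha)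
      filter_upwards [h1] with y hy using bumpField_eq_zero h0 fun h => by linarith [h.1]
    exact contDiffAt_const.congr_of_eventuallyEq this
  · have hn : ContDiffAt ℝ (⊤ : ℕ∞) (fun y : E3 => ‖y‖) x := contDiffAt_norm ℝ hx
    have hn0 : ‖x‖ ≠ 0 := by simpa using hx
    exact (((hn.pow 3).inv (pow_ne_zero 3 hn0)).mul (hφ.contDiffAt.comp x hn)).mul
      (hκ.contDiffAt.comp x ((hn.inv hn0).smul contDiffAt_id))

/-- The divergence of `x ↦ bumpField φ κ x • x` is `|x|⁻² φ'(|x|) κ(x/|x|)`: the factor `|x|⁻³ x` is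
divergence free, and `κ(x/|x|)` is constant along rays. -/
lemma sum_partialDeriv_bumpField (hd : Differentiable ℝ (bumpField φ κ)) (hφ : Differentiable ℝ φ)
    {r : ℝ} (hr : 0 < r) (ω : S2) :
    ∑ i, partialDeriv i (fun y => y i * bumpField φ κ y) (r • (ω : E3))
      = (r ^ 2)⁻¹ * deriv φ r * κ ω := by
  set x : E3 := r • (ω : E3) with hx
  have hpart : ∀ i, partialDeriv i (fun y => y i * bumpField φ κ y) x
      = bumpField φ κ x
        + x i * fderiv ℝ (bumpField φ κ) x (EuclideanSpace.single i 1) := fun i => by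
    have h1 : HasFDerivAt (fun y : E3 => y i) (EuclideanSpace.proj i : E3 →L[ℝ] ℝ) x :=
      (EuclideanSpace.proj i : E3 →L[ℝ] ℝ).hasFDerivAt
    have h2 := h1.fun_mul (hd x).hasFDerivAt
    rw [partialDeriv, h2.fderiv]
    simp
    ring
  have hsum : ∑ i, x i * fderiv ℝ (bumpField φ κ) x (EuclideanSpace.single i 1)
      = fderiv ℝ (bumpField φ κ) x x := by
    have h1 : x = ∑ i, x i • EuclideanSpace.single i (1 : ℝ) := by
      ext j
      simp [Finset.sum_apply, Pi.single_apply]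
    conv_rhs => rw [h1]
    rw [map_sum]
    conv_rhs => rw [← h1]
    simp
  have hray : HasDerivAt (fun s : ℝ => bumpField φ κ (s • (ω : E3)))
      (fderiv ℝ (bumpField φ κ) x ω) r := by
    have h1 : HasDerivAt (fun s : ℝ => s • (ω : E3)) (ω : E3) r := by
      simpa using (hasDerivAt_id r).smul_const (ω : E3)
    exact (hd x).hasFDerivAt.comp_hasDerivAt r h1
  have hray' : HasDerivAt (fun s : ℝ => bumpField φ κ (s • (ω : E3)))
      ((-(3 * r ^ 2) / (r ^ 3) ^ 2 * φ r + (r ^ 3)⁻¹ * deriv φ r) * κ ω) r := by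
    have h1 : HasDerivAt (fun s : ℝ => (s ^ 3)⁻¹ * φ s * κ ω)
        ((-(3 * r ^ 2) / (r ^ 3) ^ 2 * φ r + (r ^ 3)⁻¹ * deriv φ r) * κ ω) r := by
      have h2 := (hasDerivAt_pow 3 r).fun_inv (pow_ne_zero 3 hr.ne')
      simpa using (h2.fun_mul (hφ r).hasDerivAt).mul_const (κ ω)
    refine h1.congr_of_eventuallyEq ?_
    filter_upwards [Ioi_mem_nhds hr] with s hs using bumpField_polar φ κ hs ω
  have hself : fderiv ℝ (bumpField φ κ) x x = r * fderiv ℝ (bumpField φ κ) x ω := by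
    conv_lhs => rw [hx, map_smul, smul_eq_mul]
  simp only [hpart, Finset.sum_add_distrib, hsum, hself, hray.unique hray']
  rw [bumpField_polar φ κ hr]
  simp
  field_simp
  ring

lemma isTest_coord_mul_bumpField {R : ℝ} (ha : 0 < a) (hb : b < R) (hφ : ContDiff ℝ (⊤ : ℕ∞) φ)
    (hκ : ContDiff ℝ (⊤ : ℕ∞) κ) (h0 : ∀ x ∉ Ioo a b, φ x = 0) (i : Fin 3) :
    IsTest (ball 0 R) fun y => y i * bumpField φ κ y := by
  have hsub : tsupport (fun y : E3 => y i * bumpField φ κ y) ⊆ closedBall 0 b :=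
    closure_minimal (fun x hx => by
      by_contra h
      refine hx ?_
      simp only
      rw [bumpField_eq_zero h0 fun h' => h (by simpa using h'.2.le), mul_zero]) isClosed_closedBall
  exact ⟨(EuclideanSpace.proj i : E3 →L[ℝ] ℝ).contDiff.mul (contDiff_bumpField ha hφ hκ h0),
    (isCompact_closedBall _ _).of_isClosed_subset (isClosed_tsupport _) hsub,
    hsub.trans (closedBall_subset_ball hb)⟩

end

lemma integrableOn_mul_of_hasCompactSupport {R : ℝ} {f : E3 → ℝ} (hf : IntegrableOn f (ball 0 R))
    {q : E3 → ℝ} (hq : Continuous q) (hc : HasCompactSupport q) :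
    IntegrableOn (fun x => f x * q x) (ball 0 R) := by
  obtain ⟨K, hK⟩ := hc.exists_bound_of_continuous hq
  exact Integrable.mul_bdd hf hq.aestronglyMeasurable (.of_forall hK)

lemma IsTest.continuous_partialDeriv {U : Set E3} {q : E3 → ℝ} (hq : IsTest U q) (i : Fin 3) :
    Continuous (partialDeriv i q) :=
  (hq.smooth.continuous_fderiv (by norm_cast)).clm_apply continuous_const

lemma IsTest.hasCompactSupport_partialDeriv {U : Set E3} {q : E3 → ℝ} (hq : IsTest U q)
    (i : Fin 3) : HasCompactSupport (partialDeriv i q) :=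
  (hq.compact.fderiv (𝕜 := ℝ)).mono fun x hx => by
    simp only [Function.mem_support, partialDeriv] at hx ⊢
    intro h
    simp [h] at hx

lemma norm_unit_coord_le (x : E3) (i : Fin 3) : ‖‖x‖⁻¹ * x i‖ ≤ 1 := by
  rw [norm_mul, norm_inv, norm_norm]
  rcases eq_or_ne x 0 with rfl | hx
  · simp
  · rw [inv_mul_le_iff₀ (by simpa using hx), mul_one]
    exact PiLp.norm_apply_le x i

/-- An angular moment of an `H¹` function has a weak derivative in the radius, so that it has a
representative which is continuous up to the boundary. -/
lemma exists_continuousOn_moment {R : ℝ} (hR : 0 < R) {f : E3 → ℝ} (hf : MemH1 (ball 0 R) f)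
    {κ : E3 → ℝ} (hκ : ContDiff ℝ (⊤ : ℕ∞) κ) :
    ∃ u : ℝ → ℝ, ContinuousOn u (Ioc 0 R) ∧ ∀ᵐ r ∂(volume.restrict (Ioo 0 R)),
      u r = ∫ ω : S2, f (r • (ω : E3)) * κ ω ∂surf := by
  obtain ⟨hf2, hd⟩ := hf
  choose d hd2 hdw using hd
  have hfi := memLp_two_integrableOn hf2
  have hdi := fun i => memLp_two_integrableOn (hd2 i)
  have hκc : Continuous fun ω : S2 => κ ω := hκ.continuous.comp continuous_subtype_val
  set F : E3 → ℝ := fun x => ∑ i, d i x * (‖x‖⁻¹ * x i) with hF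
  have hFi : IntegrableOn F (ball 0 R) := by
    refine integrable_finsetSum _ fun i _ => ?_
    exact Integrable.mul_bdd (c := 1) (hdi i) (by fun_prop)
      (.of_forall fun x => norm_unit_coord_le x i)
  have hA := integrableOn_sq_mul_moment hfi hκc
  have hD := integrableOn_sq_mul_moment hFi hκc
  refine exists_continuousOn_of_weak_deriv hR (locallyIntegrableOn_of_sq_mul hA)
    (fun ε hε => intervalIntegrable_of_sq_mul hD hε) fun φ hφ hφc hφs => ?_
  obtain ⟨a, b, ha, hab, hb, hK⟩ := exists_Icc_of_isCompact_subset_Ioo hR hφc hφs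
  have h0 : ∀ x ∉ Ioo a b, φ x = 0 := fun x hx =>
    image_eq_zero_of_notMem_tsupport fun h => hx (hK h)
  have htest := isTest_coord_mul_bumpField ha hb hφ hκ h0
  have hBs := contDiff_bumpField ha hφ hκ h0
  have hw : ∫ x in ball (0 : E3) R,
        f x * ∑ i, partialDeriv i (fun y => y i * bumpField φ κ y) x
      = - ∫ x in ball (0 : E3) R, ∑ i, d i x * (x i * bumpField φ κ x) := by
    simp only [Finset.mul_sum]
    rw [integral_finsetSum _ fun i _ => integrableOn_mul_of_hasCompactSupport hfi
        ((htest i).continuous_partialDeriv i) ((htest i).hasCompactSupport_partialDeriv i),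
      integral_finsetSum _ fun i _ => integrableOn_mul_of_hasCompactSupport (hdi i)
        (htest i).smooth.continuous (htest i).compact, ← Finset.sum_neg_distrib]
    exact Finset.sum_congr rfl fun i _ => (hdw i).eq _ (htest i)
  rw [polar_ball_integral (by
      simp only [Finset.mul_sum]
      exact integrable_finsetSum _ fun i _ => integrableOn_mul_of_hasCompactSupport hfi
        ((htest i).continuous_partialDeriv i) ((htest i).hasCompactSupport_partialDeriv i)),
    polar_ball_integral (integrable_finsetSum _ fun i _ => integrableOn_mul_of_hasCompactSupport
      (hdi i) (htest i).smooth.continuous (htest i).compact)] at hw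
  refine Eq.trans (setIntegral_congr_fun measurableSet_Ioo fun r hr => ?_)
    (hw.trans (congrArg _ (setIntegral_congr_fun measurableSet_Ioo fun r hr => ?_)))
  · simp only [sum_partialDeriv_bumpField (hBs.differentiable (by norm_cast))
      (hφ.differentiable (by norm_cast)) hr.1]
    have : ∀ ω : S2, f (r • (ω : E3)) * ((r ^ 2)⁻¹ * deriv φ r * κ ω)
        = ((r ^ 2)⁻¹ * deriv φ r) * (f (r • (ω : E3)) * κ ω) := fun ω => by ring
    simp only [this, integral_const_mul]
    have := hr.1.ne'
    field_simp
  · simp only [bumpField_polar φ κ hr.1]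
    have : ∀ ω : S2, ∑ i, d i (r • (ω : E3)) * ((r • (ω : E3)) i * ((r ^ 3)⁻¹ * φ r * κ ω))
        = ((r ^ 2)⁻¹ * φ r) * (F (r • (ω : E3)) * κ ω) := fun ω => by
      simp only [hF, Finset.sum_mul, Finset.mul_sum, norm_smul_sphere hr.1]
      refine Finset.sum_congr rfl fun i _ => ?_
      have := hr.1.ne'
      field_simp
    simp only [this, integral_const_mul]
    have := hr.1.ne'
    field_simp

/-! ### The product rule for weak derivatives -/

section

variable {R : ℝ} {f d A B : E3 → ℝ} {i : Fin 3}

lemma partialDeriv_mul {a φ : E3 → ℝ} {x : E3} (ha : DifferentiableAt ℝ a x)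
    (hφ : DifferentiableAt ℝ φ x) :
    partialDeriv i (fun y => a y * φ y) x
      = a x * partialDeriv i φ x + partialDeriv i a x * φ x := by
  have h := ha.hasFDerivAt.fun_mul hφ.hasFDerivAt
  rw [partialDeriv, h.fderiv]
  simp [partialDeriv]
  ring

lemma IsTest.mul_left {U : Set E3} {a φ : E3 → ℝ} (hφ : IsTest U φ) (ha : ContDiff ℝ (⊤ : ℕ∞) a) :
    IsTest U fun y => a y * φ y :=
  ⟨ha.mul hφ.smooth, hφ.compact.mul_left, (tsupport_mul_subset_right).trans hφ.support⟩

/-- A factor that is, together with its gradient, a uniform limit of smooth functions on the ball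
obeys the product rule with weak derivatives. -/
lemma HasWeakPartial.integral_mul_eq (hf : IntegrableOn f (ball 0 R))
    (hd : IntegrableOn d (ball 0 R)) (hw : HasWeakPartial (ball 0 R) f i d)
    (hA : AEStronglyMeasurable A (volume.restrict (ball 0 R)))
    (hB : AEStronglyMeasurable B (volume.restrict (ball 0 R))) {K : ℝ}
    (hAK : ∀ x ∈ ball (0 : E3) R, ‖A x‖ ≤ K) (hBK : ∀ x ∈ ball (0 : E3) R, ‖B x‖ ≤ K)
    (happ : ∀ ε > 0, ∃ a : E3 → ℝ, ContDiff ℝ (⊤ : ℕ∞) a ∧ ∀ x ∈ ball (0 : E3) R,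
      |a x - A x| ≤ ε ∧ |partialDeriv i a x - B x| ≤ ε)
    {φ : E3 → ℝ} (hφ : IsTest (ball 0 R) φ) :
    ∫ x in ball (0 : E3) R, A x * f x * partialDeriv i φ x
      = - ∫ x in ball (0 : E3) R, (A x * d x + B x * f x) * φ x := by
  have hAae : ∀ᵐ x ∂(volume.restrict (ball (0 : E3) R)), ‖A x‖ ≤ K :=
    (ae_restrict_mem measurableSet_ball).mono hAK
  have hBae : ∀ᵐ x ∂(volume.restrict (ball (0 : E3) R)), ‖B x‖ ≤ K :=
    (ae_restrict_mem measurableSet_ball).mono hBK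
  have i1 : IntegrableOn (fun x => f x * partialDeriv i φ x) (ball 0 R) :=
    integrableOn_mul_of_hasCompactSupport hf (hφ.continuous_partialDeriv i)
      (hφ.hasCompactSupport_partialDeriv i)
  have i2 : IntegrableOn (fun x => d x * φ x) (ball 0 R) :=
    integrableOn_mul_of_hasCompactSupport hd hφ.smooth.continuous hφ.compact
  have i3 : IntegrableOn (fun x => f x * φ x) (ball 0 R) :=
    integrableOn_mul_of_hasCompactSupport hf hφ.smooth.continuous hφ.compact
  have j1 : IntegrableOn (fun x => A x * (f x * partialDeriv i φ x)) (ball 0 R) :=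
    Integrable.bdd_mul i1 hA hAae
  have j2 : IntegrableOn (fun x => A x * (d x * φ x)) (ball 0 R) := Integrable.bdd_mul i2 hA hAae
  have j3 : IntegrableOn (fun x => B x * (f x * φ x)) (ball 0 R) := Integrable.bdd_mul i3 hB hBae
  have j12 : IntegrableOn (fun x => A x * (f x * partialDeriv i φ x) + A x * (d x * φ x))
      (ball 0 R) := Integrable.add j1 j2
  have j123 : IntegrableOn (fun x => A x * (f x * partialDeriv i φ x) + A x * (d x * φ x)
      + B x * (f x * φ x)) (ball 0 R) := Integrable.add j12 j3
  set T : ℝ := ∫ x in ball (0 : E3) R, (A x * (f x * partialDeriv i φ x) + A x * (d x * φ x)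
    + B x * (f x * φ x)) with hT
  suffices hT0 : T = 0 by
    rw [hT, integral_add j12 j3, integral_add j1 j2] at hT0
    have e1 : ∫ x in ball (0 : E3) R, (A x * d x + B x * f x) * φ x
        = (∫ x in ball (0 : E3) R, A x * (d x * φ x))
          + ∫ x in ball (0 : E3) R, B x * (f x * φ x) := by
      rw [← integral_add j2 j3]
      exact integral_congr_ae (.of_forall fun x => by ring)
    simp only [mul_assoc] at e1 hT0 ⊢
    linarith
  set S : ℝ := ∫ x in ball (0 : E3) R, (|f x * partialDeriv i φ x| + |d x * φ x| + |f x * φ x|)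
    with hS
  have hS0 : 0 ≤ S := integral_nonneg fun x => by positivity
  have key : ∀ ε > 0, |T| ≤ ε * S := fun ε hε => by
    obtain ⟨a, ha, hax⟩ := happ ε hε
    have hte := hφ.mul_left ha
    have hp : ∀ x, partialDeriv i (fun y => a y * φ y) x
        = a x * partialDeriv i φ x + partialDeriv i a x * φ x := fun x =>
      partialDeriv_mul (ha.differentiable (by norm_cast) x)
        (hφ.smooth.differentiable (by norm_cast) x)
    have hz : ∫ x in ball (0 : E3) R, (f x * partialDeriv i (fun y => a y * φ y) x
        + d x * (a x * φ x)) = 0 := by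
      rw [integral_add (integrableOn_mul_of_hasCompactSupport hf (hte.continuous_partialDeriv i)
        (hte.hasCompactSupport_partialDeriv i)) (integrableOn_mul_of_hasCompactSupport hd
        hte.smooth.continuous hte.compact), hw.eq _ hte]
      ring
    have iz : IntegrableOn (fun x => f x * partialDeriv i (fun y => a y * φ y) x
        + d x * (a x * φ x)) (ball 0 R) :=
      Integrable.add (integrableOn_mul_of_hasCompactSupport hf (hte.continuous_partialDeriv i)
        (hte.hasCompactSupport_partialDeriv i)) (integrableOn_mul_of_hasCompactSupport hd
        hte.smooth.continuous hte.compact)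
    have hTd : T = ∫ x in ball (0 : E3) R, ((A x * (f x * partialDeriv i φ x) + A x * (d x * φ x)
        + B x * (f x * φ x)) - (f x * partialDeriv i (fun y => a y * φ y) x
        + d x * (a x * φ x))) := by
      rw [integral_sub j123 iz, hz, sub_zero]
    rw [hTd, ← Real.norm_eq_abs, hS, ← integral_const_mul]
    refine norm_integral_le_of_norm_le ?_ ?_
    · exact ((i1.norm.add i2.norm).add i3.norm).const_mul ε
    filter_upwards [ae_restrict_mem measurableSet_ball] with x hx
    obtain ⟨h1, h2⟩ := hax x hx
    rw [hp, Real.norm_eq_abs]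
    have e : (A x * (f x * partialDeriv i φ x) + A x * (d x * φ x) + B x * (f x * φ x))
        - (f x * (a x * partialDeriv i φ x + partialDeriv i a x * φ x) + d x * (a x * φ x))
        = -((a x - A x) * (f x * partialDeriv i φ x) + (a x - A x) * (d x * φ x)
          + (partialDeriv i a x - B x) * (f x * φ x)) := by ring
    rw [e, abs_neg]
    refine (abs_add_three _ _ _).trans ?_
    rw [abs_mul (a x - A x), abs_mul (a x - A x) (d x * φ x), abs_mul (partialDeriv i a x - B x)]
    have t1 := mul_le_mul_of_nonneg_right h1 (abs_nonneg (f x * partialDeriv i φ x))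
    have t2 := mul_le_mul_of_nonneg_right h1 (abs_nonneg (d x * φ x))
    have t3 := mul_le_mul_of_nonneg_right h2 (abs_nonneg (f x * φ x))
    linarith
  have hlim : |T| ≤ 0 := by
    refine le_of_forall_pos_le_add fun ε hε => ?_
    refine (key (ε / (S + 1)) (by positivity)).trans ?_
    rw [zero_add, div_mul_eq_mul_div, div_le_iff₀ (by positivity)]
    nlinarith
  exact abs_eq_zero.1 (le_antisymm hlim (abs_nonneg _))

end

/-! ### Radial factors -/

section

variable {R : ℝ} {ρ : ℝ → ℝ}

lemma contDiffOn_radDeriv (hR : 0 < R) (hρ : ContDiffOn ℝ 2 ρ (Icc 0 R)) :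
    ContDiffOn ℝ 1 (radDeriv R ρ) (Icc 0 R) :=
  hρ.derivWithin (uniqueDiffOn_Icc hR) (by norm_num)

lemma hasDerivWithinAt_radDeriv {f : ℝ → ℝ} (hf : DifferentiableOn ℝ f (Icc 0 R)) {r : ℝ}
    (hr : r ∈ Icc 0 R) : HasDerivWithinAt f (radDeriv R f r) (Icc 0 R) r :=
  (hf r hr).hasDerivWithinAt

/-- A `C²` radial profile with `ρ'(0) = 0` is a `C¹` function of `r²`: `ρ'(r) / r` is a continuous
function of `r²`. -/
lemma exists_continuousOn_div (hR : 0 < R) (hρ : ContDiffOn ℝ 2 ρ (Icc 0 R))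
    (h0 : radDeriv R ρ 0 = 0) : ∃ σ : ℝ → ℝ, ContinuousOn σ (Icc 0 (R ^ 2)) ∧
      ∀ r ∈ Icc 0 R, radDeriv R ρ r = 2 * r * σ (r ^ 2) := by
  have h1 := contDiffOn_radDeriv hR hρ
  have hd : HasDerivWithinAt (radDeriv R ρ) (radDeriv R (radDeriv R ρ) 0) (Icc 0 R) 0 :=
    hasDerivWithinAt_radDeriv (h1.differentiableOn (by norm_num)) ⟨le_rfl, hR.le⟩
  set c := radDeriv R (radDeriv R ρ) 0
  set τ : ℝ → ℝ := Function.update (fun r => radDeriv R ρ r / r) 0 c with hτ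
  have hτc : ContinuousOn τ (Icc 0 R) := fun r hr => by
    rcases eq_or_ne r 0 with rfl | hr0
    · rw [hτ, continuousWithinAt_update_same]
      rw [hasDerivWithinAt_iff_tendsto_slope] at hd
      refine hd.congr fun r => ?_
      simp [slope_def_field, h0]
    · rw [hτ, continuousWithinAt_update_of_ne hr0]
      exact (h1.continuousOn r hr).div continuousWithinAt_id hr0
  refine ⟨fun t => τ √t / 2, ?_, fun r hr => ?_⟩
  · refine (hτc.comp Real.continuous_sqrt.continuousOn fun t ht => ?_).div_const 2
    exact ⟨Real.sqrt_nonneg t, Real.sqrt_le_iff.2 ⟨hR.le, ht.2⟩⟩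
  · simp only [Real.sqrt_sq hr.1]
    rcases eq_or_ne r 0 with rfl | hr0
    · simp [h0]
    · rw [hτ, Function.update_of_ne hr0]
      field_simp

/-- A radial `C²` function on the ball is approximated in `C¹` by polynomials in `|x|²`. -/
lemma exists_smooth_near_radial (hR : 0 < R) (hρ : ContDiffOn ℝ 2 ρ (Icc 0 R))
    (h0 : radDeriv R ρ 0 = 0) {ε : ℝ} (hε : 0 < ε) :
    ∃ a : E3 → ℝ, ContDiff ℝ (⊤ : ℕ∞) a ∧ ∀ i, ∀ x ∈ ball (0 : E3) R,
      |a x - ρ ‖x‖| ≤ ε ∧ |partialDeriv i a x - ‖x‖⁻¹ * x i * radDeriv R ρ ‖x‖| ≤ ε := by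
  obtain ⟨σ, hσ, hσρ⟩ := exists_continuousOn_div hR hρ h0
  set δ : ℝ := ε / (2 * R * (R + 1)) with hδ
  have hδ0 : 0 < δ := by positivity
  have hδ1 : 2 * R * δ ≤ ε := by
    rw [hδ]; field_simp; linarith
  have hδ2 : 2 * R * δ * R ≤ ε := by
    rw [hδ]; field_simp; linarith
  obtain ⟨q, hq⟩ := exists_polynomial_near_of_continuousOn 0 (R ^ 2) σ hσ δ hδ0
  set P : ℝ → ℝ := fun t => ρ 0 + ∫ s in (0 : ℝ)..t, q.eval s with hP
  have hPd : ∀ t, HasDerivAt P (q.eval t) t := fun t =>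
    (intervalIntegral.integral_hasDerivAt_right (q.continuous.intervalIntegrable _ _)
      q.continuous.aestronglyMeasurable.stronglyMeasurableAtFilter
      q.continuous.continuousAt).const_add _
  have hPs : ContDiff ℝ (⊤ : ℕ∞) P := by
    refine contDiff_infty_iff_deriv.2 ⟨fun t => (hPd t).differentiableAt, ?_⟩
    rw [funext fun t => (hPd t).deriv]
    simpa [Polynomial.coe_aeval_eq_eval] using q.contDiff_aeval (𝕜 := ℝ) (⊤ : ℕ∞)
  have hr2 : ∀ r ∈ Icc 0 R, r ^ 2 ∈ Icc 0 (R ^ 2) := fun r hr =>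
    ⟨sq_nonneg r, pow_le_pow_left₀ hr.1 hr.2 2⟩
  refine ⟨fun x => P (‖x‖ ^ 2), hPs.comp (contDiff_norm_sq ℝ), fun i x hx => ?_⟩
  have hxR : ‖x‖ ∈ Icc 0 R := ⟨norm_nonneg x, (mem_ball_zero_iff.1 hx).le⟩
  constructor
  · have hder : ∀ r ∈ Icc 0 R, HasDerivWithinAt (fun r => P (r ^ 2) - ρ r)
        (q.eval (r ^ 2) * (2 * r) - radDeriv R ρ r) (Icc 0 R) r := fun r hr => by
      have h1 := ((hPd (r ^ 2)).comp r (hasDerivAt_pow 2 r)).hasDerivWithinAt (s := Icc 0 R)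
      simpa using h1.fun_sub (hasDerivWithinAt_radDeriv (hρ.differentiableOn (by norm_num)) hr)
    have hb : ∀ r ∈ Icc 0 R,
        ‖q.eval (r ^ 2) * (2 * r) - radDeriv R ρ r‖ ≤ 2 * R * δ := fun r hr => by
      rw [hσρ r hr, show q.eval (r ^ 2) * (2 * r) - 2 * r * σ (r ^ 2)
        = 2 * r * (q.eval (r ^ 2) - σ (r ^ 2)) by ring, Real.norm_eq_abs, abs_mul,
        abs_of_nonneg (by linarith [hr.1])]
      exact mul_le_mul (by linarith [hr.2]) (hq _ (hr2 r hr)).le (abs_nonneg _) (by linarith)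
    have := (convex_Icc (0 : ℝ) R).norm_image_sub_le_of_norm_hasDerivWithin_le hder hb
      (x := 0) ⟨le_rfl, hR.le⟩ hxR
    have h00 : P (0 ^ 2) - ρ 0 = 0 := by simp [hP]
    rw [h00, sub_zero, sub_zero, norm_norm, Real.norm_eq_abs] at this
    exact this.trans ((mul_le_mul_of_nonneg_left hxR.2 (by positivity)).trans hδ2)
  · have hpd : partialDeriv i (fun x : E3 => P (‖x‖ ^ 2)) x = q.eval (‖x‖ ^ 2) * (2 * x i) := by
      have h1 := (hPd (‖x‖ ^ 2)).comp_hasFDerivAt x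
        (HasStrictFDerivAt.hasFDerivAt (hasStrictFDerivAt_norm_sq x))
      have h2 : HasFDerivAt (fun x : E3 => P (‖x‖ ^ 2)) _ x := h1
      rw [partialDeriv, h2.fderiv]
      simp [EuclideanSpace.inner_single_right]
    have hB : ‖x‖⁻¹ * x i * radDeriv R ρ ‖x‖ = 2 * x i * σ (‖x‖ ^ 2) := by
      rw [hσρ _ hxR]
      rcases eq_or_ne x 0 with rfl | hx0
      · simp
      · have : ‖x‖ ≠ 0 := norm_ne_zero_iff.2 hx0
        field_simp
    rw [hpd, hB, show q.eval (‖x‖ ^ 2) * (2 * x i) - 2 * x i * σ (‖x‖ ^ 2)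
      = 2 * x i * (q.eval (‖x‖ ^ 2) - σ (‖x‖ ^ 2)) by ring, abs_mul]
    have hxi : |2 * x i| ≤ 2 * R := by
      rw [abs_mul, abs_two]
      have : |x i| ≤ ‖x‖ := PiLp.norm_apply_le x i
      linarith [hxR.2]
    exact (mul_le_mul hxi (hq _ (hr2 _ hxR)).le (abs_nonneg _) (by positivity)).trans hδ1

end

/-! ### The weak divergence and its modes -/

/-- A smooth extension of `sphY l m` to all of space, given by the same formula. -/
noncomputable def sphYExt (l : ℕ) (m : ℤ) (x : E3) : ℝ :=
  let k := m.natAbs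
  let N : ℝ := √((2 * l + 1) / (4 * Real.pi) * (((l - k).factorial : ℝ) / ((l + k).factorial : ℝ)))
  let q : ℝ := (derivative^[k] (legendreP l)).eval (x 2)
  let z : ℂ := ((x 0 : ℂ) + x 1 * Complex.I) ^ k
  if m = 0 then N * q else if 0 < m then √2 * N * q * z.re else √2 * N * q * z.im

lemma sphYExt_coe (l : ℕ) (m : ℤ) (ω : S2) : sphYExt l m ω = sphY l m ω := by
  simp only [sphYExt, sphY, Complex.mk_eq_add_mul_I]

lemma contDiff_coord (i : Fin 3) : ContDiff ℝ (⊤ : ℕ∞) fun x : E3 => x i :=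
  (EuclideanSpace.proj i : E3 →L[ℝ] ℝ).contDiff

lemma contDiff_sphYExt (l : ℕ) (m : ℤ) : ContDiff ℝ (⊤ : ℕ∞) (sphYExt l m) := by
  have hq : ContDiff ℝ (⊤ : ℕ∞) fun x : E3 => (derivative^[m.natAbs] (legendreP l)).eval (x 2) := by
    have := (derivative^[m.natAbs] (legendreP l)).contDiff_aeval (𝕜 := ℝ) (⊤ : ℕ∞)
    simp only [Polynomial.coe_aeval_eq_eval] at this
    exact this.comp (contDiff_coord 2)
  have hz : ContDiff ℝ (⊤ : ℕ∞) fun x : E3 => ((x 0 : ℂ) + x 1 * Complex.I) ^ m.natAbs :=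
    ((Complex.ofRealCLM.contDiff.comp (contDiff_coord 0)).add
      ((Complex.ofRealCLM.contDiff.comp (contDiff_coord 1)).mul contDiff_const)).pow _
  unfold sphYExt
  simp only
  split_ifs
  · exact contDiff_const.mul hq
  · exact (contDiff_const.mul hq).mul (Complex.reCLM.contDiff.comp hz)
  · exact (contDiff_const.mul hq).mul (Complex.imCLM.contDiff.comp hz)

lemma HasWeakDiv.ae_eq {R : ℝ} {F : E3 → E3} {d d' : E3 → ℝ} (h : HasWeakDiv (ball 0 R) F d)
    (h' : HasWeakDiv (ball 0 R) F d') : d =ᵐ[volume.restrict (ball 0 R)] d' := by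
  have key := isOpen_ball.ae_eq_zero_of_integral_contDiff_smul_eq_zero (μ := volume)
    (h.locInt_div.sub h'.locInt_div) fun φ hφ hc hs => by
      have hint : ∀ {e : E3 → ℝ}, LocallyIntegrableOn e (ball 0 R) →
          IntegrableOn (fun x => e x * φ x) (ball 0 R) := fun {e} he => by
        have h1 : IntegrableOn (fun x => e x * φ x) (tsupport φ) :=
          (he.integrableOn_compact_subset hs hc).mul_continuousOn hφ.continuous.continuousOn hc
        refine ((integrableOn_iff_integrable_of_support_subset fun x hx => ?_).1 h1).integrableOn
        exact subset_tsupport φ fun h0 => hx (by simp [h0])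
      rw [← setIntegral_eq_integral_of_forall_compl_eq_zero (s := ball 0 R) fun x hx => by
        rw [image_eq_zero_of_notMem_tsupport fun h0 => hx (hs h0), zero_smul]]
      have e1 := (h.eq φ ⟨hφ, hc, hs⟩).symm.trans (h'.eq φ ⟨hφ, hc, hs⟩)
      have e2 : ∀ x, φ x • (d - d') x = d x * φ x - d' x * φ x := fun x => by
        simp only [smul_eq_mul, Pi.sub_apply]; ring
      simp only [e2]
      rw [integral_sub (hint h.locInt_div) (hint h'.locInt_div)]
      linarith
  rw [Filter.EventuallyEq, ae_restrict_iff' measurableSet_ball]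
  filter_upwards [key] with x hx hxb
  simpa [sub_eq_zero] using hx hxb

lemma HasWeakDiv.weakDiv_ae_eq {R : ℝ} {F : E3 → E3} {d : E3 → ℝ}
    (h : HasWeakDiv (ball 0 R) F d) : weakDiv (ball 0 R) F =ᵐ[volume.restrict (ball 0 R)] d := by
  have hex : ∃ d, HasWeakDiv (ball 0 R) F d := ⟨d, h⟩
  rw [weakDiv, dif_pos hex]
  exact hex.choose_spec.ae_eq h

lemma MemH2.memH1 {U : Set E3} {f : E3 → ℝ} (hf : MemH2 U f) : MemH1 U f :=
  ⟨hf.1, fun i => (hf.2 i).imp fun _ h => ⟨h.1.1, h.2⟩⟩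

lemma norm_mem_Icc {R : ℝ} {x : E3} (hx : x ∈ ball (0 : E3) R) : ‖x‖ ∈ Icc 0 R :=
  ⟨norm_nonneg x, (mem_ball_zero_iff.1 hx).le⟩

lemma aestronglyMeasurable_radial {R : ℝ} {f : ℝ → ℝ} (hf : ContinuousOn f (Icc 0 R)) :
    AEStronglyMeasurable (fun x : E3 => f ‖x‖) (volume.restrict (ball 0 R)) :=
  (hf.comp continuous_norm.continuousOn fun _ hx => norm_mem_Icc hx).aestronglyMeasurable
    measurableSet_ball

section

variable {R : ℝ} {ρ : ℝ → ℝ} {θ : E3 → E3} {D : Fin 3 → E3 → ℝ}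

/-- The product rule `div (ρ θ) = ρ div θ + ∇ρ · θ`, where `∇ρ(|x|) = ρ'(|x|) x / |x|`. -/
lemma hasWeakDiv_radial_smul (hR : 0 < R) (hρ : ContDiffOn ℝ 2 ρ (Icc 0 R))
    (h0 : radDeriv R ρ 0 = 0) (hθ : ∀ i, MemLp (fun x => θ x i) 2 (volume.restrict (ball 0 R)))
    (hD : ∀ i, MemLp (D i) 2 (volume.restrict (ball 0 R)))
    (hw : ∀ i, HasWeakPartial (ball 0 R) (fun x => θ x i) i (D i)) :
    HasWeakDiv (ball 0 R) (fun x => ρ ‖x‖ • θ x)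
        (fun x => ∑ i, (ρ ‖x‖ * D i x + ‖x‖⁻¹ * x i * radDeriv R ρ ‖x‖ * θ x i)) ∧
      MemLp (fun x => ∑ i, (ρ ‖x‖ * D i x + ‖x‖⁻¹ * x i * radDeriv R ρ ‖x‖ * θ x i)) 2
        (volume.restrict (ball 0 R)) := by
  have hc' := (contDiffOn_radDeriv hR hρ).continuousOn
  obtain ⟨K₁, hK₁⟩ := isCompact_Icc.exists_bound_of_continuousOn hρ.continuousOn
  obtain ⟨K₂, hK₂⟩ := isCompact_Icc.exists_bound_of_continuousOn hc'
  set K := max K₁ K₂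
  have hA := aestronglyMeasurable_radial hρ.continuousOn
  have hB : ∀ i, AEStronglyMeasurable (fun x : E3 => ‖x‖⁻¹ * x i * radDeriv R ρ ‖x‖)
      (volume.restrict (ball 0 R)) := fun i =>
    AEStronglyMeasurable.mul (by fun_prop) (aestronglyMeasurable_radial hc')
  have hAK : ∀ x ∈ ball (0 : E3) R, ‖ρ ‖x‖‖ ≤ K := fun x hx =>
    (hK₁ _ (norm_mem_Icc hx)).trans (le_max_left _ _)
  have hBK : ∀ i, ∀ x ∈ ball (0 : E3) R, ‖‖x‖⁻¹ * x i * radDeriv R ρ ‖x‖‖ ≤ K := fun i x hx => by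
    rw [norm_mul]
    refine (mul_le_mul (norm_unit_coord_le x i) ((hK₂ _ (norm_mem_Icc hx)).trans
      (le_max_right _ _)) (norm_nonneg _) zero_le_one).trans (one_mul _).le
  have hA2 : ∀ {f : E3 → ℝ}, MemLp f 2 (volume.restrict (ball 0 R)) →
      MemLp (fun x => ρ ‖x‖ * f x) 2 (volume.restrict (ball 0 R)) := fun {f} hf =>
    MemLp.of_le_mul (c := K) hf (hA.mul hf.1) ((ae_restrict_mem measurableSet_ball).mono
      fun x hx => by rw [norm_mul]; exact mul_le_mul_of_nonneg_right (hAK x hx) (norm_nonneg _))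
  have hB2 : ∀ i, MemLp (fun x => ‖x‖⁻¹ * x i * radDeriv R ρ ‖x‖ * θ x i) 2
      (volume.restrict (ball 0 R)) := fun i =>
    MemLp.of_le_mul (c := K) (hθ i) ((hB i).mul (hθ i).1) ((ae_restrict_mem measurableSet_ball).mono
      fun x hx => by rw [norm_mul]; exact mul_le_mul_of_nonneg_right (hBK i x hx) (norm_nonneg _))
  have hd2 : ∀ i, MemLp (fun x => ρ ‖x‖ * D i x + ‖x‖⁻¹ * x i * radDeriv R ρ ‖x‖ * θ x i) 2
      (volume.restrict (ball 0 R)) := fun i => (hA2 (hD i)).add (hB2 i)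
  have hsum : MemLp (fun x => ∑ i, (ρ ‖x‖ * D i x + ‖x‖⁻¹ * x i * radDeriv R ρ ‖x‖ * θ x i)) 2
      (volume.restrict (ball 0 R)) := memLp_finsetSum _ fun i _ => hd2 i
  refine ⟨⟨?_, (memLp_two_integrableOn hsum).locallyIntegrableOn, fun φ hφ => ?_⟩, hsum⟩
  · refine IntegrableOn.locallyIntegrableOn (Integrable.of_eval_piLp fun i => ?_)
    have := memLp_two_integrableOn (hA2 (hθ i))
    simpa [IntegrableOn] using this
  · simp only [PiLp.smul_apply, smul_eq_mul, Finset.sum_mul]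
    rw [integral_finsetSum _ fun i _ => integrableOn_mul_of_hasCompactSupport
        (memLp_two_integrableOn (hA2 (hθ i))) (hφ.continuous_partialDeriv i)
        (hφ.hasCompactSupport_partialDeriv i),
      integral_finsetSum _ fun i _ => integrableOn_mul_of_hasCompactSupport
        (memLp_two_integrableOn (hd2 i)) hφ.smooth.continuous hφ.compact,
      ← Finset.sum_neg_distrib]
    refine Finset.sum_congr rfl fun i _ => ?_
    refine (hw i).integral_mul_eq (memLp_two_integrableOn (hθ i)) (memLp_two_integrableOn (hD i))
      hA (hB i) hAK (hBK i) (fun ε hε => ?_) hφ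
    obtain ⟨a, ha, hax⟩ := exists_smooth_near_radial hR hρ h0 hε
    exact ⟨a, ha, hax i⟩

end

lemma ae_ae_polar {R : ℝ} {P : E3 → Prop} (h : ∀ᵐ x ∂(volume.restrict (ball (0 : E3) R)), P x) :
    ∀ᵐ r ∂(volume.restrict (Ioo 0 R)), ∀ᵐ ω : S2 ∂surf, P (r • (ω : E3)) :=
  Measure.ae_ae_of_ae_prod
    (Measure.measurePreserving_swap.quasiMeasurePreserving.ae (polar_ball_ae h))

lemma ae_integrable_slice {R : ℝ} {F : E3 → ℝ} (hF : IntegrableOn F (ball 0 R)) {Y : S2 → ℝ}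
    (hY : Continuous Y) : ∀ᵐ r ∂(volume.restrict (Ioo 0 R)),
      Integrable (fun ω : S2 => F (r • (ω : E3)) * Y ω) surf := by
  filter_upwards [(integrable_polar_mul hF hY).prod_left_ae, ae_restrict_mem measurableSet_Ioo]
    with r hr hr0
  refine (hr.const_mul (r ^ 2)⁻¹).congr (.of_forall fun ω => ?_)
  have := hr0.1.ne'
  simp only
  field_simp

/-- Cauchy–Schwarz on the sphere, with a positive upper bound for `∫ Y²` in place of the integral. -/
lemma sq_integral_mul_le {f Y : S2 → ℝ} {K : ℝ} (hf : Integrable (fun ω => f ω ^ 2) surf)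
    (hfY : Integrable (fun ω => f ω * Y ω) surf) (hY : Continuous Y) (hK : 0 < K)
    (hYK : ∫ ω, Y ω ^ 2 ∂surf ≤ K) :
    (∫ ω, f ω * Y ω ∂surf) ^ 2 ≤ K * ∫ ω, f ω ^ 2 ∂surf := by
  set c := ∫ ω, f ω * Y ω ∂surf with hc
  have hY2 : Integrable (fun ω => Y ω ^ 2) surf := integrable_sphere_real (hY.pow 2)
  have h1 : 0 ≤ ∫ ω, (f ω - c / K * Y ω) ^ 2 ∂surf := integral_nonneg fun ω => sq_nonneg _
  have e : ∀ ω, (f ω - c / K * Y ω) ^ 2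
      = f ω ^ 2 - (2 * (c / K)) * (f ω * Y ω) + (c / K) ^ 2 * Y ω ^ 2 := fun ω => by ring
  simp only [e] at h1
  rw [integral_add (f := fun ω => f ω ^ 2 - (2 * (c / K)) * (f ω * Y ω))
    (hf.sub (hfY.const_mul _)) (hY2.const_mul _), integral_sub hf (hfY.const_mul _),
    integral_const_mul, integral_const_mul, ← hc] at h1
  have h2 := mul_le_mul_of_nonneg_left hYK (sq_nonneg (c / K))
  have h3 : (c / K) ^ 2 * K = c ^ 2 / K := by field_simp
  have h4 : 2 * (c / K) * c = 2 * (c ^ 2 / K) := by ring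
  have h5 : c ^ 2 / K ≤ ∫ ω, f ω ^ 2 ∂surf := by linarith
  rwa [div_le_iff₀ hK, mul_comm] at h5

/-- A mode of a square integrable function is square integrable with the weight `r²`. -/
lemma IsMode.integrableOn_sq {R : ℝ} {g : E3 → ℝ} {l : ℕ} {m : ℤ} {u : ℝ → ℝ}
    (hg : MemLp g 2 (volume.restrict (ball 0 R))) (hu : IsMode R g l m u) :
    IntegrableOn (fun r => (r * u r) ^ 2) (Ioo 0 R) := by
  have hg2 : IntegrableOn (fun x => g x ^ 2) (ball 0 R) := hg.integrable_sq
  set K : ℝ := (∫ ω, sphY l m ω ^ 2 ∂surf) + 1 with hK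
  have hK0 : 0 < K := by
    have : 0 ≤ ∫ ω, sphY l m ω ^ 2 ∂surf := integral_nonneg fun ω => sq_nonneg _
    linarith
  have hdom := (integrableOn_sq_mul_moment hg2 (Y := fun _ => 1) continuous_const).const_mul K
  refine Integrable.mono' hdom ?_ ?_
  · exact ((continuousOn_id.mul (hu.1.mono Ioo_subset_Ioc_self)).pow 2).aestronglyMeasurable
      measurableSet_Ioo
  filter_upwards [hu.2, ae_integrable_slice hg2 (Y := fun _ => 1) continuous_const,
    ae_integrable_slice (memLp_two_integrableOn hg) (continuous_sphY l m)] with r hr h1 h2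
  simp only [mul_one] at h1 ⊢
  have := sq_integral_mul_le h1 h2 (continuous_sphY l m) hK0 (by linarith)
  rw [Real.norm_of_nonneg (sq_nonneg _), mul_pow, hr, sphCoeff]
  nlinarith [sq_nonneg r, mul_le_mul_of_nonneg_left this (sq_nonneg r)]

/-- The modes of `div (ρ θ)`, for `θ` in `H²`, have continuous representatives: `div (ρ θ)` is
a combination of the `H¹` functions `∂ᵢ θᵢ` and `θᵢ` with coefficients that are radial up to factors
`xᵢ / |x|`, and the latter can be absorbed in the spherical harmonic. -/
lemma exists_isMode_gField {R : ℝ} {ρ : ℝ → ℝ} {θ : E3 → E3} (hR : 0 < R)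
    (hρ : ContDiffOn ℝ 2 ρ (Icc 0 R)) (h0 : radDeriv R ρ 0 = 0)
    (hθ : ∀ i : Fin 3, MemH2 (ball 0 R) (fun x => θ x i)) (l : ℕ) (m : ℤ) :
    MemLp (gField R ρ θ) 2 (volume.restrict (ball 0 R)) ∧
      ∃ u, IsMode R (gField R ρ θ) l m u := by
  choose D hD hw using fun i => (hθ i).2 i
  obtain ⟨hdiv, hL2⟩ := hasWeakDiv_radial_smul hR hρ h0 (fun i => (hθ i).1) (fun i => (hD i).1) hw
  have hae := hdiv.weakDiv_ae_eq
  refine ⟨(memLp_congr_ae hae).2 hL2, ?_⟩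
  have hY := contDiff_sphYExt l m
  choose v hvc hv using fun i => exists_continuousOn_moment hR (hD i) hY
  choose w hwc hwv using fun i =>
    exists_continuousOn_moment hR (hθ i).memH1 ((contDiff_coord i).mul hY)
  refine ⟨fun r => ∑ i, (ρ r * v i r + radDeriv R ρ r * w i r), ?_, ?_⟩
  · refine continuousOn_finsetSum _ fun i _ => ?_
    exact ((hρ.continuousOn.mono Ioc_subset_Icc_self).mul (hvc i)).add
      (((contDiffOn_radDeriv hR hρ).continuousOn.mono Ioc_subset_Icc_self).mul (hwc i))
  have hYc : Continuous fun ω : S2 => sphYExt l m ω := hY.continuous.comp continuous_subtype_val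
  have hYi : ∀ i : Fin 3, Continuous fun ω : S2 => (ω : E3) i * sphYExt l m ω := fun i =>
    ((contDiff_coord i).continuous.comp continuous_subtype_val).mul hYc
  filter_upwards [ae_ae_polar hae, ae_all_iff.2 hv, ae_all_iff.2 hwv,
    ae_all_iff.2 fun i => ae_integrable_slice (memLp_two_integrableOn (hD i).1) hYc,
    ae_all_iff.2 fun i => ae_integrable_slice (memLp_two_integrableOn (hθ i).1) (hYi i),
    ae_restrict_mem measurableSet_Ioo] with r h1 h2 h3 h4 h5 hr
  have e1 : sphCoeff (gField R ρ θ) l m r = ∫ ω : S2, ∑ i,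
      (ρ r * (D i (r • (ω : E3)) * sphYExt l m ω)
      + radDeriv R ρ r * (θ (r • (ω : E3)) i * ((ω : E3) i * sphYExt l m ω))) ∂surf := by
    refine integral_congr_ae ?_
    filter_upwards [h1] with ω hω
    rw [gField, hω, ← sphYExt_coe, Finset.sum_mul]
    refine Finset.sum_congr rfl fun i _ => ?_
    rw [norm_smul_sphere hr.1]
    have := hr.1.ne'
    simp only [PiLp.smul_apply, smul_eq_mul]
    field_simp
  have h6 : ∀ i, Integrable (fun ω : S2 => ρ r * (D i (r • (ω : E3)) * sphYExt l m ω)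
      + radDeriv R ρ r * (θ (r • (ω : E3)) i * ((ω : E3) i * sphYExt l m ω))) surf := fun i =>
    ((h4 i).const_mul _).add ((h5 i).const_mul _)
  rw [e1, integral_finsetSum _ fun i _ => h6 i]
  refine Finset.sum_congr rfl fun i _ => ?_
  rw [integral_add ((h4 i).const_mul _) ((h5 i).const_mul _), integral_const_mul,
    integral_const_mul, h2 i, h3 i]

/-! ### The Lane–Emden equation -/

/-- The radial derivative of the enthalpy of the star, `γ ρ^(γ-2) ρ'`. -/
noncomputable def enthalpyDeriv (γ R : ℝ) (ρ : ℝ → ℝ) (r : ℝ) : ℝ :=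
  γ * ρ r ^ (γ - 2) * radDeriv R ρ r

lemma radDeriv_eq {R r : ℝ} {f : ℝ → ℝ} {f' : ℝ} (hR : 0 < R) (hr : r ∈ Icc 0 R)
    (h : HasDerivWithinAt f f' (Icc 0 R) r) : radDeriv R f r = f' :=
  h.derivWithin (uniqueDiffOn_Icc hR r hr)

lemma radDeriv_congr {R r : ℝ} {f f₁ : ℝ → ℝ} (h : EqOn f f₁ (Icc 0 R)) (hr : r ∈ Icc 0 R) :
    radDeriv R f r = radDeriv R f₁ r :=
  derivWithin_congr h (h hr)

namespace IsLiquidLaneEmden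

variable {γ R : ℝ} {ρ : ℝ → ℝ}

lemma hasDerivWithinAt (hρ : IsLiquidLaneEmden γ R ρ) {r : ℝ} (hr : r ∈ Icc 0 R) :
    HasDerivWithinAt ρ (radDeriv R ρ r) (Icc 0 R) r :=
  hasDerivWithinAt_radDeriv (hρ.smooth.differentiableOn (by norm_num)) hr

lemma hasDerivAt (hρ : IsLiquidLaneEmden γ R ρ) {r : ℝ} (hr : r ∈ Ioo 0 R) : HasDerivAt ρ
    (radDeriv R ρ r) r :=
  (hρ.hasDerivWithinAt (Ioo_subset_Icc_self hr)).hasDerivAt (Icc_mem_nhds hr.1 hr.2)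

lemma continuousOn_rpow (hρ : IsLiquidLaneEmden γ R ρ) (a : ℝ) : ContinuousOn (fun r => ρ r ^ a)
    (Icc 0 R) :=
  hρ.smooth.continuousOn.rpow_const fun r hr => Or.inl (hρ.pos r hr).ne'

lemma continuousOn_radDeriv (hρ : IsLiquidLaneEmden γ R ρ) : ContinuousOn (radDeriv R ρ) (Icc 0 R)
    :=
  (contDiffOn_radDeriv hρ.radius_pos hρ.smooth).continuousOn

lemma radDeriv_enthalpy (hρ : IsLiquidLaneEmden γ R ρ) {r : ℝ} (hr : r ∈ Icc 0 R) :
    radDeriv R (fun t => enthalpy γ (ρ t)) r = enthalpyDeriv γ R ρ r := by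
  refine radDeriv_eq hρ.radius_pos hr ?_
  have h := hρ.hasDerivWithinAt hr
  have hp := (hρ.pos r hr).ne'
  unfold enthalpy enthalpyDeriv
  by_cases hγ : γ = 1
  · simp only [hγ, if_true]
    refine (h.log hp).congr_deriv ?_
    rw [show (1 : ℝ) - 2 = -1 by norm_num, Real.rpow_neg_one]
    ring
  · simp only [hγ, if_false]
    have h1 : γ - 1 ≠ 0 := sub_ne_zero.2 hγ
    have h2 := (h.rpow_const (p := γ - 1) (Or.inl hp)).const_mul (γ / (γ - 1))
    rw [show γ - 1 - 1 = γ - 2 by ring] at h2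
    refine h2.congr_deriv ?_
    field_simp

lemma contDiffOn_enthalpyDeriv (hρ : IsLiquidLaneEmden γ R ρ) : ContDiffOn ℝ 1 (enthalpyDeriv γ R ρ)
    (Icc 0 R) := by
  have h1 : ContDiffOn ℝ 1 (fun r => ρ r ^ (γ - 2)) (Icc 0 R) :=
    (hρ.smooth.of_le (by norm_num)).rpow_const_of_ne fun r hr => (hρ.pos r hr).ne'
  exact (contDiffOn_const.mul h1).mul (contDiffOn_radDeriv hρ.radius_pos hρ.smooth)

lemma hasDerivAt_sq_mul_enthalpyDeriv (hρ : IsLiquidLaneEmden γ R ρ) {r : ℝ} (hr : r ∈ Ioo 0 R) :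
    HasDerivAt (fun s => s ^ 2 * enthalpyDeriv γ R ρ s) (-(4 * Real.pi * ρ r * r ^ 2)) r := by
  have hr' := Ioo_subset_Icc_self hr
  have hd : DifferentiableOn ℝ (fun s => s ^ 2 * enthalpyDeriv γ R ρ s) (Icc 0 R) :=
    (by fun_prop : DifferentiableOn ℝ (fun s : ℝ => s ^ 2) (Icc 0 R)).mul
      (hρ.contDiffOn_enthalpyDeriv.differentiableOn (by norm_num))
  have h1 := (hasDerivWithinAt_radDeriv hd hr').hasDerivAt (Icc_mem_nhds hr.1 hr.2)
  have h2 := hρ.ode r hr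
  rw [radDeriv_congr (fun s hs => by rw [hρ.radDeriv_enthalpy hs]) hr'] at h2
  refine h1.congr_deriv ?_
  have := hr.1.ne'
  field_simp at h2
  linarith

lemma hasDerivAt_enthalpyDeriv (hρ : IsLiquidLaneEmden γ R ρ) {r : ℝ} (hr : r ∈ Ioo 0 R) :
    HasDerivAt (enthalpyDeriv γ R ρ)
      (-(4 * Real.pi * ρ r) - 2 * (enthalpyDeriv γ R ρ r / r)) r := by
  have h0 := hr.1.ne'
  have h := (hρ.hasDerivAt_sq_mul_enthalpyDeriv hr).fun_div (hasDerivAt_pow 2 r) (pow_ne_zero 2 h0)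
  have h' : HasDerivAt (enthalpyDeriv γ R ρ) _ r := h.congr_of_eventuallyEq (by
    filter_upwards [Ioi_mem_nhds hr.1] with s hs
    have : s ≠ 0 := ne_of_gt hs
    field_simp)
  refine h'.congr_deriv ?_
  field_simp
  simp
  ring

/-- The star is strictly denser towards its centre: `r² h'(r)`, with `h` the enthalpy, vanishes at
the centre and is strictly decreasing. -/
lemma enthalpyDeriv_neg (hρ : IsLiquidLaneEmden γ R ρ) {r : ℝ} (hr : r ∈ Ioc 0 R) : enthalpyDeriv γ
    R ρ r < 0 := by
  have hanti : StrictAntiOn (fun s => s ^ 2 * enthalpyDeriv γ R ρ s) (Icc 0 R) := by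
    refine strictAntiOn_of_deriv_neg (convex_Icc 0 R)
      ((by fun_prop : ContinuousOn (fun s : ℝ => s ^ 2) (Icc 0 R)).mul
        hρ.contDiffOn_enthalpyDeriv.continuousOn) fun s hs => ?_
    rw [interior_Icc] at hs
    rw [(hρ.hasDerivAt_sq_mul_enthalpyDeriv hs).deriv, neg_lt_zero]
    have := hρ.pos s (Ioo_subset_Icc_self hs)
    have := hs.1
    positivity
  have h := hanti ⟨le_rfl, hρ.radius_pos.le⟩ (Ioc_subset_Icc_self hr) hr.1
  simp only [ne_eq, OfNat.ofNat_ne_zero, not_false_eq_true, zero_pow, zero_mul] at h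
  have := hr.1
  by_contra hcon
  exact absurd h (not_lt.2 (mul_nonneg (by positivity) (not_lt.1 hcon)))

lemma radDeriv_boundary_ne_zero (hρ : IsLiquidLaneEmden γ R ρ) : radDeriv R ρ R ≠ 0 := fun h => by
  have := hρ.enthalpyDeriv_neg ⟨hρ.radius_pos, le_rfl⟩
  simp [enthalpyDeriv, h] at this

lemma exists_abs_enthalpyDeriv_le (hρ : IsLiquidLaneEmden γ R ρ) : ∃ C, ∀ r ∈ Icc 0 R,
    |enthalpyDeriv γ R ρ r| ≤ C * r := by
  obtain ⟨σ, hσ, hσρ⟩ := exists_continuousOn_div hρ.radius_pos hρ.smooth hρ.deriv_zero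
  obtain ⟨K₁, hK₁⟩ := isCompact_Icc.exists_bound_of_continuousOn hσ
  obtain ⟨K₂, hK₂⟩ := isCompact_Icc.exists_bound_of_continuousOn (hρ.continuousOn_rpow (γ - 2))
  refine ⟨|γ| * K₂ * (2 * K₁), fun r hr => ?_⟩
  have h1 := hK₁ (r ^ 2) ⟨sq_nonneg r, pow_le_pow_left₀ hr.1 hr.2 2⟩
  have h2 := hK₂ r hr
  rw [Real.norm_eq_abs] at h1 h2
  have hr0 := hr.1
  have hK0 : 0 ≤ K₂ := (abs_nonneg _).trans h2
  rw [enthalpyDeriv, hσρ r hr, abs_mul, abs_mul, abs_mul, abs_mul, abs_two, abs_of_nonneg hr0]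
  calc |γ| * |ρ r ^ (γ - 2)| * (2 * r * |σ (r ^ 2)|)
      ≤ |γ| * K₂ * (2 * r * K₁) := by gcongr
    _ = _ := by ring

lemma rpow_eq (hρ : IsLiquidLaneEmden γ R ρ) {r : ℝ} (hr : r ∈ Icc 0 R) : ρ r ^ γ = ρ r ^ (γ - 2) *
    ρ r ^ 2 := by
  rw [← Real.rpow_natCast, ← Real.rpow_add (hρ.pos r hr)]
  norm_num

lemma radDeriv_rpow (hρ : IsLiquidLaneEmden γ R ρ) {r : ℝ} (hr : r ∈ Icc 0 R) :
    radDeriv R (fun s => ρ s ^ γ) r = ρ r * enthalpyDeriv γ R ρ r := by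
  have hp := hρ.pos r hr
  rw [radDeriv_eq hρ.radius_pos hr ((hρ.hasDerivWithinAt hr).rpow_const (p := γ) (Or.inl hp.ne')),
    enthalpyDeriv, show γ - 1 = (γ - 2) + 1 by ring, Real.rpow_add hp, Real.rpow_one]
  ring

end IsLiquidLaneEmden

/-! ### Primitives with a singularity at the origin -/

/-- The primitive of `p` with the value `c` at `R`. -/
noncomputable def outerPrim (p : ℝ → ℝ) (R c r : ℝ) : ℝ := c - ∫ s in r..R, p s

/-- The moment `∫₀^r w s^(2l) ds` of the primitive `w` of `p` with `w(R) = c`. -/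
noncomputable def innerMoment (p : ℝ → ℝ) (R c : ℝ) (l : ℕ) (r : ℝ) : ℝ :=
  ∫ s in (0 : ℝ)..r, outerPrim p R c s * s ^ (2 * l)

section

variable {p : ℝ → ℝ} {R : ℝ}

lemma intervalIntegrable_of_continuousOn_Ioi (hp : ContinuousOn p (Ioi 0)) {a b : ℝ} (ha : 0 < a)
    (hb : 0 < b) : IntervalIntegrable p volume a b :=
  (hp.mono fun _ hx => (lt_min ha hb).trans_le hx.1).intervalIntegrable

lemma hasDerivAt_outerPrim (hp : ContinuousOn p (Ioi 0)) (hR : 0 < R) (c : ℝ) {r : ℝ} (hr : 0 < r) :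
    HasDerivAt (outerPrim p R c) (p r) r := by
  have h := intervalIntegral.integral_hasDerivAt_left
    (intervalIntegrable_of_continuousOn_Ioi hp hr hR)
    (hp.stronglyMeasurableAtFilter isOpen_Ioi r hr) (hp.continuousAt (Ioi_mem_nhds hr))
  exact (h.const_sub c).congr_deriv (neg_neg _)

lemma outerPrim_self (p : ℝ → ℝ) (R c : ℝ) : outerPrim p R c R = c := by simp [outerPrim]

lemma continuousOn_outerPrim (hp : ContinuousOn p (Ioi 0)) (hR : 0 < R) (c : ℝ) :
    ContinuousOn (outerPrim p R c) (Ioi 0) := fun _ hr =>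
  (hasDerivAt_outerPrim hp hR c hr).continuousAt.continuousWithinAt

lemma contDiffOn_outerPrim (hp : ContinuousOn p (Ioi 0)) (hR : 0 < R) (c : ℝ) :
    ContDiffOn ℝ 1 (outerPrim p R c) (Ioi 0) := by
  have hd : ∀ r ∈ Ioi (0 : ℝ), HasDerivAt (outerPrim p R c) (p r) r := fun r hr =>
    hasDerivAt_outerPrim hp hR c hr
  rw [show (1 : WithTop ℕ∞) = 0 + 1 by rfl, contDiffOn_succ_iff_deriv_of_isOpen isOpen_Ioi]
  refine ⟨fun r hr => (hd r hr).differentiableAt.differentiableWithinAt, by simp, ?_⟩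
  exact contDiffOn_zero.2 (hp.congr fun r hr => (hd r hr).deriv)

variable {l : ℕ}

/-- If `p s^l` is integrable then the primitive of `p` is `O(r^(-l))` at the origin. -/
lemma exists_abs_outerPrim_mul_pow_le (hR : 0 < R)
    (hq : IntegrableOn (fun s => p s * s ^ l) (Ioo 0 R)) (c : ℝ) :
    ∃ C, 0 ≤ C ∧ ∀ r ∈ Ioc 0 R, |outerPrim p R c r| * r ^ l ≤ C := by
  refine ⟨|c| * R ^ l + ∫ s in Ioo 0 R, |p s * s ^ l|,
    add_nonneg (by positivity) (integral_nonneg fun _ => abs_nonneg _), fun r hr => ?_⟩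
  have hrl : 0 ≤ r ^ l := pow_nonneg hr.1.le l
  have h1 : |∫ s in r..R, p s| * r ^ l ≤ ∫ s in Ioo 0 R, |p s * s ^ l| := by
    rw [intervalIntegral.integral_of_le hr.2, integral_Ioc_eq_integral_Ioo, ← abs_of_nonneg hrl,
      ← abs_mul, ← integral_mul_const]
    rw [← Real.norm_eq_abs]
    refine (norm_integral_le_of_norm_le (g := fun s => |p s * s ^ l|)
      (hq.mono_set (Ioo_subset_Ioo_left hr.1.le)).abs ?_).trans
      (setIntegral_mono_set hq.abs (.of_forall fun _ => abs_nonneg _)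
        (Ioo_subset_Ioo_left hr.1.le).eventuallyLE)
    filter_upwards [ae_restrict_mem measurableSet_Ioo] with s hs
    rw [norm_mul, Real.norm_eq_abs, Real.norm_eq_abs, abs_mul,
      abs_of_nonneg (pow_nonneg (hr.1.trans hs.1).le l), abs_of_nonneg hrl]
    gcongr
    exacts [hr.1.le, hs.1.le]
  calc |outerPrim p R c r| * r ^ l ≤ (|c| + |∫ s in r..R, p s|) * r ^ l := by
        gcongr; exact abs_sub _ _
    _ = |c| * r ^ l + |∫ s in r..R, p s| * r ^ l := by ring
    _ ≤ _ := by
        refine add_le_add ?_ h1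
        have := pow_le_pow_left₀ hr.1.le hr.2 l
        gcongr

lemma tendsto_zero_of_abs_le_mul {F : ℝ → ℝ} {C : ℝ} (hR : 0 < R)
    (h : ∀ r ∈ Ioc 0 R, |F r| ≤ C * r) : Tendsto F (𝓝[>] 0) (𝓝 0) := by
  refine squeeze_zero_norm' (a := fun r => C * r) ?_ ?_
  · filter_upwards [Ioc_mem_nhdsGT hR] with r hr using h r hr
  · have : Tendsto (fun r : ℝ => C * r) (𝓝 0) (𝓝 (C * 0)) := tendsto_id.const_mul C
    rw [mul_zero] at this
    exact this.mono_left nhdsWithin_le_nhds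

section

variable {c C : ℝ}

lemma abs_outerPrim_mul_pow_le (hC : ∀ r ∈ Ioc 0 R, |outerPrim p R c r| * r ^ l ≤ C) (n : ℕ) {r : ℝ}
    (hr : r ∈ Ioc 0 R) : |outerPrim p R c r * r ^ (l + n)| ≤ C * r ^ n := by
  rw [abs_mul, abs_of_nonneg (pow_nonneg hr.1.le _), pow_add, ← mul_assoc]
  exact mul_le_mul_of_nonneg_right (hC r hr) (pow_nonneg hr.1.le n)

lemma intervalIntegrable_outerPrim_mul_pow (hp : ContinuousOn p (Ioi 0)) (hR : 0 < R)
    (hC : ∀ r ∈ Ioc 0 R, |outerPrim p R c r| * r ^ l ≤ C) {r : ℝ} (hr : 0 < r) :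
    IntervalIntegrable (fun s => outerPrim p R c s * s ^ (2 * l)) volume 0 r := by
  have hcont : ContinuousOn (fun s => outerPrim p R c s * s ^ (2 * l)) (Ioi 0) :=
    (continuousOn_outerPrim hp hR c).mul (by fun_prop)
  refine IntervalIntegrable.trans (b := R) ?_ (intervalIntegrable_of_continuousOn_Ioi hcont hR hr)
  rw [intervalIntegrable_iff_integrableOn_Ioo_of_le hR.le]
  refine IntegrableOn.of_bound measure_Ioo_lt_top ?_ (C * R ^ l) ?_
  · exact (hcont.mono fun _ hs => hs.1).aestronglyMeasurable measurableSet_Ioo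
  filter_upwards [ae_restrict_mem measurableSet_Ioo] with s hs
  have hs' := Ioo_subset_Ioc_self hs
  have hC0 : 0 ≤ C := (by have := hs.1; positivity : (0 : ℝ) ≤ _).trans (hC s hs')
  rw [two_mul]
  refine (abs_outerPrim_mul_pow_le hC l hs').trans ?_
  have := pow_le_pow_left₀ hs.1.le hs.2.le l
  gcongr

lemma hasDerivAt_innerMoment (hp : ContinuousOn p (Ioi 0)) (hR : 0 < R)
    (hC : ∀ r ∈ Ioc 0 R, |outerPrim p R c r| * r ^ l ≤ C) {r : ℝ} (hr : 0 < r) :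
    HasDerivAt (innerMoment p R c l) (outerPrim p R c r * r ^ (2 * l)) r := by
  have hcont : ContinuousOn (fun s => outerPrim p R c s * s ^ (2 * l)) (Ioi 0) :=
    (continuousOn_outerPrim hp hR c).mul (by fun_prop)
  exact intervalIntegral.integral_hasDerivAt_right
    (intervalIntegrable_outerPrim_mul_pow hp hR hC hr)
    (hcont.stronglyMeasurableAtFilter isOpen_Ioi r hr) (hcont.continuousAt (Ioi_mem_nhds hr))

lemma abs_innerMoment_le (hC : ∀ r ∈ Ioc 0 R, |outerPrim p R c r| * r ^ l ≤ C) {r : ℝ}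
    (hr : r ∈ Ioc 0 R) : |innerMoment p R c l r| ≤ C * r ^ (l + 1) := by
  have hC0 : 0 ≤ C := (by have := hr.1; positivity : (0 : ℝ) ≤ _).trans (hC r hr)
  have h := intervalIntegral.norm_integral_le_of_norm_le_const (a := 0) (b := r) (C := C * r ^ l)
    (f := fun s => outerPrim p R c s * s ^ (2 * l)) fun s hs => by
      rw [uIoc_of_le hr.1.le] at hs
      rw [two_mul]
      refine (abs_outerPrim_mul_pow_le hC l ⟨hs.1, hs.2.trans hr.2⟩).trans ?_
      have := pow_le_pow_left₀ hs.1.le hs.2 l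
      gcongr
  rw [sub_zero, abs_of_pos hr.1, mul_assoc, ← pow_succ] at h
  exact h

lemma intervalIntegrable_mul_pow (hq : IntegrableOn (fun s => p s * s ^ l) (Ioo 0 R)) {r : ℝ}
    (hr : r ∈ Ioc 0 R) : IntervalIntegrable (fun s => p s * s ^ (2 * l + 1)) volume 0 r := by
  rw [intervalIntegrable_iff_integrableOn_Ioo_of_le hr.1.le]
  have h1 : IntegrableOn (fun s => p s * s ^ l * s ^ (l + 1)) (Ioo 0 r) :=
    IntegrableOn.mul_continuousOn_of_subset (K := Icc 0 r)
      (hq.mono_set (Ioo_subset_Ioo_right hr.2)) (by fun_prop) measurableSet_Ioo isCompact_Icc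
      Ioo_subset_Icc_self
  exact h1.congr_fun (fun s _ => by simp only; ring) measurableSet_Ioo

/-- Integration by parts: `∫₀^r p s^(2l+1) ds` in terms of the primitive of `p`. -/
lemma integral_mul_pow_eq (hp : ContinuousOn p (Ioi 0)) (hR : 0 < R)
    (hq : IntegrableOn (fun s => p s * s ^ l) (Ioo 0 R))
    (hC : ∀ r ∈ Ioc 0 R, |outerPrim p R c r| * r ^ l ≤ C) {r : ℝ} (hr : r ∈ Ioc 0 R) :
    ∫ s in (0 : ℝ)..r, p s * s ^ (2 * l + 1)
      = outerPrim p R c r * r ^ (2 * l + 1) - (2 * l + 1) * innerMoment p R c l r := by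
  have hC0 : 0 ≤ C := (by have := hr.1; positivity : (0 : ℝ) ≤ _).trans (hC r hr)
  have i1 := intervalIntegrable_mul_pow hq hr
  have i2 := (intervalIntegrable_outerPrim_mul_pow hp hR hC hr.1).const_mul (2 * l + 1 : ℝ)
  have hder : ∀ s : ℝ, 0 < s → HasDerivAt (fun s => outerPrim p R c s * s ^ (2 * l + 1))
      (p s * s ^ (2 * l + 1) + (2 * l + 1) * (outerPrim p R c s * s ^ (2 * l))) s := fun s hs => by
    refine ((hasDerivAt_outerPrim hp hR c hs).fun_mul (hasDerivAt_pow (2 * l + 1) s)).congr_deriv ?_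
    push_cast
    ring
  have h0 : Tendsto (fun s => outerPrim p R c s * s ^ (2 * l + 1)) (𝓝[>] 0) (𝓝 0) := by
    refine tendsto_zero_of_abs_le_mul (C := C * R ^ l) hR fun s hs => ?_
    rw [show 2 * l + 1 = l + (l + 1) by ring]
    refine (abs_outerPrim_mul_pow_le hC (l + 1) hs).trans ?_
    have := pow_le_pow_left₀ hs.1.le hs.2 l
    have := hs.1
    rw [pow_succ, ← mul_assoc]
    gcongr
  have h := intervalIntegral.integral_eq_sub_of_hasDerivAt_of_tendsto hr.1
    (fun s hs => hder s hs.1) (i1.add i2) h0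
    ((hder r hr.1).continuousAt.continuousWithinAt (s := Iio r))
  rw [intervalIntegral.integral_add i1 i2, intervalIntegral.integral_const_mul] at h
  rw [innerMoment]
  linarith

end

end

/-! ### The energy in terms of `χ` -/

/-- The function `χ = w / ρ`, where `w` is the primitive of `p` with `w(R) = c`. -/
noncomputable def chiOf (ρ p : ℝ → ℝ) (R c r : ℝ) : ℝ := outerPrim p R c r / ρ r

section

variable {γ R : ℝ} {ρ p : ℝ → ℝ} {c C : ℝ} {l : ℕ}

lemma contDiffOn_chiOf (hρ : IsLiquidLaneEmden γ R ρ) (hp : ContinuousOn p (Ioi 0)) :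
    ContDiffOn ℝ 1 (chiOf ρ p R c) (Ioc 0 R) :=
  ((contDiffOn_outerPrim hp hρ.radius_pos c).mono fun _ hr => hr.1).div
    ((hρ.smooth.of_le (by norm_num)).mono Ioc_subset_Icc_self)
    fun r hr => (hρ.pos r (Ioc_subset_Icc_self hr)).ne'

lemma mul_chiOf (hρ : IsLiquidLaneEmden γ R ρ) {r : ℝ} (hr : r ∈ Icc 0 R) :
    ρ r * chiOf ρ p R c r = outerPrim p R c r := by
  have := (hρ.pos r hr).ne'
  rw [chiOf]
  field_simp

lemma radDeriv_mul_chiOf (hρ : IsLiquidLaneEmden γ R ρ) (hp : ContinuousOn p (Ioi 0)) {r : ℝ}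
    (hr : r ∈ Ioc 0 R) : radDeriv R (fun s => ρ s * chiOf ρ p R c s) r = p r := by
  have hr' := Ioc_subset_Icc_self hr
  rw [radDeriv_congr (fun s hs => mul_chiOf hρ hs) hr']
  exact radDeriv_eq hρ.radius_pos hr'
    (hasDerivAt_outerPrim hp hρ.radius_pos c hr.1).hasDerivWithinAt

lemma radDeriv_chiOf (hρ : IsLiquidLaneEmden γ R ρ) (hp : ContinuousOn p (Ioi 0)) {r : ℝ}
    (hr : r ∈ Ioc 0 R) : radDeriv R (chiOf ρ p R c) r
      = (p r * ρ r - outerPrim p R c r * radDeriv R ρ r) / ρ r ^ 2 := by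
  have hr' := Ioc_subset_Icc_self hr
  exact radDeriv_eq hρ.radius_pos hr' ((hasDerivAt_outerPrim hp hρ.radius_pos c
    hr.1).hasDerivWithinAt.fun_div (hρ.hasDerivWithinAt hr') (hρ.pos r hr').ne')

lemma chiIntegrandOne_eq (hρ : IsLiquidLaneEmden γ R ρ) (hp : ContinuousOn p (Ioi 0)) {r : ℝ}
    (hr : r ∈ Ioc 0 R) : chiIntegrandOne γ R ρ l (chiOf ρ p R c) r
      = γ * ρ r ^ (γ - 2) * (p r * r ^ l) ^ 2
        - 4 * Real.pi * (outerPrim p R c r * r ^ l) ^ 2 := by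
  rw [chiIntegrandOne, radDeriv_mul_chiOf hρ hp hr, mul_chiOf hρ (Ioc_subset_Icc_self hr)]
  ring

lemma chiIntegrandTwo_eq (hρ : IsLiquidLaneEmden γ R ρ) (hp : ContinuousOn p (Ioi 0)) {r : ℝ}
    (hr : r ∈ Ioc 0 R) : chiIntegrandTwo γ R ρ l (chiOf ρ p R c) r
      = γ * ρ r ^ (γ - 2) * (p r * r ^ l) ^ 2
        - 2 * enthalpyDeriv γ R ρ r / ρ r * (p r * r ^ l * (outerPrim p R c r * r ^ l))
        + enthalpyDeriv γ R ρ r * radDeriv R ρ r / ρ r ^ 2 * (outerPrim p R c r * r ^ l) ^ 2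
        - 2 * ((l : ℝ) - 1) * (enthalpyDeriv γ R ρ r / r) / ρ r
          * (outerPrim p R c r * r ^ l) ^ 2 := by
  have hr' := Ioc_subset_Icc_self hr
  have h1 := (hρ.pos r hr').ne'
  have h2 := hr.1.ne'
  have h3 : r ^ (2 * (l : ℤ) - 1) = (r ^ l) ^ 2 / r := by
    rw [zpow_sub_one₀ h2, mul_comm (2 : ℤ), zpow_mul, zpow_natCast]
    norm_cast
  rw [chiIntegrandTwo, radDeriv_chiOf hρ hp hr, hρ.radDeriv_rpow hr', hρ.rpow_eq hr', h3,
    mul_comm 2 l, pow_mul, chiOf, enthalpyDeriv]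
  field_simp
  ring

/-- For `l ≥ 1` the energy density is non-negative, since the density decreases. -/
lemma chiIntegrandTwo_nonneg (hρ : IsLiquidLaneEmden γ R ρ) (hγ : 0 ≤ γ) (hl : 1 ≤ l) (χ : ℝ → ℝ)
    {r : ℝ} (hr : r ∈ Ioo 0 R) : 0 ≤ chiIntegrandTwo γ R ρ l χ r := by
  have hr' := Ioo_subset_Icc_self hr
  have h1 := hρ.pos r hr'
  have h2 := hr.1
  have h3 := hρ.enthalpyDeriv_neg (Ioo_subset_Ioc_self hr)
  have h4 : (0 : ℝ) ≤ (l : ℝ) - 1 := by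
    have : (1 : ℝ) ≤ l := by exact_mod_cast hl
    linarith
  rw [chiIntegrandTwo, hρ.radDeriv_rpow hr', sub_nonneg]
  refine le_trans ?_ (by positivity : 0 ≤ γ * ρ r ^ γ * radDeriv R χ r ^ 2 * r ^ (2 * l))
  have h5 : 0 ≤ 2 * ((l : ℝ) - 1) * (ρ r * -enthalpyDeriv γ R ρ r) * χ r ^ 2
      * r ^ (2 * (l : ℤ) - 1) := by
    have : 0 ≤ -enthalpyDeriv γ R ρ r := by linarith
    positivity
  linarith

lemma integrableOn_of_sq {q : ℝ → ℝ} (hq : ContinuousOn q (Ioo 0 R))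
    (hq2 : IntegrableOn (fun s => q s ^ 2) (Ioo 0 R)) : IntegrableOn q (Ioo 0 R) := by
  have hm := hq.aestronglyMeasurable (μ := volume) measurableSet_Ioo
  have : IsFiniteMeasure (volume.restrict (Ioo (0 : ℝ) R)) :=
    ⟨by rw [Measure.restrict_apply_univ]; exact measure_Ioo_lt_top⟩
  exact ((memLp_two_iff_integrable_sq hm).2 hq2).integrable one_le_two

lemma continuousOn_outerPrim_mul_pow (hp : ContinuousOn p (Ioi 0)) (hR : 0 < R) :
    ContinuousOn (fun s => outerPrim p R c s * s ^ l) (Ioo 0 R) :=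
  ((continuousOn_outerPrim hp hR c).mono fun _ hs => hs.1).mul (by fun_prop)

lemma ae_norm_outerPrim_mul_pow_le (hC : ∀ r ∈ Ioc 0 R, |outerPrim p R c r| * r ^ l ≤ C) :
    ∀ᵐ s ∂(volume.restrict (Ioo 0 R)), ‖outerPrim p R c s * s ^ l‖ ≤ C := by
  filter_upwards [ae_restrict_mem measurableSet_Ioo] with s hs
  rw [norm_mul, Real.norm_eq_abs, Real.norm_of_nonneg (pow_nonneg hs.1.le l)]
  exact hC s (Ioo_subset_Ioc_self hs)

lemma integrableOn_outerPrim_sq (hp : ContinuousOn p (Ioi 0)) (hR : 0 < R)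
    (hC : ∀ r ∈ Ioc 0 R, |outerPrim p R c r| * r ^ l ≤ C) :
    IntegrableOn (fun s => (outerPrim p R c s * s ^ l) ^ 2) (Ioo 0 R) := by
  refine IntegrableOn.of_bound measure_Ioo_lt_top
    (((continuousOn_outerPrim_mul_pow hp hR).pow 2).aestronglyMeasurable measurableSet_Ioo)
    (C ^ 2) ?_
  filter_upwards [ae_norm_outerPrim_mul_pow_le hC] with s hs
  rw [norm_pow]
  gcongr

lemma integrableOn_mul_outerPrim (hp : ContinuousOn p (Ioi 0)) (hR : 0 < R)
    (hq : IntegrableOn (fun s => (p s * s ^ l) ^ 2) (Ioo 0 R))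
    (hC : ∀ r ∈ Ioc 0 R, |outerPrim p R c r| * r ^ l ≤ C) :
    IntegrableOn (fun s => p s * s ^ l * (outerPrim p R c s * s ^ l)) (Ioo 0 R) :=
  Integrable.mul_bdd
    (integrableOn_of_sq ((hp.mono fun _ hs => hs.1).mul (by fun_prop)) hq)
    ((continuousOn_outerPrim_mul_pow hp hR).aestronglyMeasurable measurableSet_Ioo)
    (ae_norm_outerPrim_mul_pow_le hC)

lemma intervalIntegrable_chiIntegrandOne (hρ : IsLiquidLaneEmden γ R ρ)
    (hp : ContinuousOn p (Ioi 0)) (hq : IntegrableOn (fun s => (p s * s ^ l) ^ 2) (Ioo 0 R))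
    (hC : ∀ r ∈ Ioc 0 R, |outerPrim p R c r| * r ^ l ≤ C) :
    IntervalIntegrable (chiIntegrandOne γ R ρ l (chiOf ρ p R c)) volume 0 R := by
  have hR := hρ.radius_pos
  rw [intervalIntegrable_iff_integrableOn_Ioo_of_le hR.le]
  have h1 : IntegrableOn (fun r => γ * ρ r ^ (γ - 2) * (p r * r ^ l) ^ 2) (Ioo 0 R) :=
    IntegrableOn.continuousOn_mul_of_subset (K := Icc 0 R)
      (continuousOn_const.mul (hρ.continuousOn_rpow _)) hq isCompact_Icc measurableSet_Ioo
      Ioo_subset_Icc_self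
  have h2 := (integrableOn_outerPrim_sq hp hR hC).const_mul (4 * Real.pi)
  exact IntegrableOn.congr_fun (Integrable.sub h1 h2)
    (fun r hr => (chiIntegrandOne_eq hρ hp (Ioo_subset_Ioc_self hr)).symm) measurableSet_Ioo

lemma intervalIntegrable_chiIntegrandTwo (hρ : IsLiquidLaneEmden γ R ρ)
    (hp : ContinuousOn p (Ioi 0)) (hq : IntegrableOn (fun s => (p s * s ^ l) ^ 2) (Ioo 0 R))
    (hC : ∀ r ∈ Ioc 0 R, |outerPrim p R c r| * r ^ l ≤ C) :
    IntervalIntegrable (chiIntegrandTwo γ R ρ l (chiOf ρ p R c)) volume 0 R := by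
  have hR := hρ.radius_pos
  rw [intervalIntegrable_iff_integrableOn_Ioo_of_le hR.le]
  have hH := hρ.contDiffOn_enthalpyDeriv.continuousOn
  have hρc := hρ.smooth.continuousOn
  have hρ0 : ∀ r ∈ Icc 0 R, ρ r ≠ 0 := fun r hr => (hρ.pos r hr).ne'
  have hvv := integrableOn_outerPrim_sq hp hR hC
  have h1 : IntegrableOn (fun r => γ * ρ r ^ (γ - 2) * (p r * r ^ l) ^ 2) (Ioo 0 R) :=
    IntegrableOn.continuousOn_mul_of_subset (K := Icc 0 R)
      (continuousOn_const.mul (hρ.continuousOn_rpow _)) hq isCompact_Icc measurableSet_Ioo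
      Ioo_subset_Icc_self
  have h2 : IntegrableOn (fun r => 2 * enthalpyDeriv γ R ρ r / ρ r
      * (p r * r ^ l * (outerPrim p R c r * r ^ l))) (Ioo 0 R) :=
    IntegrableOn.continuousOn_mul_of_subset (K := Icc 0 R)
      ((continuousOn_const.mul hH).div hρc hρ0) (integrableOn_mul_outerPrim hp hR hq hC)
      isCompact_Icc measurableSet_Ioo Ioo_subset_Icc_self
  have h3 : IntegrableOn (fun r => enthalpyDeriv γ R ρ r * radDeriv R ρ r / ρ r ^ 2
      * (outerPrim p R c r * r ^ l) ^ 2) (Ioo 0 R) :=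
    IntegrableOn.continuousOn_mul_of_subset (K := Icc 0 R)
      ((hH.mul hρ.continuousOn_radDeriv).div (hρc.pow 2) fun r hr => pow_ne_zero 2 (hρ0 r hr))
      hvv isCompact_Icc measurableSet_Ioo Ioo_subset_Icc_self
  have h4 : IntegrableOn (fun r => 2 * ((l : ℝ) - 1) * (enthalpyDeriv γ R ρ r / r) / ρ r
          * (outerPrim p R c r * r ^ l) ^ 2) (Ioo 0 R) := by
    obtain ⟨K, hK⟩ := hρ.exists_abs_enthalpyDeriv_le
    have h5 : IntegrableOn (fun r => 2 * ((l : ℝ) - 1) / ρ r * (outerPrim p R c r * r ^ l) ^ 2)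
        (Ioo 0 R) :=
      IntegrableOn.continuousOn_mul_of_subset (K := Icc 0 R)
        (continuousOn_const.div hρc hρ0) hvv isCompact_Icc measurableSet_Ioo Ioo_subset_Icc_self
    have h6 : IntegrableOn (fun r => enthalpyDeriv γ R ρ r / r
        * (2 * ((l : ℝ) - 1) / ρ r * (outerPrim p R c r * r ^ l) ^ 2)) (Ioo 0 R) := by
      refine Integrable.bdd_mul (c := K) h5
        (((hH.mono Ioo_subset_Icc_self).div continuousOn_id
          fun r hr => hr.1.ne').aestronglyMeasurable measurableSet_Ioo) ?_
      filter_upwards [ae_restrict_mem measurableSet_Ioo] with r hr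
      rw [Real.norm_eq_abs, abs_div, abs_of_pos hr.1, div_le_iff₀ hr.1]
      exact hK r (Ioo_subset_Icc_self hr)
    exact h6.congr_fun (fun r _ => by simp only; ring) measurableSet_Ioo
  exact IntegrableOn.congr_fun (Integrable.sub (Integrable.add (Integrable.sub h1 h2) h3) h4)
    (fun r hr => (chiIntegrandTwo_eq hρ hp (Ioo_subset_Ioc_self hr)).symm) measurableSet_Ioo

/-- The difference of the two integrands is the derivative of `h' r^(2l) w² / ρ`, where `h` is the
enthalpy and `w = ρ χ`; this is where the Lane–Emden equation enters. -/
lemma integral_chiIntegrandTwo (hρ : IsLiquidLaneEmden γ R ρ)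
    (hp : ContinuousOn p (Ioi 0)) (hq : IntegrableOn (fun s => (p s * s ^ l) ^ 2) (Ioo 0 R))
    (hC : ∀ r ∈ Ioc 0 R, |outerPrim p R c r| * r ^ l ≤ C) :
    (∫ r in (0 : ℝ)..R, chiIntegrandOne γ R ρ l (chiOf ρ p R c) r)
        - γ * radDeriv R ρ R * c ^ 2 * R ^ (2 * l)
      = ∫ r in (0 : ℝ)..R, chiIntegrandTwo γ R ρ l (chiOf ρ p R c) r := by
  have hR := hρ.radius_pos
  have i1 := intervalIntegrable_chiIntegrandOne hρ hp hq hC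
  have i2 := intervalIntegrable_chiIntegrandTwo hρ hp hq hC
  set E : ℝ → ℝ := fun r => enthalpyDeriv γ R ρ r * (outerPrim p R c r * r ^ l) ^ 2 / ρ r with hE
  have hder : ∀ r ∈ Ioo 0 R, HasDerivAt E (chiIntegrandOne γ R ρ l (chiOf ρ p R c) r
      - chiIntegrandTwo γ R ρ l (chiOf ρ p R c) r) r := fun r hr => by
    have hr' := Ioo_subset_Ioc_self hr
    have h0 := hr.1.ne'
    have h1 := (hρ.pos r (Ioc_subset_Icc_self hr')).ne'
    refine (((hρ.hasDerivAt_enthalpyDeriv hr).fun_mul (((hasDerivAt_outerPrim hp hR c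
      hr.1).fun_mul (hasDerivAt_pow l r)).fun_pow 2)).fun_div (hρ.hasDerivAt hr) h1).congr_deriv ?_
    rw [chiIntegrandOne_eq hρ hp hr', chiIntegrandTwo_eq hρ hp hr']
    have hl : (l : ℝ) * r ^ (l - 1) = l * r ^ l / r := by
      rcases l with _ | n
      · simp
      · rw [Nat.add_sub_cancel, pow_succ]; field_simp
    rw [hl]
    field_simp
    ring
  have h0 : Tendsto E (𝓝[>] 0) (𝓝 0) := by
    obtain ⟨K, hK⟩ := hρ.exists_abs_enthalpyDeriv_le
    have hinv : ContinuousOn (fun r => (ρ r)⁻¹) (Icc 0 R) :=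
      hρ.smooth.continuousOn.inv₀ fun r hr => (hρ.pos r hr).ne'
    obtain ⟨K', hK'⟩ := isCompact_Icc.exists_bound_of_continuousOn hinv
    refine tendsto_zero_of_abs_le_mul (C := K * C ^ 2 * K') hR fun r hr => ?_
    have hr' := Ioc_subset_Icc_self hr
    have e1 := hK r hr'
    have e2 := hK' r hr'
    rw [Real.norm_eq_abs] at e2
    have e3 := hC r hr
    rw [hE]
    simp only
    rw [div_eq_mul_inv, abs_mul, abs_mul, abs_pow, abs_mul, abs_of_nonneg (pow_nonneg hr.1.le l)]
    have e4 : 0 ≤ |outerPrim p R c r| * r ^ l := by have := hr.1; positivity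
    calc |enthalpyDeriv γ R ρ r| * (|outerPrim p R c r| * r ^ l) ^ 2 * |(ρ r)⁻¹|
        ≤ (K * r) * C ^ 2 * K' := by
          have : 0 ≤ K * r := (abs_nonneg _).trans e1
          gcongr
      _ = _ := by ring
  have hb : Tendsto E (𝓝[<] R) (𝓝 (E R)) := by
    have hc : ContinuousOn E (Ioc 0 R) :=
      ((hρ.contDiffOn_enthalpyDeriv.continuousOn.mono Ioc_subset_Icc_self).mul
        ((((continuousOn_outerPrim hp hR c).mono fun _ hs => hs.1).mul (by fun_prop)).pow 2)).div
        (hρ.smooth.continuousOn.mono Ioc_subset_Icc_self)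
        fun r hr => (hρ.pos r (Ioc_subset_Icc_self hr)).ne'
    have h1 := hc R ⟨hR, le_rfl⟩
    rw [ContinuousWithinAt, nhdsWithin_Ioc_eq_nhdsLE hR] at h1
    exact h1.mono_left (nhdsWithin_mono _ Iio_subset_Iic_self)
  have h := intervalIntegral.integral_eq_sub_of_hasDerivAt_of_tendsto hR hder (i1.sub i2) h0 hb
  rw [intervalIntegral.integral_sub i1 i2] at h
  have hER : E R = γ * radDeriv R ρ R * c ^ 2 * R ^ (2 * l) := by
    simp only [hE, enthalpyDeriv, outerPrim_self, hρ.boundary, Real.one_rpow]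
    ring
  rw [hER] at h
  linarith

end

/-! ### The energy of a mode -/

section

variable {γ R : ℝ} {ρ p u : ℝ → ℝ} {c C : ℝ} {l : ℕ} {m : ℤ} {g : E3 → ℝ}

/-- The mode of the potential, in terms of the primitive `w` of `p = r^(1-l) g_lm`: the multipole
expansion of the Newton kernel, integrated by parts. -/
lemma pow_mul_sphCoeff_potential (hR : 0 < R) (hg : IntegrableOn g (ball 0 R))
    (hu : IsMode R g l m u) (hp : ContinuousOn p (Ioi 0))
    (hpu : ∀ s ∈ Ioc 0 R, u s * s = p s * s ^ l)
    (hq : IntegrableOn (fun s => p s * s ^ l) (Ioo 0 R))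
    (hC : ∀ r ∈ Ioc 0 R, |outerPrim p R c r| * r ^ l ≤ C) {r : ℝ} (hr : r ∈ Ioc 0 R) :
    r ^ (l + 1) * sphCoeff (fun x => 1 / (4 * Real.pi) * gravK R g x) l m r
      = innerMoment p R c l r - c * r ^ (2 * l + 1) / (2 * l + 1) := by
  have hr0 := hr.1.ne'
  rw [sphCoeff_potential hr.1 hg]
  have e1 : ∫ s in Ioo 0 R, s ^ 2 * (multipole l r s * sphCoeff g l m s)
      = ∫ s in (0 : ℝ)..R, s ^ 2 * (multipole l r s * u s) := by
    rw [intervalIntegral.integral_of_le hR.le, integral_Ioc_eq_integral_Ioo]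
    refine integral_congr_ae ?_
    filter_upwards [hu.2] with s hs
    rw [hs]
  have hin : EqOn (fun s => (r ^ (l + 1))⁻¹ * (p s * s ^ (2 * l + 1)))
      (fun s => s ^ 2 * (multipole l r s * u s)) (Ioc 0 r) := fun s hs => by
    have hs0 := hs.1.ne'
    have h := hpu s ⟨hs.1, hs.2.trans hr.2⟩
    simp only [multipole, min_eq_right hs.2, max_eq_left hs.2]
    rw [show p s * s ^ (2 * l + 1) = p s * s ^ l * s ^ (l + 1) by ring, ← h]
    field_simp
    ring
  have hout : EqOn (fun s => r ^ l * p s)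
      (fun s => s ^ 2 * (multipole l r s * u s)) (Ioc r R) := fun s hs => by
    have hs0 := (hr.1.trans hs.1).ne'
    have h := hpu s ⟨hr.1.trans hs.1, hs.2⟩
    simp only [multipole, min_eq_left hs.1.le, max_eq_right hs.1.le]
    have h' : p s = u s * s / s ^ l := by rw [h]; field_simp
    rw [h']
    field_simp
    ring
  have i1 := (intervalIntegrable_mul_pow hq hr).const_mul (r ^ (l + 1))⁻¹
  have i2 := (intervalIntegrable_of_continuousOn_Ioi hp hr.1 hR).const_mul (r ^ l)
  have i1' : IntervalIntegrable (fun s => s ^ 2 * (multipole l r s * u s)) volume 0 r :=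
    i1.congr (by rwa [uIoc_of_le hr.1.le])
  have i2' : IntervalIntegrable (fun s => s ^ 2 * (multipole l r s * u s)) volume r R :=
    i2.congr (by rwa [uIoc_of_le hr.2])
  have e2 : ∫ s in (0 : ℝ)..r, s ^ 2 * (multipole l r s * u s)
      = (r ^ (l + 1))⁻¹ * ∫ s in (0 : ℝ)..r, p s * s ^ (2 * l + 1) := by
    rw [← intervalIntegral.integral_const_mul, intervalIntegral.integral_of_le hr.1.le,
      intervalIntegral.integral_of_le hr.1.le]
    exact (setIntegral_congr_fun measurableSet_Ioc hin).symm
  have e3 : ∫ s in r..R, s ^ 2 * (multipole l r s * u s) = r ^ l * ∫ s in r..R, p s := by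
    rw [← intervalIntegral.integral_const_mul, intervalIntegral.integral_of_le hr.2,
      intervalIntegral.integral_of_le hr.2]
    exact (setIntegral_congr_fun measurableSet_Ioc hout).symm
  have e4 : ∫ s in r..R, p s = c - outerPrim p R c r := by rw [outerPrim]; ring
  rw [e1, ← intervalIntegral.integral_add_adjacent_intervals i1' i2', e2, e3, e4,
    integral_mul_pow_eq hp hR hq hC hr]
  field_simp
  ring

variable {ψ : ℝ → ℝ}

lemma intervalIntegrable_mul_innerMoment (hp : ContinuousOn p (Ioi 0)) (hR : 0 < R)
    (hq : IntegrableOn (fun s => p s * s ^ l) (Ioo 0 R))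
    (hC : ∀ r ∈ Ioc 0 R, |outerPrim p R c r| * r ^ l ≤ C) :
    IntervalIntegrable (fun r => p r * innerMoment p R c l r) volume 0 R := by
  have hC0 : 0 ≤ C := (by positivity : (0 : ℝ) ≤ _).trans (hC R ⟨hR, le_rfl⟩)
  rw [intervalIntegrable_iff_integrableOn_Ioo_of_le hR.le]
  have h1 : IntegrableOn (fun r => p r * r ^ l * (innerMoment p R c l r / r ^ l)) (Ioo 0 R) := by
    refine Integrable.mul_bdd (c := C * R) hq ?_ ?_
    · refine ContinuousOn.aestronglyMeasurable (fun r hr => ?_) measurableSet_Ioo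
      exact ((hasDerivAt_innerMoment hp hR hC hr.1).continuousAt.div (continuous_pow l).continuousAt
        (pow_ne_zero l hr.1.ne')).continuousWithinAt
    filter_upwards [ae_restrict_mem measurableSet_Ioo] with r hr
    have hrl := pow_pos hr.1 l
    rw [norm_div, Real.norm_eq_abs, Real.norm_of_nonneg hrl.le, div_le_iff₀ hrl]
    refine (abs_innerMoment_le hC (Ioo_subset_Ioc_self hr)).trans ?_
    rw [pow_succ, mul_assoc, mul_comm R]
    have := hr.2.le
    gcongr
  refine h1.congr_fun (fun r hr => ?_) measurableSet_Ioo
  have := hr.1.ne'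
  simp only
  field_simp

lemma LambdaIntegrand_eq (hρ : IsLiquidLaneEmden γ R ρ) (hp : ContinuousOn p (Ioi 0))
    (hpu : ∀ s ∈ Ioc 0 R, u s * s = p s * s ^ l)
    (hψ : ∀ r ∈ Ioc 0 R, r ^ (l + 1) * ψ r
      = innerMoment p R c l r - c * r ^ (2 * l + 1) / (2 * l + 1)) {r : ℝ} (hr : r ∈ Ioc 0 R) :
    LambdaIntegrand γ ρ u ψ r = chiIntegrandOne γ R ρ l (chiOf ρ p R c) r
      + 4 * Real.pi * (p r * innerMoment p R c l r - c / (2 * l + 1) * (p r * r ^ (2 * l + 1))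
        + (outerPrim p R c r * r ^ l) ^ 2) := by
  have h1 := hpu r hr
  have h2 := hψ r hr
  have h3 : p r * innerMoment p R c l r - c / (2 * l + 1) * (p r * r ^ (2 * l + 1))
      = u r * ψ r * r ^ 2 := by
    calc _ = p r * (innerMoment p R c l r - c * r ^ (2 * l + 1) / (2 * l + 1)) := by ring
      _ = p r * r ^ l * (r * ψ r) := by rw [← h2]; ring
      _ = _ := by rw [← h1]; ring
  rw [chiIntegrandOne_eq hρ hp hr, h3, ← h1, LambdaIntegrand]
  ring

lemma intervalIntegrable_LambdaIntegrand (hρ : IsLiquidLaneEmden γ R ρ)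
    (hp : ContinuousOn p (Ioi 0)) (hpu : ∀ s ∈ Ioc 0 R, u s * s = p s * s ^ l)
    (hψ : ∀ r ∈ Ioc 0 R, r ^ (l + 1) * ψ r
      = innerMoment p R c l r - c * r ^ (2 * l + 1) / (2 * l + 1))
    (hq : IntegrableOn (fun s => (p s * s ^ l) ^ 2) (Ioo 0 R))
    (hC : ∀ r ∈ Ioc 0 R, |outerPrim p R c r| * r ^ l ≤ C) :
    IntervalIntegrable (LambdaIntegrand γ ρ u ψ) volume 0 R ∧
      ∫ r in (0 : ℝ)..R, LambdaIntegrand γ ρ u ψ r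
        = (∫ r in (0 : ℝ)..R, chiIntegrandOne γ R ρ l (chiOf ρ p R c) r)
          + 4 * Real.pi * (2 * c * innerMoment p R c l R
            - c ^ 2 * R ^ (2 * l + 1) / (2 * l + 1)) := by
  have hR := hρ.radius_pos
  have hC0 : 0 ≤ C := (by positivity : (0 : ℝ) ≤ _).trans (hC R ⟨hR, le_rfl⟩)
  have hq1 : IntegrableOn (fun s => p s * s ^ l) (Ioo 0 R) :=
    integrableOn_of_sq ((hp.mono fun _ hs => hs.1).mul (by fun_prop)) hq
  set T : ℝ → ℝ := fun r => p r * innerMoment p R c l r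
    - c / (2 * l + 1) * (p r * r ^ (2 * l + 1)) + (outerPrim p R c r * r ^ l) ^ 2 with hT
  have i1 := intervalIntegrable_chiIntegrandOne hρ hp hq hC
  have i2 : IntervalIntegrable T volume 0 R :=
    ((intervalIntegrable_mul_innerMoment hp hR hq1 hC).sub
      ((intervalIntegrable_mul_pow hq1 ⟨hR, le_rfl⟩).const_mul _)).add
      ((intervalIntegrable_iff_integrableOn_Ioo_of_le hR.le).2 (integrableOn_outerPrim_sq hp hR hC))
  have heq : EqOn (fun r => chiIntegrandOne γ R ρ l (chiOf ρ p R c) r + 4 * Real.pi * T r)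
      (LambdaIntegrand γ ρ u ψ) (Ioc 0 R) := fun r hr =>
    (LambdaIntegrand_eq hρ hp hpu hψ hr).symm
  refine ⟨(i1.add (i2.const_mul (4 * Real.pi))).congr (by rwa [uIoc_of_le hR.le]), ?_⟩
  have e1 : ∫ r in (0 : ℝ)..R, LambdaIntegrand γ ρ u ψ r
      = ∫ r in (0 : ℝ)..R, (chiIntegrandOne γ R ρ l (chiOf ρ p R c) r + 4 * Real.pi * T r) := by
    rw [intervalIntegral.integral_of_le hR.le, intervalIntegral.integral_of_le hR.le]
    exact (setIntegral_congr_fun measurableSet_Ioc heq).symm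
  rw [e1, intervalIntegral.integral_add i1 (i2.const_mul _), intervalIntegral.integral_const_mul]
  congr 2
  -- an explicit primitive of `T`
  set w := outerPrim p R c with hw
  set M := innerMoment p R c l with hM
  set B : ℝ → ℝ := fun r => w r * M r - c / (2 * l + 1) * (w r * r ^ (2 * l + 1)) + c * M r with hB
  have hder : ∀ r : ℝ, 0 < r → HasDerivAt B (T r) r := fun r hr => by
    have d1 := hasDerivAt_outerPrim hp hR c hr
    have d2 := hasDerivAt_innerMoment hp hR hC hr
    refine (((d1.fun_mul d2).fun_sub ((d1.fun_mul (hasDerivAt_pow (2 * l + 1) r)).const_mul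
      (c / (2 * l + 1)))).fun_add (d2.const_mul c)).congr_deriv ?_
    simp only [hT, ← hw, ← hM]
    push_cast
    field_simp
    ring
  have h0 : Tendsto B (𝓝[>] 0) (𝓝 0) := by
    have t1 : Tendsto (fun r => w r * M r) (𝓝[>] 0) (𝓝 0) := by
      refine tendsto_zero_of_abs_le_mul (C := C * C) hR fun r hr => ?_
      have hr0 := hr.1
      calc |w r * M r| ≤ |w r| * (C * r ^ (l + 1)) := by
            rw [abs_mul]; gcongr; exact abs_innerMoment_le hC hr
        _ = C * (|w r| * r ^ l) * r := by ring
        _ ≤ C * C * r := by gcongr; exact hC r hr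
    have t2 : Tendsto (fun r => w r * r ^ (2 * l + 1)) (𝓝[>] 0) (𝓝 0) := by
      refine tendsto_zero_of_abs_le_mul (C := C * R ^ l) hR fun r hr => ?_
      have hr0 := hr.1
      rw [show 2 * l + 1 = l + (l + 1) by ring]
      refine (abs_outerPrim_mul_pow_le hC (l + 1) hr).trans ?_
      have := pow_le_pow_left₀ hr0.le hr.2 l
      rw [pow_succ, ← mul_assoc]
      gcongr
    have t3 : Tendsto M (𝓝[>] 0) (𝓝 0) := by
      refine tendsto_zero_of_abs_le_mul (C := C * R ^ l) hR fun r hr => ?_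
      have hr0 := hr.1
      refine (abs_innerMoment_le hC hr).trans ?_
      have := pow_le_pow_left₀ hr0.le hr.2 l
      rw [pow_succ, ← mul_assoc]
      gcongr
    simpa using (t1.sub (t2.const_mul (c / (2 * l + 1)))).add (t3.const_mul c)
  rw [intervalIntegral.integral_eq_sub_of_hasDerivAt_of_tendsto hR (fun r hr => hder r hr.1) i2 h0
    ((hder R hR).continuousAt.continuousWithinAt (s := Iio R))]
  simp only [hB, hw, outerPrim_self]
  ring

/-- The boundary energy cancels the boundary term that the potential leaves in the bulk energy. -/
lemma Lambda_add_Gamma (hρ : IsLiquidLaneEmden γ R ρ)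
    (hp : ContinuousOn p (Ioi 0)) (hpu : ∀ s ∈ Ioc 0 R, u s * s = p s * s ^ l)
    (hψ : ∀ r ∈ Ioc 0 R, r ^ (l + 1) * ψ r
      = innerMoment p R c l r - c * r ^ (2 * l + 1) / (2 * l + 1))
    (hq : IntegrableOn (fun s => (p s * s ^ l) ^ 2) (Ioo 0 R))
    (hC : ∀ r ∈ Ioc 0 R, |outerPrim p R c r| * r ^ l ≤ C) (hc : p R = c * radDeriv R ρ R) :
    Lambda γ R ρ u ψ + Gamma γ R ρ l u ψ
      = (∫ r in (0 : ℝ)..R, chiIntegrandOne γ R ρ l (chiOf ρ p R c) r)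
        - γ * radDeriv R ρ R * c ^ 2 * R ^ (2 * l) := by
  have hR := hρ.radius_pos
  have hR' : R ∈ Ioc 0 R := ⟨hR, le_rfl⟩
  have hd := hρ.radDeriv_boundary_ne_zero
  rw [Lambda, (intervalIntegrable_LambdaIntegrand hρ hp hpu hψ hq hC).2]
  have h1 : u R = c * radDeriv R ρ R * R ^ l / R := by
    rw [← hc, ← hpu R hR']; field_simp
  have h2 : innerMoment p R c l R = R ^ (l + 1) * ψ R + c * R ^ (2 * l + 1) / (2 * l + 1) := by
    rw [hψ R hR']; ring
  have h3 : (2 * (l : ℝ) + 1) ≠ 0 := by positivity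
  rw [Gamma, h1, h2]
  field_simp
  ring

end

end LiquidStar

theorem mainTheorem5 (γ R : ℝ) (hγ : γ ∈ Set.Icc (1 : ℝ) 2)
    (ρ : ℝ → ℝ) (hρ : LiquidStar.IsLiquidLaneEmden γ R ρ)
    (θ : LiquidStar.E3 → LiquidStar.E3)
    (hθ : ∀ i : Fin 3, LiquidStar.MemH2 (Metric.ball 0 R) (fun x => θ x i))
    (hdiv : LiquidStar.HasTrace R (LiquidStar.weakDiv (Metric.ball 0 R) θ) (fun _ => 0))
    (l : ℕ) (m : ℤ) (hm : |m| ≤ (l : ℤ)) :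
    ∃ g χ : ℝ → ℝ,
      -- `g` is the mode of `div (ρ θ)`, and `χ` is of class `C¹` up to the boundary
      LiquidStar.IsMode R (LiquidStar.gField R ρ θ) l m g ∧
      ContDiffOn ℝ 1 χ (Set.Ioc 0 R) ∧
      (∀ r ∈ Set.Ioc 0 R,
        g r = LiquidStar.radDeriv R (fun s => ρ s * χ s) r * r ^ ((l : ℤ) - 1)) ∧
      LiquidStar.radDeriv R χ R = 0 ∧
      -- the integrals that occur converge
      IntervalIntegrable (LiquidStar.LambdaIntegrand γ ρ g
        (LiquidStar.sphCoeff (LiquidStar.PsiField R ρ θ) l m)) MeasureTheory.volume 0 R ∧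
      IntervalIntegrable (LiquidStar.chiIntegrandOne γ R ρ l χ) MeasureTheory.volume 0 R ∧
      IntervalIntegrable (LiquidStar.chiIntegrandTwo γ R ρ l χ) MeasureTheory.volume 0 R ∧
      -- the two formulas for the energy of the mode
      LiquidStar.Lambda γ R ρ g (LiquidStar.sphCoeff (LiquidStar.PsiField R ρ θ) l m)
          + LiquidStar.Gamma γ R ρ l g (LiquidStar.sphCoeff (LiquidStar.PsiField R ρ θ) l m)
        = (∫ r in (0 : ℝ)..R, LiquidStar.chiIntegrandOne γ R ρ l χ r)
          - γ * LiquidStar.radDeriv R ρ R * χ R ^ 2 * R ^ (2 * l) ∧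
      LiquidStar.Lambda γ R ρ g (LiquidStar.sphCoeff (LiquidStar.PsiField R ρ θ) l m)
          + LiquidStar.Gamma γ R ρ l g (LiquidStar.sphCoeff (LiquidStar.PsiField R ρ θ) l m)
        = ∫ r in (0 : ℝ)..R, LiquidStar.chiIntegrandTwo γ R ρ l χ r ∧
      -- non-negativity for `l ≥ 1`, of the integrand and of the energy
      (1 ≤ l →
        (∀ r ∈ Set.Ioo 0 R, 0 ≤ LiquidStar.chiIntegrandTwo γ R ρ l χ r) ∧
        0 ≤ LiquidStar.Lambda γ R ρ g (LiquidStar.sphCoeff (LiquidStar.PsiField R ρ θ) l m)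
          + LiquidStar.Gamma γ R ρ l g
              (LiquidStar.sphCoeff (LiquidStar.PsiField R ρ θ) l m)) := by
  have hR := hρ.radius_pos
  obtain ⟨hg2, u, hu⟩ := LiquidStar.exists_isMode_gField hR hρ.smooth hρ.deriv_zero hθ l m
  have hg := LiquidStar.memLp_two_integrableOn hg2
  -- `p = r^(1-l) g_lm`, with `g_lm` continued to the right of `R` by the constant `g_lm(R)`
  set p : ℝ → ℝ := fun s => u (min s R) * s / s ^ l with hp_def
  have hp : ContinuousOn p (Ioi 0) :=
    ((hu.1.comp (by fun_prop) fun s hs => ⟨lt_min hs hR, min_le_right s R⟩).mul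
      continuousOn_id).div (by fun_prop) fun s hs => pow_ne_zero l (ne_of_gt hs)
  have hpu : ∀ s ∈ Ioc 0 R, u s * s = p s * s ^ l := fun s hs => by
    have := hs.1.ne'
    rw [hp_def]
    simp only [min_eq_left hs.2]
    field_simp
  have hq : IntegrableOn (fun s => (p s * s ^ l) ^ 2) (Ioo 0 R) :=
    (hu.integrableOn_sq hg2).congr_fun (fun s hs => by
      simp only
      rw [← hpu s (Ioo_subset_Ioc_self hs), mul_comm]) measurableSet_Ioo
  have hq1 : IntegrableOn (fun s => p s * s ^ l) (Ioo 0 R) :=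
    LiquidStar.integrableOn_of_sq ((hp.mono fun _ hs => hs.1).mul (by fun_prop)) hq
  -- the value of `χ` at `R` that makes `χ'(R)` vanish
  set c : ℝ := p R / LiquidStar.radDeriv R ρ R with hc_def
  have hc : p R = c * LiquidStar.radDeriv R ρ R :=
    (div_mul_cancel₀ _ hρ.radDeriv_boundary_ne_zero).symm
  obtain ⟨C, -, hC⟩ := LiquidStar.exists_abs_outerPrim_mul_pow_le hR hq1 c
  have hψ : ∀ r ∈ Ioc 0 R,
      r ^ (l + 1) * LiquidStar.sphCoeff (LiquidStar.PsiField R ρ θ) l m r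
        = LiquidStar.innerMoment p R c l r - c * r ^ (2 * l + 1) / (2 * l + 1) := fun r hr =>
    LiquidStar.pow_mul_sphCoeff_potential hR hg hu hp hpu hq1 hC hr
  have hR' : R ∈ Ioc 0 R := ⟨hR, le_rfl⟩
  have hχR : LiquidStar.chiOf ρ p R c R = c := by
    rw [LiquidStar.chiOf, LiquidStar.outerPrim_self, hρ.boundary, div_one]
  have hone := LiquidStar.Lambda_add_Gamma hρ hp hpu hψ hq hC hc
  have htwo := LiquidStar.integral_chiIntegrandTwo hρ hp hq hC
  have hnonneg : 1 ≤ l → ∀ r ∈ Ioo 0 R,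
      0 ≤ LiquidStar.chiIntegrandTwo γ R ρ l (LiquidStar.chiOf ρ p R c) r := fun hl r hr =>
    LiquidStar.chiIntegrandTwo_nonneg hρ (zero_le_one.trans hγ.1) hl _ hr
  refine ⟨u, LiquidStar.chiOf ρ p R c, hu, LiquidStar.contDiffOn_chiOf hρ hp, fun r hr => ?_, ?_,
    (LiquidStar.intervalIntegrable_LambdaIntegrand hρ hp hpu hψ hq hC).1,
    LiquidStar.intervalIntegrable_chiIntegrandOne hρ hp hq hC,
    LiquidStar.intervalIntegrable_chiIntegrandTwo hρ hp hq hC, by rw [hχR]; exact hone,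
    hone.trans htwo, fun hl => ⟨hnonneg hl, ?_⟩⟩
  · rw [LiquidStar.radDeriv_mul_chiOf hρ hp hr, zpow_sub_one₀ hr.1.ne', zpow_natCast, ← mul_assoc,
      ← hpu r hr, mul_inv_cancel_right₀ hr.1.ne']
  · rw [LiquidStar.radDeriv_chiOf hρ hp hR', LiquidStar.outerPrim_self, hρ.boundary, mul_one, hc,
      sub_self, zero_div]
  · rw [hone, htwo, intervalIntegral.integral_of_le hR.le, integral_Ioc_eq_integral_Ioo]
    exact setIntegral_nonneg measurableSet_Ioo (hnonneg hl)
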